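/- **Conventions.** $\Gamma$ is a discrete group with the icc property: every conjugacy class other than $\{e\}$ is infinite. A tracial von Neumann algebra $(P,\tau)$ is a von Neumann algebra $P\subseteq B(H)$ with a faithful normal tracial state $\tau$; $L^2(P)$ is the completion of $P$ for $\|x\|_2=\tau(x^*x)^{1/2}$. An extension $\Gamma\curvearrowright^\sigma(P_0\subseteq P)$ of tracial von Neumann algebras is a $\tau$-preserving action $\sigma$ of $\Gamma$ on $P$ by $*$-automorphisms together with a $\Gamma$-invariant (unital) von Neumann subalgebra $P_0\subseteq P$. It is *compact* if there is a set $\mathcal F\subseteq P$ whose linear span is $\|\cdot\|_2$-dense in $L^2(P)$ such that for every $f\in\mathcal F$ and $\varepsilon>0$ there are $\xi_1,\dots,\xi_n\in L^2(P)$ and, for every $\gamma\in\Gamma$, elements $\kappa_1(\gamma),\dots,\kappa_n(\gamma)\in P_0$ with $\sup_{i,\gamma}\|\kappa_i(\gamma)\|_\infty<\infty$ and $\|\sigma_\gamma(f)-\sum_i\kappa_i(\gamma)\xi_i\|_2\le\varepsilon$ for all $\gamma\in\Gamma$. For a von Neumann subalgebra $Q\subseteq P$, $Q\rtimes\Gamma$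 denotes the von Neumann algebra on $\ell^2(\Gamma,H)$ generated by the operators $(\pi(a)\xi)(h)=\sigma_{h^{-1}}(a)\xi(h)$ ($a\in Q$) and $(\lambda_g\xi)(h)=\xi(g^{-1}h)$ ($g\in\Gamma$). For probability measure preserving (pmp) actions, a factor map $\pi:(X,\mu)\to(X_0,\mu_0)$ is a measure preserving map with $\pi(\gamma x)=\gamma\pi(x)$ for almost every $x$, for each $\gamma\in\Gamma$; it embeds $L^\infty(X_0)$ in $L^\infty(X)$ by $f\mapsto f\circ\pi$. Both algebras act by multiplication on $L^2(X,\mu)$; $\Gamma$ acts on $L^\infty(X)$ by $\sigma_\gamma(f)=f\circ\gamma^{-1}$, and the trace is integration. The extension $\pi$ is *compact* if there is a dense set of $f\in L^2(X,\mu)$ with the following property: for every $\varepsilon>0$ there are $\xi_1,\dots,\xi_n\in L^2(X,\mu)$ such that for every $\gamma\in\Gamma$, almost everywhere, $\min_j \mathbb E\big(|f\circ\gamma^{-1}-\xi_j|^2\,\big|\,X_0\big)<\varepsilon^2$. **Theorem.** Let $\Gamma$ be an icc group. 1. Let $\Gamma\curvearrowright(P_0\subseteq P)$ be a compact extension of tracial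 von Neumann algebras. Then for every von Neumann algebra $N$ with $P_0\rtimes\Gamma\subseteq N\subseteq P\rtimes\Gamma$ there is a $\Gamma$-invariant von Neumann algebra $P_0\subseteq Q\subseteq P$ such that $N=Q\rtimes\Gamma$. 2. Let $\Gamma\curvearrowright(X,\mu)$ and $\Gamma\curvearrowright(X_0,\mu_0)$ be pmp actions on probability spaces and $\pi:X\to X_0$ a factor map. * If $\Gamma\curvearrowright X$ is ergodic and the extension $\pi$ is compact, then $\Gamma\curvearrowright(L^\infty(X_0)\subseteq L^\infty(X))$ is a compact extension of tracial von Neumann algebras. * If $\Gamma\curvearrowright(L^\infty(X_0)\subseteq L^\infty(X))$ is a compact extension of tracial von Neumann algebras, then for every von Neumann algebra $N$ with $L^\infty(X_0)\rtimes\Gamma\subseteq N\subseteq L^\infty(X)\rtimes\Gamma$ there are a pmp action $\Gamma\curvearrowright(Z,\nu)$ on a probability space and factor maps $\pi_1:X\to Z$, $\pi_2:Z\to X_0$ with $\pi_2\circ\pi_1=\pi$ and $N=L^\infty(Z)\rtimes\Gamma$. If $\Gamma$ is countable and $X,X_0$ are standard Borel spaces, then $Z$ can be taken to be a standard Borel space.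 In particular, the last conclusion holds whenever $\Gamma\curvearrowright X$ is an ergodic compact extension of $\Gamma\curvearrowright X_0$. -/

import Mathlib

open MeasureTheory Filter
open scoped ENNReal InnerProductSpace ComplexOrder

universe u v w

section Algebras

variable {H : Type*} [NormedAddCommGroup H] [InnerProductSpace ℂ H] [CompleteSpace H]

instance VonNeumannAlgebra.instSMulMemClass :
    SMulMemClass (VonNeumannAlgebra H) ℂ (H →L[ℂ] H) where
  smul_mem {S} c _ hx := S.toStarSubalgebra.smul_mem hx c

instance VonNeumannAlgebra.isClosed_coe (P : VonNeumannAlgebra H) :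
    IsClosed (P : Set (H →L[ℂ] H)) := by
  rw [← P.centralizer_centralizer]
  exact Set.isClosed_centralizer _


/-- The order on `P` is the usual order of self-adjoint operators on `H`. -/
instance VonNeumannAlgebra.instStarOrderedRing (P : VonNeumannAlgebra H) : StarOrderedRing P := by
  refine .of_nonneg_iff' (fun {x y} h z => ?_) fun x => ⟨fun h => ?_, ?_⟩
  · exact add_le_add_right (show (x : H →L[ℂ] H) ≤ y from h) (z : H →L[ℂ] H)
  · have h0 : (0 : H →L[ℂ] H) ≤ x := h
    have hs : CFC.sqrt (x : H →L[ℂ] H) ∈ P := by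
      rw [← SetLike.mem_coe, ← P.centralizer_centralizer]
      intro y hy
      have hc : Commute (x : H →L[ℂ] H) y := hy _ x.2
      exact (Commute.cfcₙ_nnreal hc _).symm
    refine ⟨⟨_, hs⟩, Subtype.ext ?_⟩
    have h1 : star (CFC.sqrt (x : H →L[ℂ] H)) = CFC.sqrt (x : H →L[ℂ] H) :=
      (CFC.sqrt_nonneg _).isSelfAdjoint
    show (x : H →L[ℂ] H) = star (CFC.sqrt (x : H →L[ℂ] H)) * CFC.sqrt (x : H →L[ℂ] H)
    rw [h1, CFC.sqrt_mul_sqrt_self _ h0]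
  · rintro ⟨s, rfl⟩
    exact star_mul_self_nonneg (s : H →L[ℂ] H)

/-- The commutant of a set of operators together with their adjoints. -/
noncomputable def commutantOf (S : Set (H →L[ℂ] H)) : VonNeumannAlgebra H where
  toStarSubalgebra := StarSubalgebra.centralizer ℂ S
  centralizer_centralizer' := by
    show Set.centralizer (Set.centralizer (S ∪ star S).centralizer) = (S ∪ star S).centralizer
    exact Set.centralizer_centralizer_centralizer _

/-- The von Neumann algebra generated by a set of operators: the double commutant of `S ∪ S⋆`. -/
noncomputable def vnGenerated (S : Set (H →L[ℂ] H)) : VonNeumannAlgebra H :=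
  (commutantOf S).commutant

theorem coe_commutantOf (S : Set (H →L[ℂ] H)) :
    (commutantOf S : Set (H →L[ℂ] H)) = Set.centralizer (S ∪ star S) := rfl

theorem mem_commutantOf {S : Set (H →L[ℂ] H)} {x : H →L[ℂ] H} :
    x ∈ commutantOf S ↔ ∀ s ∈ S, s * x = x * s ∧ star s * x = x * star s := by
  rw [← SetLike.mem_coe, coe_commutantOf, Set.mem_centralizer_iff]
  constructor
  · intro h s hs
    exact ⟨h s (Or.inl hs), h _ (Or.inr (by simpa using hs))⟩
  · rintro h s (hs | hs)
    · exact (h s hs).1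
    · simpa using (h _ hs).2

theorem mem_vnGenerated {S : Set (H →L[ℂ] H)} {x : H →L[ℂ] H} :
    x ∈ vnGenerated S ↔ ∀ y ∈ commutantOf S, y * x = x * y :=
  VonNeumannAlgebra.mem_commutant_iff

theorem subset_vnGenerated (S : Set (H →L[ℂ] H)) {x : H →L[ℂ] H} (hx : x ∈ S) :
    x ∈ vnGenerated S :=
  mem_vnGenerated.2 fun _ hy => ((mem_commutantOf.1 hy) x hx).1.symm

theorem vnGenerated_mono {S T : Set (H →L[ℂ] H)} (h : S ⊆ T) : vnGenerated S ≤ vnGenerated T :=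
  fun _ hx => mem_vnGenerated.2 fun y hy =>
    mem_vnGenerated.1 hx y (mem_commutantOf.2 fun s hs => mem_commutantOf.1 hy s (h hs))

/-- A faithful normal tracial state on `P`; normality is continuity for the ultraweak
(`σ`-weak) topology of `B(H)`. -/
structure TracialState (P : VonNeumannAlgebra H) where
  toPositive : P →ₚ[ℂ] ℂ
  map_one : toPositive 1 = 1
  map_mul_comm : ∀ a b : P, toPositive (a * b) = toPositive (b * a)
  faithful : ∀ a : P, toPositive (star a * a) = 0 → a = 0
  normal : ∃ ξ η : ℕ → H, Summable (fun n => ‖ξ n‖ ^ 2) ∧ Summable (fun n => ‖η n‖ ^ 2) ∧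
    ∀ a : P, toPositive a = ∑' n, ⟪ξ n, (a : H →L[ℂ] H) (η n)⟫_ℂ

namespace TracialState

variable {P : VonNeumannAlgebra H} (τ : TracialState P)

/-- `L²(P, τ)`: the completion of `P` for `⟨a, b⟩ = τ(a⋆ b)`. -/
abbrev L2 : Type _ := τ.toPositive.GNS

/-- The canonical map `P → L²(P, τ)`. -/
noncomputable def toL2 (a : P) : τ.L2 := (τ.toPositive.toPreGNS a : τ.toPositive.GNS)

/-- Left multiplication of vectors of `L²(P, τ)` by elements of `P`. -/
noncomputable def lmul (a : P) : τ.L2 →L[ℂ] τ.L2 := τ.toPositive.gnsStarAlgHom a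

end TracialState

end Algebras

section CrossedProduct

variable {Γ : Type*} {H : Type*} [NormedAddCommGroup H] [InnerProductSpace ℂ H]

/-- `Γ ↷ P` by `⋆`-automorphisms. -/
abbrev VNAction (Γ : Type*) [Group Γ] [CompleteSpace H] (P : VonNeumannAlgebra H) := Γ →* (P ≃⋆ₐ[ℂ] P)

/-- The Hilbert space `ℓ²(Γ, H) = ℓ²(Γ) ⊗ H`. -/
abbrev EllTwo (Γ H : Type*) [NormedAddCommGroup H] : Type _ := lp (fun _ : Γ => H) 2

/-- `(ξ_h)_h ↦ (T_h ξ_h)_h` for a uniformly bounded family of operators `T_h`. -/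
noncomputable def diagOp (T : Γ → H →L[ℂ] H) (C : ℝ) (hT : ∀ h, ‖T h‖ ≤ C) :
    EllTwo Γ H →L[ℂ] EllTwo Γ H :=
  have key : ∀ (ξ : EllTwo Γ H) (h : Γ), ‖T h (ξ h)‖ ≤ ‖((C : ℂ) • ξ) h‖ := fun ξ h => by
    have hC : 0 ≤ C := (norm_nonneg _).trans (hT h)
    calc ‖T h (ξ h)‖ ≤ C * ‖ξ h‖ := (T h).le_of_opNorm_le (hT h) _
      _ = ‖((C : ℂ) • ξ) h‖ := by
        rw [lp.coeFn_smul, Pi.smul_apply, norm_smul, Complex.norm_real, Real.norm_of_nonneg hC]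
  LinearMap.mkContinuous
    { toFun := fun ξ => ⟨fun h => T h (ξ h), (lp.memℓp ((C : ℂ) • ξ)).mono' (key ξ)⟩
      map_add' := fun ξ η => lp.ext (funext fun h => map_add (T h) (ξ h) (η h))
      map_smul' := fun c ξ => lp.ext (funext fun h => map_smul (T h) c (ξ h)) } ‖(C : ℂ)‖ fun ξ => by
    rw [← norm_smul]
    exact lp.norm_mono (by norm_num) (key ξ)

@[simp] theorem diagOp_apply (T : Γ → H →L[ℂ] H) (C : ℝ) (hT : ∀ h, ‖T h‖ ≤ C)
    (ξ : EllTwo Γ H) (h : Γ) : diagOp T C hT ξ h = T h (ξ h) := rfl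

variable [Group Γ]

/-- The operator `λ_g` of left translation by `g`: `(λ_g ξ)(h) = ξ(g⁻¹ h)`. -/
noncomputable def translationOp (g : Γ) : EllTwo Γ H →L[ℂ] EllTwo Γ H :=
  have mem : ∀ ξ : EllTwo Γ H, Memℓp (fun h => ξ (g⁻¹ * h)) 2 := fun ξ => by
    have h2 : 0 < (2 : ℝ≥0∞).toReal := by norm_num
    exact memℓp_gen (((lp.memℓp ξ).summable h2).comp_injective (mul_right_injective g⁻¹))
  LinearMap.mkContinuous
    { toFun := fun ξ => ⟨fun h => ξ (g⁻¹ * h), mem ξ⟩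
      map_add' := fun _ _ => rfl
      map_smul' := fun _ _ => rfl } 1 fun ξ => by
    have h2 : 0 < (2 : ℝ≥0∞).toReal := by norm_num
    rw [one_mul, lp.norm_eq_tsum_rpow h2, lp.norm_eq_tsum_rpow h2]
    exact le_of_eq (congrArg (fun t : ℝ => t ^ (1 / (2 : ℝ≥0∞).toReal))
      ((Equiv.mulLeft g⁻¹).tsum_eq fun h => ‖ξ h‖ ^ (2 : ℝ≥0∞).toReal))

@[simp] theorem translationOp_apply (g : Γ) (ξ : EllTwo Γ H) (h : Γ) :
    translationOp g ξ h = ξ (g⁻¹ * h) := rfl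

variable [CompleteSpace H] {P : VonNeumannAlgebra H}

theorem VNAction.norm_le (σ : VNAction Γ P) (g : Γ) (a : P) :
    ‖((σ g a : P) : H →L[ℂ] H)‖ ≤ ‖a‖ :=
  NonUnitalStarAlgHom.norm_apply_le (σ g) a

/-- The copy of `a ∈ P` in the crossed product: `(π(a) ξ)(h) = σ_{h⁻¹}(a) ξ(h)`. -/
noncomputable def VNAction.coeffOp (σ : VNAction Γ P) (a : P) :
    EllTwo Γ H →L[ℂ] EllTwo Γ H :=
  diagOp (fun h => ((σ h⁻¹ a : P) : H →L[ℂ] H)) ‖a‖ fun h => σ.norm_le h⁻¹ a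

/-- `Q ⋊ Γ` for a subalgebra `Q` of `P`, inside `P ⋊ Γ`: the von Neumann algebra on `ℓ²(Γ, H)`
generated by the `π(a)`, `a ∈ Q`, and the `λ_g`, `g ∈ Γ`.  For `Q = P` this is `P ⋊ Γ`. -/
noncomputable def VNAction.crossedProduct (σ : VNAction Γ P) (Q : VonNeumannAlgebra H) :
    VonNeumannAlgebra (EllTwo Γ H) :=
  vnGenerated ({T | ∃ a : P, (a : H →L[ℂ] H) ∈ Q ∧ T = σ.coeffOp a} ∪
    Set.range fun g : Γ => translationOp g)

/-- The action leaves the subalgebra `Q` of `P` invariant. -/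
def VNAction.Invariant (σ : VNAction Γ P) (Q : VonNeumannAlgebra H) : Prop :=
  ∀ (g : Γ) (a : P), (a : H →L[ℂ] H) ∈ Q → ((σ g a : P) : H →L[ℂ] H) ∈ Q

/-- The action preserves the trace. -/
def VNAction.TracePreserving (σ : VNAction Γ P) (τ : TracialState P) : Prop :=
  ∀ (g : Γ) (a : P), τ.toPositive (σ g a) = τ.toPositive a

/-- The extension `Γ ↷ (P₀ ⊆ P, τ)` is compact. -/
def VNAction.IsCompactExtension (σ : VNAction Γ P) (τ : TracialState P)
    (P₀ : VonNeumannAlgebra H) : Prop :=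
  ∃ F : Set P,
    closure (Submodule.span ℂ (τ.toL2 '' F) : Set τ.L2) = Set.univ ∧
    ∀ f ∈ F, ∀ ε : ℝ, 0 < ε → ∃ (n : ℕ) (ξ : Fin n → τ.L2) (κ : Fin n → Γ → P),
      (∀ i g, (κ i g : H →L[ℂ] H) ∈ P₀) ∧ (∃ C : ℝ, ∀ i g, ‖κ i g‖ ≤ C) ∧
      ∀ g, ‖τ.toL2 (σ g f) - ∑ i, τ.lmul (κ i g) (ξ i)‖ ≤ ε

/-- Every conjugacy class other than that of the identity is infinite. -/
def IsICC (Γ : Type*) [Group Γ] : Prop :=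
  ∀ g : Γ, g ≠ 1 → (conjugatesOf g).Infinite

/-- The action `x ↦ u_g x u_g⋆` on a von Neumann algebra normalised by a unitary
representation `u`. -/
noncomputable def adAction (u : Γ →* unitary (H →L[ℂ] H)) (P : VonNeumannAlgebra H)
    (hP : ∀ g, ∀ x ∈ P, (u g : H →L[ℂ] H) * x * star (u g : H →L[ℂ] H) ∈ P) : VNAction Γ P where
  toFun g :=
    { toFun := fun x => ⟨Unitary.conjStarAlgAut ℂ _ (u g) x, hP g x x.2⟩
      invFun := fun x => ⟨Unitary.conjStarAlgAut ℂ _ (u g⁻¹) x, hP g⁻¹ x x.2⟩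
      left_inv := fun x => Subtype.ext <| by
        show Unitary.conjStarAlgAut ℂ _ (u g⁻¹) (Unitary.conjStarAlgAut ℂ _ (u g) x) = x
        rw [← Unitary.conjStarAlgAut_mul_apply, ← map_mul]; simp
      right_inv := fun x => Subtype.ext <| by
        show Unitary.conjStarAlgAut ℂ _ (u g) (Unitary.conjStarAlgAut ℂ _ (u g⁻¹) x) = x
        rw [← Unitary.conjStarAlgAut_mul_apply, ← map_mul]; simp
      map_mul' := fun x y => Subtype.ext <| map_mul (Unitary.conjStarAlgAut ℂ _ (u g)) _ _
      map_add' := fun x y => Subtype.ext <| map_add (Unitary.conjStarAlgAut ℂ _ (u g)) _ _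
      map_star' := fun x => Subtype.ext <| map_star (Unitary.conjStarAlgAut ℂ _ (u g)) _
      map_smul' := fun c x => Subtype.ext <| map_smul (Unitary.conjStarAlgAut ℂ _ (u g)) c _ }
  map_one' := by
    ext x
    show Unitary.conjStarAlgAut ℂ _ (u 1) (x : H →L[ℂ] H) _ = _
    simp
  map_mul' g h := by
    refine StarAlgEquiv.ext fun x => Subtype.ext ?_
    show Unitary.conjStarAlgAut ℂ _ (u (g * h)) (x : H →L[ℂ] H) =
      Unitary.conjStarAlgAut ℂ _ (u g) (Unitary.conjStarAlgAut ℂ _ (u h) x)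
    rw [map_mul, Unitary.conjStarAlgAut_mul_apply]

@[simp] theorem coe_adAction_apply (u : Γ →* unitary (H →L[ℂ] H)) (P : VonNeumannAlgebra H)
    (hP : ∀ g, ∀ x ∈ P, (u g : H →L[ℂ] H) * x * star (u g : H →L[ℂ] H) ∈ P) (g : Γ) (x : P) :
    ((adAction u P hP g x : P) : H →L[ℂ] H) =
      (u g : H →L[ℂ] H) * x * star (u g : H →L[ℂ] H) := rfl

end CrossedProduct

section Measure

variable {X : Type*} [MeasurableSpace X]

/-- Multiplication by `f ∈ L^∞(X, μ)` on `L²(X, μ)`. -/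
noncomputable def mulOp (μ : Measure X) : Lp ℂ ∞ μ →L[ℂ] Lp ℂ 2 μ →L[ℂ] Lp ℂ 2 μ :=
  (ContinuousLinearMap.mul ℂ ℂ).holderL μ ∞ 2 2

theorem mulOp_apply_ae {μ : Measure X} (f : Lp ℂ ∞ μ) (ξ : Lp ℂ 2 μ) :
    mulOp μ f ξ =ᵐ[μ] fun x => f x * ξ x :=
  (ContinuousLinearMap.mul ℂ ℂ).coeFn_holder f ξ

/-- `L^∞(X, μ)` acting by multiplication on `L²(X, μ)`.  (These multiplications already form
a von Neumann algebra.) -/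
noncomputable def linfty (μ : Measure X) : VonNeumannAlgebra (Lp ℂ 2 μ) :=
  vnGenerated (Set.range (mulOp μ))

variable {Z : Type*} [MeasurableSpace Z]

/-- For a measure preserving `π : (X, μ) → (Z, ν)`, the subalgebra `L^∞(Z, ν)` of `L^∞(X, μ)`:
the multiplications by the functions `f ∘ π` with `f ∈ L^∞(Z, ν)`. -/
noncomputable def linftyOfFactor {μ : Measure X} {ν : Measure Z} (π : X → Z)
    (hπ : MeasurePreserving π μ ν) : VonNeumannAlgebra (Lp ℂ 2 μ) :=
  vnGenerated (Set.range fun f : Lp ℂ ∞ ν => mulOp μ (Lp.compMeasurePreserving π hπ f))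

theorem linftyOfFactor_le {μ : Measure X} {ν : Measure Z} (π : X → Z)
    (hπ : MeasurePreserving π μ ν) : linftyOfFactor π hπ ≤ linfty μ :=
  vnGenerated_mono <| by rintro _ ⟨f, rfl⟩; exact ⟨_, rfl⟩

theorem mulOp_comm {μ : Measure X} (f g : Lp ℂ ∞ μ) :
    mulOp μ f * mulOp μ g = mulOp μ g * mulOp μ f := by
  ext1 ξ
  apply Lp.ext
  simp only [mul_apply_eq_comp]
  filter_upwards [mulOp_apply_ae f (mulOp μ g ξ), mulOp_apply_ae g (mulOp μ f ξ),
    mulOp_apply_ae f ξ, mulOp_apply_ae g ξ] with x h1 h2 h3 h4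
  rw [h1, h2, h3, h4]; ring

theorem star_mulOp {μ : Measure X} (f : Lp ℂ ∞ μ) : star (mulOp μ f) = mulOp μ (star f) := by
  rw [ContinuousLinearMap.star_eq_adjoint]
  symm
  rw [ContinuousLinearMap.eq_adjoint_iff]
  intro ξ η
  rw [L2.inner_def, L2.inner_def]
  apply integral_congr_ae
  filter_upwards [mulOp_apply_ae (star f) ξ, mulOp_apply_ae f η, Lp.coeFn_star f] with x h1 h2 h3
  rw [h1, h2, h3]
  simp only [Pi.star_apply, RCLike.inner_apply, map_mul, RCLike.star_def, RCLike.conj_conj]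
  ring

/-- The elements of `L^∞(X, μ)` commute with each other. -/
theorem linfty_mul_comm {μ : Measure X} {S T : Lp ℂ 2 μ →L[ℂ] Lp ℂ 2 μ}
    (hS : S ∈ linfty μ) (hT : T ∈ linfty μ) : S * T = T * S := by
  have h1 : ∀ U ∈ linfty μ, U ∈ commutantOf (Set.range (mulOp μ)) := fun U hU =>
    mem_commutantOf.2 <| by
      rintro _ ⟨f, rfl⟩
      have hm : ∀ g : Lp ℂ ∞ μ, mulOp μ g ∈ commutantOf (Set.range (mulOp μ)) := fun g =>
        mem_commutantOf.2 <| by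
          rintro _ ⟨f, rfl⟩
          rw [star_mulOp]
          exact ⟨mulOp_comm _ _, mulOp_comm _ _⟩
      rw [star_mulOp]
      exact ⟨mem_vnGenerated.1 hU _ (hm f), mem_vnGenerated.1 hU _ (hm (star f))⟩
  exact mem_vnGenerated.1 hT S (h1 S hS)

/-- The constant function `1` in `L²(X, μ)`. -/
noncomputable def oneL2 (μ : Measure X) [IsProbabilityMeasure μ] : Lp ℂ 2 μ := Lp.const 2 μ 1

/-- An element of `L^∞(X, μ)` that kills the constant function `1` is zero. -/
theorem eq_zero_of_apply_one {μ : Measure X} [IsProbabilityMeasure μ]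
    {T : Lp ℂ 2 μ →L[ℂ] Lp ℂ 2 μ} (hT : T ∈ linfty μ) (h : T (oneL2 μ) = 0) : T = 0 := by
  ext1 ξ
  induction ξ using Lp.induction (by norm_num : (2 : ℝ≥0∞) ≠ ∞) with
  | indicatorConst c hs hμs => 
    rename_i s
    have hf : mulOp μ (indicatorConstLp ∞ hs hμs.ne c) (oneL2 μ) =
        indicatorConstLp 2 hs hμs.ne c := by
      apply Lp.ext
      filter_upwards [mulOp_apply_ae (indicatorConstLp ∞ hs hμs.ne c) (oneL2 μ),
        indicatorConstLp_coeFn (p := ∞) (hs := hs) (hμs := hμs.ne) (c := c),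
        indicatorConstLp_coeFn (p := 2) (hs := hs) (hμs := hμs.ne) (c := c),
        Lp.coeFn_const (p := 2) (μ := μ) (1 : ℂ)] with x h1 h2 h3 h4
      rw [h1, h2, h3, oneL2, h4]; simp
    have hc := linfty_mul_comm hT (subset_vnGenerated _ ⟨indicatorConstLp ∞ hs hμs.ne c, rfl⟩)
    have := congrArg (fun S => S (oneL2 μ)) hc
    simp only [mul_apply_eq_comp, hf, h, map_zero] at this
    simpa using this
  | add hf hg _ h1 h2 =>
    rw [map_add, h1, h2]; simp
  | isClosed => exact isClosed_eq T.continuous continuous_const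

theorem oneL2_ae (μ : Measure X) [IsProbabilityMeasure μ] : oneL2 μ =ᵐ[μ] fun _ => 1 :=
  Lp.coeFn_const (p := 2) (μ := μ) (1 : ℂ)

theorem inner_oneL2_self (μ : Measure X) [IsProbabilityMeasure μ] :
    ⟪oneL2 μ, oneL2 μ⟫_ℂ = 1 := by
  rw [L2.inner_def, integral_congr_ae (g := fun _ => (1 : ℂ))]
  · simp
  · filter_upwards [oneL2_ae μ] with x hx
    rw [hx]; simp

/-- Integration with respect to `μ`, as a tracial state on `L^∞(X, μ)`:
`T ↦ ⟨1, T 1⟩`, that is `f ↦ ∫ f dμ`. -/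
noncomputable def integralState (μ : Measure X) [IsProbabilityMeasure μ] :
    TracialState (linfty μ) where
  toPositive := .mk₀
    { toFun := fun T => ⟪oneL2 μ, (T : Lp ℂ 2 μ →L[ℂ] Lp ℂ 2 μ) (oneL2 μ)⟫_ℂ
      map_add' := fun S T => by simp [inner_add_right]
      map_smul' := fun c T => by simp [inner_smul_right] } fun T hT => by
    have h : (0 : Lp ℂ 2 μ →L[ℂ] Lp ℂ 2 μ) ≤ T := hT
    exact ((ContinuousLinearMap.nonneg_iff_isPositive _).1 h).inner_nonneg_right _
  map_one := inner_oneL2_self μ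
  map_mul_comm a b := by
    rw [show a * b = b * a from Subtype.ext (linfty_mul_comm a.2 b.2)]
  faithful a ha := by
    apply Subtype.ext
    apply eq_zero_of_apply_one a.2
    rw [← inner_self_eq_zero (𝕜 := ℂ), ← ContinuousLinearMap.adjoint_inner_right]
    exact ha
  normal := by
    refine ⟨fun n => if n = 0 then oneL2 μ else 0, fun n => if n = 0 then oneL2 μ else 0,
      ?_, ?_, fun a => ?_⟩
    · exact summable_of_ne_finset_zero (s := {0}) fun n hn => by simp_all
    · exact summable_of_ne_finset_zero (s := {0}) fun n hn => by simp_all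
    · rw [tsum_eq_single 0 fun n hn => by simp [hn]]
      rfl

end Measure

section Koopman

variable {Γ : Type*} [Group Γ]
variable {X : Type*} [MeasurableSpace X] [MulAction Γ X] [MeasurableConstSMul Γ X]

theorem compMP_comp {μ : Measure X} {p : ℝ≥0∞} {a b c : X → X} (ha : MeasurePreserving a μ μ)
    (hb : MeasurePreserving b μ μ) (hc : MeasurePreserving c μ μ) (h : ∀ x, b (a x) = c x)
    (ξ : Lp ℂ p μ) :
    Lp.compMeasurePreserving a ha (Lp.compMeasurePreserving b hb ξ) =
      Lp.compMeasurePreserving c hc ξ := by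
  apply Lp.ext
  filter_upwards [Lp.coeFn_compMeasurePreserving (Lp.compMeasurePreserving b hb ξ) ha,
    ha.quasiMeasurePreserving.ae_eq_comp (Lp.coeFn_compMeasurePreserving ξ hb),
    Lp.coeFn_compMeasurePreserving ξ hc] with x h1 h2 h3
  rw [h1, h2, h3]
  simp [h]

theorem compMP_id {μ : Measure X} {p : ℝ≥0∞} {a : X → X} (ha : MeasurePreserving a μ μ)
    (h : ∀ x, a x = x) (ξ : Lp ℂ p μ) : Lp.compMeasurePreserving a ha ξ = ξ := by
  apply Lp.ext
  filter_upwards [Lp.coeFn_compMeasurePreserving ξ ha] with x h1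
  rw [h1]; simp [h]

variable (Γ)

/-- The Koopman representation of `Γ` on `L²(X, μ)`: `(u_g ξ)(x) = ξ(g⁻¹ x)`. -/
noncomputable def koopman (μ : Measure X) [SMulInvariantMeasure Γ X μ] :
    Γ →* unitary (Lp ℂ 2 μ →L[ℂ] Lp ℂ 2 μ) :=
  Unitary.linearIsometryEquiv.symm.toMonoidHom.comp
    { toFun := fun g =>
        { Lp.compMeasurePreservingₗᵢ ℂ (g⁻¹ • · : X → X) (measurePreserving_smul g⁻¹ μ) with
          invFun := Lp.compMeasurePreserving (g • · : X → X) (measurePreserving_smul g μ)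
          left_inv := fun ξ =>
            (compMP_comp _ _ (MeasurePreserving.id μ) (fun x => inv_smul_smul g x) ξ).trans
              (compMP_id _ (fun _ => rfl) ξ)
          right_inv := fun ξ =>
            (compMP_comp _ _ (MeasurePreserving.id μ) (fun x => smul_inv_smul g x) ξ).trans
              (compMP_id _ (fun _ => rfl) ξ) }
      map_one' := LinearIsometryEquiv.ext fun ξ =>
        compMP_id (measurePreserving_smul (1 : Γ)⁻¹ μ) (fun x => by simp) ξ
      map_mul' := fun g h => LinearIsometryEquiv.ext fun ξ =>
        (compMP_comp (measurePreserving_smul g⁻¹ μ) (measurePreserving_smul h⁻¹ μ)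
          (measurePreserving_smul (g * h)⁻¹ μ) (fun x => by simp [mul_smul]) ξ).symm }

theorem koopman_apply_ae (μ : Measure X) [SMulInvariantMeasure Γ X μ] (g : Γ) (ξ : Lp ℂ 2 μ) :
    (koopman Γ μ g : Lp ℂ 2 μ →L[ℂ] Lp ℂ 2 μ) ξ =ᵐ[μ] fun x => ξ (g⁻¹ • x) :=
  Lp.coeFn_compMeasurePreserving ξ (measurePreserving_smul g⁻¹ μ)

/-- `u_g M_f u_g⋆ = M_{f ∘ g⁻¹}`. -/
theorem koopman_conj_mulOp (μ : Measure X) [SMulInvariantMeasure Γ X μ] (g : Γ)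
    (f : Lp ℂ ∞ μ) :
    (koopman Γ μ g : Lp ℂ 2 μ →L[ℂ] Lp ℂ 2 μ) * mulOp μ f *
        star (koopman Γ μ g : Lp ℂ 2 μ →L[ℂ] Lp ℂ 2 μ) =
      mulOp μ (Lp.compMeasurePreserving (g⁻¹ • · : X → X) (measurePreserving_smul g⁻¹ μ) f) := by
  have key : (koopman Γ μ g : Lp ℂ 2 μ →L[ℂ] Lp ℂ 2 μ) * mulOp μ f =
      mulOp μ (Lp.compMeasurePreserving (g⁻¹ • · : X → X) (measurePreserving_smul g⁻¹ μ) f) *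
        (koopman Γ μ g : Lp ℂ 2 μ →L[ℂ] Lp ℂ 2 μ) := by
    ext1 ξ
    apply Lp.ext
    simp only [mul_apply_eq_comp]
    filter_upwards [koopman_apply_ae Γ μ g (mulOp μ f ξ), koopman_apply_ae Γ μ g ξ,
      (measurePreserving_smul g⁻¹ μ).quasiMeasurePreserving.ae_eq_comp (mulOp_apply_ae f ξ),
      mulOp_apply_ae
        (Lp.compMeasurePreserving (g⁻¹ • · : X → X) (measurePreserving_smul g⁻¹ μ) f)
        ((koopman Γ μ g : Lp ℂ 2 μ →L[ℂ] Lp ℂ 2 μ) ξ),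
      Lp.coeFn_compMeasurePreserving f (measurePreserving_smul g⁻¹ μ)] with x h1 h2 h3 h4 h5
    rw [h1, h4, h2, h5]
    exact h3
  rw [key, mul_assoc, Unitary.mul_star_self_of_mem (koopman Γ μ g).2, mul_one]

theorem koopman_conj_mem (μ : Measure X) [SMulInvariantMeasure Γ X μ] (g : Γ) :
    ∀ T ∈ linfty μ, (koopman Γ μ g : Lp ℂ 2 μ →L[ℂ] Lp ℂ 2 μ) * T *
      star (koopman Γ μ g : Lp ℂ 2 μ →L[ℂ] Lp ℂ 2 μ) ∈ linfty μ := by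
  intro T hT
  set u := (koopman Γ μ g : Lp ℂ 2 μ →L[ℂ] Lp ℂ 2 μ) with hu
  have hu1 : star u * u = 1 := Unitary.star_mul_self_of_mem (koopman Γ μ g).2
  have hu2 : u * star u = 1 := Unitary.mul_star_self_of_mem (koopman Γ μ g).2
  refine mem_vnGenerated.2 fun y hy => ?_
  have hy' : star u * y * u ∈ commutantOf (Set.range (mulOp μ)) := mem_commutantOf.2 <| by
    have h1 : ∀ f, mulOp μ f * (star u * y * u) = star u * y * u * mulOp μ f := fun f => by
      have h2 := (mem_commutantOf.1 hy _ ⟨_, (koopman_conj_mulOp Γ μ g f).symm⟩).1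
      rw [← hu] at h2
      calc mulOp μ f * (star u * y * u)
          = star u * (u * mulOp μ f * star u * y) * u := by
            simp only [← mul_assoc, hu1, one_mul]
        _ = star u * y * u * mulOp μ f * (star u * u) := by rw [h2]; simp only [mul_assoc]
        _ = _ := by rw [hu1, mul_one]
    rintro _ ⟨f, rfl⟩
    rw [star_mulOp]
    exact ⟨h1 _, h1 _⟩
  have h3 := mem_vnGenerated.1 hT _ hy'
  calc y * (u * T * star u) = u * (star u * y * u * T) * star u := by
        simp only [← mul_assoc, hu2, one_mul]
    _ = u * T * star u * y * (u * star u) := by rw [h3]; simp only [mul_assoc]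
    _ = _ := by rw [hu2, mul_one]

/-- The action of `Γ` on `L^∞(X, μ)` induced by the action on `X`: `σ_g(f) = f ∘ g⁻¹`. -/
noncomputable def linftyAction (μ : Measure X) [SMulInvariantMeasure Γ X μ] :
    VNAction Γ (linfty μ) :=
  adAction (koopman Γ μ) (linfty μ) (koopman_conj_mem Γ μ)

/-- `π : (X, μ) → (Z, ν)` is a factor map of measure preserving `Γ`-actions. -/
structure IsFactorMap {Z : Type*} [MeasurableSpace Z] [MulAction Γ Z] (π : X → Z)
    (μ : Measure X) (ν : Measure Z) : Prop where
  measurePreserving : MeasurePreserving π μ ν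
  equivariant : ∀ g : Γ, ∀ᵐ x ∂μ, π (g • x) = g • π x

/-- `f ∈ L²(X, μ)` is almost periodic relative to `π : X → Z`: up to `ε` in the norm of
`L²(μ_z)` for almost every fibre `π⁻¹(z)`, its translates take only finitely many values.  Here
`‖ξ‖²_{L²(μ_z)}` is the conditional expectation of `|ξ|²` given `π`. -/
def IsRelAlmostPeriodic {Z : Type*} [MeasurableSpace Z] (μ : Measure X)
    [SMulInvariantMeasure Γ X μ] (π : X → Z) (f : Lp ℂ 2 μ) : Prop :=
  ∀ ε : ℝ, 0 < ε → ∃ (n : ℕ) (ξ : Fin n → Lp ℂ 2 μ), ∀ g : Γ, ∀ᵐ x ∂μ, ∃ j : Fin n,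
    (μ[fun y => ‖(koopman Γ μ g : Lp ℂ 2 μ →L[ℂ] Lp ℂ 2 μ) f y - ξ j y‖ ^ 2 |
      MeasurableSpace.comap π inferInstance]) x < ε ^ 2

/-- The extension `π : X → Z` of measure preserving `Γ`-actions is compact: the relatively almost
periodic functions are dense in `L²(X, μ)`. -/
def IsCompactFactorMap {Z : Type*} [MeasurableSpace Z] (μ : Measure X)
    [SMulInvariantMeasure Γ X μ] (π : X → Z) : Prop :=
  Dense {f : Lp ℂ 2 μ | IsRelAlmostPeriodic Γ μ π f}

end Koopman

/-! Let `E` be the trace preserving conditional expectation of `P ⋊ Γ` onto `N`, and write elements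
of the crossed product as formal series `∑ λ_g c_g` with `c_g ∈ P`. The point is that `E` maps `P`
into `P`. Let `f` be almost periodic and let `c` be the coefficients of `E(f)`. Since `λ_g ∈ N`,
`E(σ_g f) = λ_g E(f) λ_g⋆`, whose coefficient at `g h g⁻¹` is `σ_g(c_h)`, of the same `2`-norm as
`c_h`. On the other hand `E` is `P₀`-linear, so `E(σ_g f)` is within `ε` of `∑ κ_i(g) E(ξ_i)`, where
the `E(ξ_i)` are finitely many vectors independent of `g`. Their coefficients are square summable,
hence small off a finite subset of `Γ`, and the bounded `κ_i(g)` act on each coefficient separately.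
If `h ≠ 1`, the infinite conjugacy class of `h` leaves that finite set, so `‖c_h‖₂ ≤ 2ε` for every
`ε`. This is `VNAction.coeff_eq_zero_of_almostPeriodic`; density extends it to all of `P`.

Put `Q = N ∩ P`. If `d ∈ N` is orthogonal to `Q ⋊ Γ` and has coefficients `c_g`, then `‖c_g‖₂² =
⟨c_g, λ_g⋆ d⟩ = ⟨E(c_g), λ_g⋆ d⟩ = ⟨λ_g E(c_g), d⟩ = 0`, because `E(c_g) ∈ Q`. Hence `N = Q ⋊ Γ`.

The space `H` need not be the standard representation of `P`. The trace therefore becomes a vector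
state only on `ℓ²(ℕ) ⊗ H` (`TracialState.exists_vector`), and `δ_1 ⊗ Ω` is then a trace vector for
the amplified crossed product. Conditional expectations are projections onto closures of orbits `N
Ω`; that they send bounded elements to bounded elements is `IsTraceVector.exists_condExp`.

For measure preserving actions, relative almost periodicity gives the algebraic condition with
indicator functions of sets from `X₀` as coefficients `κ`. An invariant intermediate `Q ⊆ L^∞(X)` is
`L^∞` of the `σ`-algebra of sets whose indicators it contains; in the standard case a dense sequence
in `Q 1` and its translates provide coordinates for a standard Borel model. -/

/-! ### Trace vectors and conditional expectations -/

section TraceVector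

variable {K : Type*} [NormedAddCommGroup K] [InnerProductSpace ℂ K] [CompleteSpace K]

theorem inner_star_apply_left (a : K →L[ℂ] K) (ξ η : K) : ⟪star a ξ, η⟫_ℂ = ⟪ξ, a η⟫_ℂ := by
  rw [ContinuousLinearMap.star_eq_adjoint, ContinuousLinearMap.adjoint_inner_left]

theorem inner_star_apply_right (a : K →L[ℂ] K) (ξ η : K) : ⟪ξ, star a η⟫_ℂ = ⟪a ξ, η⟫_ℂ := by
  rw [ContinuousLinearMap.star_eq_adjoint, ContinuousLinearMap.adjoint_inner_right]

theorem VonNeumannAlgebra.mem_iff_commute {N : VonNeumannAlgebra K} {x : K →L[ℂ] K} :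
    x ∈ N ↔ ∀ y ∈ N.commutant, y * x = x * y := by
  conv_lhs => rw [← N.commutant_commutant]
  exact VonNeumannAlgebra.mem_commutant_iff

theorem vnGenerated_coe (N : VonNeumannAlgebra K) : vnGenerated (N : Set (K →L[ℂ] K)) = N := by
  ext x
  rw [mem_vnGenerated, VonNeumannAlgebra.mem_iff_commute]
  have h : ∀ y, y ∈ commutantOf (N : Set (K →L[ℂ] K)) ↔ y ∈ N.commutant := fun y => by
    rw [mem_commutantOf, VonNeumannAlgebra.mem_commutant_iff]
    exact ⟨fun h s hs => (h s hs).1, fun h s hs => ⟨h s hs, h _ (star_mem hs)⟩⟩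
  simp only [h]

theorem vnGenerated_le {S : Set (K →L[ℂ] K)} {N : VonNeumannAlgebra K} (h : ∀ x ∈ S, x ∈ N) :
    vnGenerated S ≤ N := by
  rw [← vnGenerated_coe N]
  exact vnGenerated_mono h

theorem VonNeumannAlgebra.sqrt_mem (N : VonNeumannAlgebra K) {x : K →L[ℂ] K} (hx : x ∈ N) :
    CFC.sqrt x ∈ N := by
  rw [VonNeumannAlgebra.mem_iff_commute]
  intro y hy
  have hc : Commute x y := (VonNeumannAlgebra.mem_iff_commute.1 hx y hy).symm
  exact (Commute.cfcₙ_nnreal hc _).symm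

theorem VonNeumannAlgebra.inv_mem (N : VonNeumannAlgebra K) (k : (K →L[ℂ] K)ˣ)
    (hk : (k : K →L[ℂ] K) ∈ N) : ((k⁻¹ : (K →L[ℂ] K)ˣ) : K →L[ℂ] K) ∈ N := by
  rw [VonNeumannAlgebra.mem_iff_commute]
  intro y hy
  have hc : Commute y (k : K →L[ℂ] K) := VonNeumannAlgebra.mem_iff_commute.1 hk y hy
  exact hc.units_inv_right

/-- `Ω` induces a faithful trace on `M`. -/
structure IsTraceVector (M : VonNeumannAlgebra K) (Ω : K) : Prop where
  trace : ∀ a ∈ M, ∀ b ∈ M, ⟪Ω, a (b Ω)⟫_ℂ = ⟪Ω, b (a Ω)⟫_ℂ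
  separating : ∀ a ∈ M, a Ω = 0 → a = 0

/-- The subspace `N Ω`. -/
def orbitSpace (N : VonNeumannAlgebra K) (Ω : K) : Submodule ℂ K where
  carrier := {v | ∃ a ∈ N, a Ω = v}
  add_mem' := by
    rintro _ _ ⟨a, ha, rfl⟩ ⟨b, hb, rfl⟩
    exact ⟨a + b, add_mem ha hb, rfl⟩
  zero_mem' := ⟨0, zero_mem _, rfl⟩
  smul_mem' := by
    rintro c _ ⟨a, ha, rfl⟩
    exact ⟨c • a, SMulMemClass.smul_mem c ha, rfl⟩

theorem apply_mem_orbitSpace {N : VonNeumannAlgebra K} {a : K →L[ℂ] K} (ha : a ∈ N) (Ω : K) :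
    a Ω ∈ orbitSpace N Ω := ⟨a, ha, rfl⟩

theorem self_mem_orbitSpace (N : VonNeumannAlgebra K) (Ω : K) : Ω ∈ orbitSpace N Ω :=
  ⟨1, one_mem _, rfl⟩

/-- The projection onto the closure of `N Ω`. -/
noncomputable def orbitProj (N : VonNeumannAlgebra K) (Ω : K) : K →L[ℂ] K :=
  (orbitSpace N Ω).topologicalClosure.starProjection

theorem map_closure_orbitSpace {N : VonNeumannAlgebra K} {a : K →L[ℂ] K} (ha : a ∈ N) (Ω : K)
    {v : K} (hv : v ∈ (orbitSpace N Ω).topologicalClosure) :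
    a v ∈ (orbitSpace N Ω).topologicalClosure := by
  refine map_mem_closure a.continuous hv ?_
  rintro _ ⟨b, hb, rfl⟩
  exact ⟨a * b, mul_mem ha hb, rfl⟩

theorem orbitProj_mem_commutant (N : VonNeumannAlgebra K) (Ω : K) :
    orbitProj N Ω ∈ N.commutant := by
  rw [orbitProj, VonNeumannAlgebra.IsStarProjection.mem_iff isStarProjection_starProjection]
  intro y hy
  rw [N.commutant_commutant] at hy
  rw [Submodule.range_starProjection]
  intro v hv
  exact map_closure_orbitSpace hy Ω hv

theorem orbitProj_apply_comm {N : VonNeumannAlgebra K} {a : K →L[ℂ] K} (ha : a ∈ N) (Ω ξ : K) :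
    orbitProj N Ω (a ξ) = a (orbitProj N Ω ξ) :=
  (congrArg (fun T : K →L[ℂ] K => T ξ)
    (VonNeumannAlgebra.mem_commutant_iff.1 (orbitProj_mem_commutant N Ω) a ha)).symm

theorem orbitProj_eq {N : VonNeumannAlgebra K} {Ω ξ v : K}
    (hv : v ∈ (orbitSpace N Ω).topologicalClosure) (h : ∀ a ∈ N, ⟪a Ω, ξ - v⟫_ℂ = 0) :
    orbitProj N Ω ξ = v := by
  refine Submodule.eq_starProjection_of_mem_orthogonal hv ?_
  rw [Submodule.orthogonal_closure, Submodule.mem_orthogonal]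
  rintro _ ⟨a, ha, rfl⟩
  exact h a ha

theorem inner_sub_orbitProj {N : VonNeumannAlgebra K} {a : K →L[ℂ] K} (ha : a ∈ N) (Ω ξ : K) :
    ⟪a Ω, ξ - orbitProj N Ω ξ⟫_ℂ = 0 := by
  have h := Submodule.sub_starProjection_mem_orthogonal
    (K := (orbitSpace N Ω).topologicalClosure) ξ
  rw [Submodule.orthogonal_closure] at h
  exact (Submodule.mem_orthogonal _ _).1 h _ (apply_mem_orbitSpace ha Ω)

theorem norm_orbitProj_apply_le (N : VonNeumannAlgebra K) (Ω ξ : K) :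
    ‖orbitProj N Ω ξ‖ ≤ ‖ξ‖ :=
  Submodule.norm_starProjection_apply_le _ ξ

namespace IsTraceVector

variable {M N : VonNeumannAlgebra K} {Ω : K}

/-- This is `τ(a⋆ d b) = τ(b a⋆ d)`: the trace lets a right factor change sides of the inner
product. -/
theorem inner_apply (h : IsTraceVector M Ω) {a b d : K →L[ℂ] K} (ha : a ∈ M) (hb : b ∈ M)
    (hd : d ∈ M) : ⟪a Ω, d (b Ω)⟫_ℂ = ⟪a (star b Ω), d Ω⟫_ℂ := by
  rw [← inner_star_apply_right, ← inner_star_apply_right a (star b Ω), ← inner_star_apply_right,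
    star_star]
  have := h.trace (star a * d) (mul_mem (star_mem ha) hd) b hb
  simpa using this

/-- A separating vector for `M` is cyclic for `M'`: the projection onto the closure of `M' Ω` lies
in `M'' = M` and fixes `Ω`, so it equals `1`. -/
theorem dense_commutant (h : IsTraceVector M Ω) :
    Dense (orbitSpace M.commutant Ω : Set K) := by
  have hp : orbitProj M.commutant Ω ∈ M := by
    have := orbitProj_mem_commutant M.commutant Ω
    rwa [M.commutant_commutant] at this
  have h1 : orbitProj M.commutant Ω Ω = Ω :=
    Submodule.starProjection_eq_self_iff.2
      (Submodule.le_topologicalClosure _ (self_mem_orbitSpace _ _))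
  have h2 := h.separating _ (sub_mem hp (one_mem M)) (by simp [h1])
  rw [Submodule.dense_iff_topologicalClosure_eq_top, eq_top_iff]
  intro v _
  rw [← Submodule.starProjection_eq_self_iff]
  exact congrArg (fun T : K →L[ℂ] K => T v) (sub_eq_zero.1 h2)

/-- The unit ball of `N` is closed in `‖·‖₂`. -/
theorem exists_of_tendsto (h : IsTraceVector M Ω) (hN : N ≤ M) {x : ℕ → K →L[ℂ] K} {C : ℝ}
    (hx : ∀ n, x n ∈ N) (hC : ∀ n, ‖x n‖ ≤ C) {v : K}
    (hv : Tendsto (fun n => x n Ω) atTop (nhds v)) : ∃ y ∈ N, ‖y‖ ≤ C ∧ y Ω = v := by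
  have hC0 : 0 ≤ C := (norm_nonneg _).trans (hC 0)
  have hcau : ∀ ξ : K, CauchySeq fun n => x n ξ := by
    intro ξ
    rw [Metric.cauchySeq_iff]
    intro ε hε
    have hC1 : 0 < C + 1 := by linarith
    -- On the dense set of vectors `d Ω`, `d ∈ M'`, convergence is known because `x n (d Ω) = d (x n
    -- Ω)`; the uniform bound carries it to `ξ`. `C + 1` avoids a zero denominator.
    obtain ⟨_, ⟨d, hd, rfl⟩, hdξ⟩ := h.dense_commutant.exists_dist_lt ξ (ε := ε / (3 * (C + 1)))
      (by positivity)
    have hcd : CauchySeq fun n => x n (d Ω) := by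
      have : (fun n => x n (d Ω)) = fun n => d (x n Ω) := funext fun n =>
        congrArg (fun T : K →L[ℂ] K => T Ω) (VonNeumannAlgebra.mem_commutant_iff.1 hd _ (hN (hx n)))
      rw [this]
      exact ((d.continuous.tendsto v).comp hv).cauchySeq
    obtain ⟨n₀, hn₀⟩ := Metric.cauchySeq_iff.1 hcd (ε / 3) (by positivity)
    refine ⟨n₀, fun m hm n hn => ?_⟩
    have hb : ∀ n, dist (x n ξ) (x n (d Ω)) ≤ ε / 3 := fun n => by
      rw [dist_eq_norm, ← map_sub]
      calc ‖x n (ξ - d Ω)‖ ≤ (C + 1) * (ε / (3 * (C + 1))) := by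
            refine ((x n).le_of_opNorm_le ((hC n).trans (le_add_of_nonneg_right zero_le_one)) _).trans ?_
            rw [← dist_eq_norm]
            gcongr
        _ = ε / 3 := by field_simp
    calc dist (x m ξ) (x n ξ)
        ≤ dist (x m ξ) (x m (d Ω)) + dist (x m (d Ω)) (x n (d Ω)) + dist (x n (d Ω)) (x n ξ) :=
          dist_triangle4 _ _ _ _
      _ < ε / 3 + ε / 3 + ε / 3 := by
          have h1 := hb m
          have h2 := hb n
          rw [dist_comm] at h2
          have h3 := hn₀ m hm n hn
          linarith
      _ = ε := by ring
  choose f hf using fun ξ => cauchySeq_tendsto_of_complete (hcau ξ)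
  have hfle : ∀ ξ, ‖f ξ‖ ≤ C * ‖ξ‖ := fun ξ =>
    le_of_tendsto (hf ξ).norm (Eventually.of_forall fun n => (x n).le_of_opNorm_le (hC n) ξ)
  let y : K →L[ℂ] K := LinearMap.mkContinuous
    { toFun := f
      map_add' := fun ξ η => tendsto_nhds_unique (hf _) (by simpa using (hf ξ).add (hf η))
      map_smul' := fun c ξ => tendsto_nhds_unique (hf _) (by simpa using (hf ξ).const_smul c) } C
    hfle
  have hy : ∀ ξ, Tendsto (fun n => x n ξ) atTop (nhds (y ξ)) := hf
  refine ⟨y, ?_, LinearMap.mkContinuous_norm_le _ hC0 _, tendsto_nhds_unique (hy Ω) hv⟩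
  rw [VonNeumannAlgebra.mem_iff_commute]
  intro z hz
  ext ξ
  refine tendsto_nhds_unique ((z.continuous.tendsto _).comp (hy ξ)) ?_
  refine (hy (z ξ)).congr fun n => ?_
  exact (congrArg (fun T : K →L[ℂ] K => T ξ) (VonNeumannAlgebra.mem_iff_commute.1 (hx n) z hz)).symm

/-- An approximate polar decomposition turns the `L¹`-`L^∞` duality inequality for `x ∈ M` into
one for elements of `N`. -/
theorem exists_re_inner_le (h : IsTraceVector M Ω) (hN : N ≤ M) {x z : K →L[ℂ] K} (hx : x ∈ M)
    (hz : z ∈ N) {δ : ℝ} (hδ : 0 < δ) :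
    ∃ y ∈ N, ‖y‖ ≤ 1 ∧ (⟪z Ω, x Ω⟫_ℂ).re ≤ ‖x‖ * ((⟪z Ω, y Ω⟫_ℂ).re + 2 * δ * ‖Ω‖ ^ 2) := by
  have hzz0 : 0 ≤ star z * z := star_mul_self_nonneg z
  have hzzN : star z * z ∈ N := mul_mem (star_mem hz) hz
  -- With `p = |z|`, `k = |z| + δ` and `j = k⁻¹`, the element `y = z j` stands in for the partial
  -- isometry of the polar decomposition. Everything stays in `N`, and `z = y k` exactly.
  set p := CFC.sqrt (star z * z) with hp
  have hp0 : 0 ≤ p := CFC.sqrt_nonneg _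
  have hpN : p ∈ N := N.sqrt_mem hzzN
  have hpp : p * p = star z * z := CFC.sqrt_mul_sqrt_self _ hzz0
  have hunit : IsUnit (p + (δ : ℂ) • (1 : K →L[ℂ] K)) := by
    by_contra hcon
    have hmem : (-δ : ℝ) ∈ spectrum ℝ p := by
      rw [spectrum.mem_iff]
      intro hu
      apply hcon
      have : p + (δ : ℂ) • (1 : K →L[ℂ] K) = -(algebraMap ℝ (K →L[ℂ] K) (-δ) - p) := by
        rw [map_neg, Algebra.algebraMap_eq_smul_one]
        ext ξ
        simp [Complex.coe_smul, add_comm]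
      rw [this]
      exact hu.neg
    have := spectrum_nonneg_of_nonneg hp0 hmem
    linarith
  obtain ⟨k, hk⟩ := hunit
  have hkN : (k : K →L[ℂ] K) ∈ N := by
    rw [hk]; exact add_mem hpN (SMulMemClass.smul_mem _ (one_mem N))
  set j : K →L[ℂ] K := ((k⁻¹ : (K →L[ℂ] K)ˣ) : K →L[ℂ] K) with hj
  have hjN : j ∈ N := N.inv_mem k hkN
  have hkj : ∀ ξ, (k : K →L[ℂ] K) (j ξ) = ξ := fun ξ =>
    congrArg (fun T : K →L[ℂ] K => T ξ) k.mul_inv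
  have hjk : ∀ ξ, j ((k : K →L[ℂ] K) ξ) = ξ := fun ξ =>
    congrArg (fun T : K →L[ℂ] K => T ξ) k.inv_mul
  have hkapp : ∀ ξ, (k : K →L[ℂ] K) ξ = p ξ + (δ : ℂ) • ξ := fun ξ => by rw [hk]; simp
  have hpsa : ∀ ξ η, ⟪p ξ, η⟫_ℂ = ⟪ξ, p η⟫_ℂ := fun ξ η => by
    conv_lhs => rw [← hp0.isSelfAdjoint.star_eq]
    exact inner_star_apply_left p ξ η
  have hppos : ∀ ξ, 0 ≤ (⟪ξ, p ξ⟫_ℂ).re := fun ξ => by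
    have := ((ContinuousLinearMap.nonneg_iff_isPositive _).1 hp0).inner_nonneg_right ξ
    exact (Complex.le_def.1 this).1
  have hk0 : 0 ≤ (k : K →L[ℂ] K) := by
    rw [hk]
    refine add_nonneg hp0 (smul_nonneg ?_ zero_le_one)
    exact_mod_cast hδ.le
  have hksa : star (k : K →L[ℂ] K) = k := hk0.isSelfAdjoint.star_eq
  -- As `p = k - δ`, this is `p² k⁻¹ = k - 2δ + δ² k⁻¹`; it gives the error term `2δ‖Ω‖²`.
  have hpk : ∀ ξ, p (p (j ξ)) = (k : K →L[ℂ] K) ξ - (2 * δ : ℂ) • ξ + (δ ^ 2 : ℂ) • j ξ := by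
    intro ξ
    have e1 : p (j ξ) = ξ - (δ : ℂ) • j ξ := by
      rw [eq_sub_iff_add_eq, ← hkapp, hkj]
    rw [e1, map_sub, map_smul, e1, hkapp]
    module
  have hzp : ∀ ξ η, ⟪z ξ, z η⟫_ℂ = ⟪ξ, p (p η)⟫_ℂ := fun ξ η => by
    rw [← inner_star_apply_right]
    exact congrArg (fun T : K →L[ℂ] K => ⟪ξ, T η⟫_ℂ) hpp.symm
  set s := CFC.sqrt (k : K →L[ℂ] K) with hs
  have hsN : s ∈ N := N.sqrt_mem hkN
  have hss : s * s = k := CFC.sqrt_mul_sqrt_self _ hk0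
  have hssa : star s = s := (CFC.sqrt_nonneg _).isSelfAdjoint.star_eq
  have hnorm : ∀ ξ, ‖(z * j) ξ‖ ≤ ‖ξ‖ := fun ξ => by
    refine le_of_sq_le_sq ?_ (norm_nonneg _)
    set η := j ξ with hη
    have hξ : ξ = p η + (δ : ℂ) • η := by rw [← hkapp, hη, hkj]
    have e1 : ‖(z * j) ξ‖ ^ 2 = (⟪η, p (p η)⟫_ℂ).re := by
      rw [← hzp]; exact (inner_self_eq_norm_sq (𝕜 := ℂ) _).symm
    have e2 : ‖ξ‖ ^ 2 = (⟪η, p (p η)⟫_ℂ).re + 2 * δ * (⟪η, p η⟫_ℂ).re + δ ^ 2 * ‖η‖ ^ 2 := by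
      rw [hξ, ← hpsa η (p η), @norm_add_sq ℂ]
      have e3 : ‖p η‖ ^ 2 = (⟪p η, p η⟫_ℂ).re := (inner_self_eq_norm_sq (𝕜 := ℂ) _).symm
      rw [e3, inner_smul_right, norm_smul, hpsa η η]
      simp only [RCLike.re_to_complex, Complex.re_ofReal_mul, Complex.norm_real, mul_pow,
        Real.norm_eq_abs, sq_abs]
      ring
    rw [e1, e2]
    have := hppos η
    nlinarith [sq_nonneg (δ * ‖η‖), mul_nonneg hδ.le this]
  refine ⟨z * j, mul_mem hz hjN,
    ContinuousLinearMap.opNorm_le_bound _ zero_le_one fun ξ => by simpa using hnorm ξ, ?_⟩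
  · have hyy : (⟪z Ω, (z * j) Ω⟫_ℂ).re =
        (⟪Ω, (k : K →L[ℂ] K) Ω⟫_ℂ).re - 2 * δ * ‖Ω‖ ^ 2 + δ ^ 2 * (⟪Ω, j Ω⟫_ℂ).re := by
      have e1 : ⟪z Ω, (z * j) Ω⟫_ℂ = ⟪Ω, p (p (j Ω))⟫_ℂ := hzp _ _
      have e2 : (⟪Ω, Ω⟫_ℂ).re = ‖Ω‖ ^ 2 := inner_self_eq_norm_sq (𝕜 := ℂ) _
      rw [e1, hpk, inner_add_right, inner_sub_right, inner_smul_right, inner_smul_right, ← e2]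
      have e3 : ((2 * δ : ℂ)) = ((2 * δ : ℝ) : ℂ) := by push_cast; ring
      have e4 : ((δ ^ 2 : ℂ)) = ((δ ^ 2 : ℝ) : ℂ) := by push_cast; ring
      rw [e3, e4, Complex.add_re, Complex.sub_re, Complex.re_ofReal_mul, Complex.re_ofReal_mul]
    have hjpos : 0 ≤ (⟪Ω, j Ω⟫_ℂ).re := by
      have e1 : ⟪Ω, j Ω⟫_ℂ = ⟪p (j Ω), j Ω⟫_ℂ + (δ : ℂ) * ⟪j Ω, j Ω⟫_ℂ := by
        conv_lhs => rw [← hkj Ω, hjk, hkapp]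
        rw [inner_add_left, inner_smul_left, Complex.conj_ofReal]
      have e2 : (⟪j Ω, j Ω⟫_ℂ).re = ‖j Ω‖ ^ 2 := inner_self_eq_norm_sq (𝕜 := ℂ) _
      rw [e1, hpsa, Complex.add_re, Complex.re_ofReal_mul, e2]
      have := hppos (j Ω)
      positivity
    -- Write `z = y s s` with `s = k^{1/2}` and move one `s` across by traciality. Cauchy–Schwarz
    -- then bounds the left side by `‖x‖ τ(k)`, without a norm of `z`.
    have hzx : ⟪z Ω, x Ω⟫_ℂ = ⟪(z * j) (s Ω), x (s Ω)⟫_ℂ := by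
      have e1 : z = z * j * s * s := by
        rw [mul_assoc (z * j), hss, mul_assoc, hj, k.inv_mul, mul_one]
      have hM : z * j ∈ M := hN (mul_mem hz hjN)
      have := h.inner_apply (a := z * j * s) (b := s) (d := x) (mul_mem hM (hN hsN)) (hN hsN) hx
      rw [hssa] at this
      conv_lhs => rw [e1]
      exact this.symm
    have hsk : ‖s Ω‖ ^ 2 = (⟪Ω, (k : K →L[ℂ] K) Ω⟫_ℂ).re := by
      rw [← hss, mul_apply_eq_comp, ← hssa, inner_star_apply_right, hssa]
      exact (inner_self_eq_norm_sq (𝕜 := ℂ) _).symm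
    have hy1 := hnorm (s Ω)
    have : (⟪z Ω, x Ω⟫_ℂ).re ≤ ‖x‖ * ‖s Ω‖ ^ 2 := by
      rw [hzx]
      calc _ ≤ ‖⟪(z * j) (s Ω), x (s Ω)⟫_ℂ‖ := Complex.re_le_norm _
        _ ≤ ‖(z * j) (s Ω)‖ * ‖x (s Ω)‖ := norm_inner_le_norm _ _
        _ ≤ ‖s Ω‖ * (‖x‖ * ‖s Ω‖) := by gcongr; exact x.le_opNorm _
        _ = _ := by ring
    refine this.trans (mul_le_mul_of_nonneg_left ?_ (norm_nonneg _))
    rw [hyy, hsk]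
    nlinarith [mul_nonneg (sq_nonneg δ) hjpos]

theorem convex_ball (N : VonNeumannAlgebra K) (Ω : K) (C : ℝ) :
    Convex ℝ {v : K | ∃ a ∈ N, ‖a‖ ≤ C ∧ a Ω = v} := by
  rintro _ ⟨a, ha, hac, rfl⟩ _ ⟨b, hb, hbc, rfl⟩ s t hs ht hst
  refine ⟨(s : ℂ) • a + (t : ℂ) • b,
    add_mem (SMulMemClass.smul_mem _ ha) (SMulMemClass.smul_mem _ hb), ?_, ?_⟩
  · calc _ ≤ ‖(s : ℂ) • a‖ + ‖(t : ℂ) • b‖ := norm_add_le _ _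
      _ = s * ‖a‖ + t * ‖b‖ := by
        rw [norm_smul, norm_smul, Complex.norm_real, Complex.norm_real, Real.norm_of_nonneg hs,
          Real.norm_of_nonneg ht]
      _ ≤ s * C + t * C := by gcongr
      _ = C := by rw [← add_mul, hst, one_mul]
  · simp [Complex.coe_smul]

/-- The trace preserving conditional expectation `M → N`. -/
theorem exists_condExp (h : IsTraceVector M Ω) (hN : N ≤ M) {x : K →L[ℂ] K} (hx : x ∈ M) :
    ∃ y ∈ N, orbitProj N Ω (x Ω) = y Ω := by
  let _ : InnerProductSpace ℝ K := InnerProductSpace.rclikeToReal ℂ K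
  set B : Set K := {v : K | ∃ a ∈ N, ‖a‖ ≤ ‖x‖ ∧ a Ω = v} with hB
  have hBc : IsClosed B := by
    rw [← isSeqClosed_iff_isClosed]
    intro v w hv hw
    choose a haN ha hav using hv
    have : Tendsto (fun n => a n Ω) atTop (nhds w) := by simpa only [hav] using hw
    exact h.exists_of_tendsto hN haN ha this
  have hne : B.Nonempty := ⟨0, 0, zero_mem _, by simp, rfl⟩
  -- The candidate for the expectation of `x` is the point nearest to the projection of `x Ω` in the
  -- closed convex image of the ball of radius `‖x‖` in `N`. The defect `ζ` is zero by duality: the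
  -- variational inequality bounds `Re ⟨ζ, a Ω⟩` over that ball, while approximate polar
  -- decomposition provides `a` in the ball that nearly does as well as `x`.
  obtain ⟨w, hwB, hw⟩ := exists_norm_eq_iInf_of_complete_convex hne hBc.isComplete
    (convex_ball N Ω ‖x‖) (orbitProj N Ω (x Ω))
  rw [norm_eq_iInf_iff_real_inner_le_zero (convex_ball N Ω ‖x‖) hwB] at hw
  obtain ⟨y, hyN, hyx, rfl⟩ := hwB
  refine ⟨y, hyN, ?_⟩
  set ζ := orbitProj N Ω (x Ω) - y Ω with hζ
  have hζmem : ζ ∈ (orbitSpace N Ω).topologicalClosure :=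
    sub_mem (Submodule.starProjection_apply_mem _ _)
      (Submodule.le_topologicalClosure _ (apply_mem_orbitSpace hyN Ω))
  have hw' : ∀ a ∈ N, ‖a‖ ≤ ‖x‖ → (⟪ζ, a Ω⟫_ℂ).re ≤ (⟪ζ, y Ω⟫_ℂ).re := fun a ha hax => by
    have : (⟪ζ, a Ω - y Ω⟫_ℂ).re ≤ 0 := hw (a Ω) ⟨a, ha, hax, rfl⟩
    rw [inner_sub_right, Complex.sub_re] at this
    linarith
  have hζx : ⟪ζ, orbitProj N Ω (x Ω)⟫_ℂ = ⟪ζ, x Ω⟫_ℂ := by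
    rw [orbitProj, ← Submodule.inner_starProjection_left_eq_right,
      Submodule.starProjection_eq_self_iff.2 hζmem]
  have hζζ : ‖ζ‖ ^ 2 = (⟪ζ, x Ω⟫_ℂ).re - (⟪ζ, y Ω⟫_ℂ).re := by
    rw [← hζx, ← Complex.sub_re, ← inner_sub_right]
    exact (inner_self_eq_norm_sq (𝕜 := ℂ) _).symm
  -- Replacing `ζ` by `z Ω` costs `δ‖x‖‖Ω‖` twice, once against `x` and once against the competitor
  -- `‖x‖ c`; the remaining term is the loss `2δ‖x‖‖Ω‖²` of `exists_re_inner_le`.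
  have key : ∀ δ : ℝ, 0 < δ → ‖ζ‖ ^ 2 ≤ δ * (2 * ‖x‖ * ‖Ω‖ + 2 * ‖x‖ * ‖Ω‖ ^ 2) := by
    intro δ hδ
    obtain ⟨_, ⟨z, hz, rfl⟩, hzd⟩ := Metric.mem_closure_iff.1 hζmem δ hδ
    obtain ⟨c, hcN, hc1, hc⟩ := h.exists_re_inner_le hN hx hz hδ
    have h1 : ∀ a : K →L[ℂ] K, ‖a‖ ≤ ‖x‖ →
        |(⟪ζ, a Ω⟫_ℂ).re - (⟪z Ω, a Ω⟫_ℂ).re| ≤ δ * (‖x‖ * ‖Ω‖) := fun a ha => by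
      rw [← Complex.sub_re, ← inner_sub_left]
      refine (Complex.abs_re_le_norm _).trans ((norm_inner_le_norm _ _).trans ?_)
      rw [dist_eq_norm] at hzd
      gcongr
      exact a.le_of_opNorm_le ha Ω
    have hcx : ‖(‖x‖ : ℂ) • c‖ ≤ ‖x‖ := by
      rw [norm_smul, Complex.norm_real, norm_norm]
      exact mul_le_of_le_one_right (norm_nonneg _) hc1
    have h2 := abs_le.1 (h1 x le_rfl)
    have h3 := abs_le.1 (h1 _ hcx)
    have h4 := hw' _ (SMulMemClass.smul_mem (‖x‖ : ℂ) hcN) hcx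
    have h5 : (⟪z Ω, ((‖x‖ : ℂ) • c) Ω⟫_ℂ).re = ‖x‖ * (⟪z Ω, c Ω⟫_ℂ).re := by
      rw [_root_.smul_apply, inner_smul_right, Complex.re_ofReal_mul]
    rw [hζζ]
    nlinarith [h2.1, h2.2, h3.1, h3.2]
  have hz0 : ‖ζ‖ ^ 2 ≤ 0 := by
    refine le_of_forall_pos_le_add fun ε hε => ?_
    have hD : 0 ≤ 2 * ‖x‖ * ‖Ω‖ + 2 * ‖x‖ * ‖Ω‖ ^ 2 := by positivity
    set D := 2 * ‖x‖ * ‖Ω‖ + 2 * ‖x‖ * ‖Ω‖ ^ 2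
    refine (key (ε / (D + 1)) (by positivity)).trans ?_
    rw [zero_add, div_mul_eq_mul_div, div_le_iff₀ (by positivity)]
    nlinarith
  have : ζ = 0 := by
    rw [← norm_eq_zero]
    exact pow_eq_zero_iff two_ne_zero |>.1 (le_antisymm hz0 (sq_nonneg _))
  exact sub_eq_zero.1 this

/-- Left linearity is automatic for the projection; right linearity comes from the trace, as `⟨a Ω,
u (x - y) u⋆ Ω⟩ = ⟨u⋆ a u Ω, (x - y) Ω⟩` and `u⋆ a u ∈ N`. -/
theorem orbitProj_conj (h : IsTraceVector M Ω) (hN : N ≤ M) {x y u : K →L[ℂ] K} (hx : x ∈ M)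
    (hy : y ∈ N) (hu : u ∈ N) (hxy : orbitProj N Ω (x Ω) = y Ω) :
    orbitProj N Ω ((u * x * star u) Ω) = (u * y * star u) Ω := by
  refine orbitProj_eq (Submodule.le_topologicalClosure _
    (apply_mem_orbitSpace (mul_mem (mul_mem hu hy) (star_mem hu)) Ω)) fun a ha => ?_
  have h1 := h.inner_apply (a := star u * a) (b := star u) (d := x - y)
    (hN (mul_mem (star_mem hu) ha)) (hN (star_mem hu)) (sub_mem hx (hN hy))
  have h2 := inner_sub_orbitProj (mul_mem (mul_mem (star_mem hu) ha) hu) Ω (x Ω)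
  rw [hxy] at h2
  rw [star_star] at h1
  have h3 := h1.trans h2
  rw [mul_apply_eq_comp, inner_star_apply_left] at h3
  simpa [mul_apply_eq_comp] using h3

/-- The expectation of `x` agrees with `x` on the separating vector `Ω`. This is the tool for
proving membership in a von Neumann algebra by `2`-norm approximation, with no bound on the
approximants. -/
theorem mem_of_mem_closure (h : IsTraceVector M Ω) (hN : N ≤ M) {x : K →L[ℂ] K} (hx : x ∈ M)
    (hxN : x Ω ∈ (orbitSpace N Ω).topologicalClosure) : x ∈ N := by
  obtain ⟨y, hy, hxy⟩ := h.exists_condExp hN hx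
  have h1 : orbitProj N Ω (x Ω) = x Ω := Submodule.starProjection_eq_self_iff.2 hxN
  have h2 := h.separating (x - y) (sub_mem hx (hN hy)) (by simp [← hxy, h1])
  rwa [sub_eq_zero.1 h2]

end IsTraceVector

end TraceVector

/-! ### Operator matrices and amplification -/

section Matrix

theorem ellTwo_norm_sq {ι H : Type*} [NormedAddCommGroup H] (ξ : EllTwo ι H) :
    ‖ξ‖ ^ 2 = ∑' i, ‖ξ i‖ ^ 2 := by
  have := lp.norm_rpow_eq_tsum (p := 2) (by norm_num) ξ
  simpa using this

theorem ellTwo_summable {ι H : Type*} [NormedAddCommGroup H] (ξ : EllTwo ι H) :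
    Summable fun i => ‖ξ i‖ ^ 2 := by
  have := (lp.memℓp ξ).summable (by norm_num)
  simpa using this

variable {ι : Type*} {H : Type*} [NormedAddCommGroup H] [InnerProductSpace ℂ H]

open Classical in
/-- The vector `δ_i ⊗ a`. -/
noncomputable def ellSingle (i : ι) : H →L[ℂ] EllTwo ι H :=
  lp.singleContinuousLinearMap ℂ (fun _ : ι => H) 2 i

/-- The `i`-th coordinate of a vector. -/
noncomputable def ellEval (i : ι) : EllTwo ι H →L[ℂ] H :=
  lp.evalCLM ℂ (fun _ : ι => H) 2 i

@[simp] theorem ellEval_apply (i : ι) (ξ : EllTwo ι H) : ellEval i ξ = ξ i := rfl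

@[simp] theorem ellSingle_apply_self (i : ι) (a : H) : (ellSingle i a : EllTwo ι H) i = a := by
  classical
  exact lp.single_apply_self (E := fun _ : ι => H) 2 i a

theorem ellSingle_apply_ne {i j : ι} (h : j ≠ i) (a : H) : (ellSingle i a : EllTwo ι H) j = 0 := by
  classical
  exact lp.single_apply_ne (E := fun _ : ι => H) 2 i a h

theorem inner_ellSingle_left (i : ι) (a : H) (ξ : EllTwo ι H) : ⟪ellSingle i a, ξ⟫_ℂ = ⟪a, ξ i⟫_ℂ := by
  classical
  exact lp.inner_single_left (𝕜 := ℂ) (G := fun _ : ι => H) i a ξ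

theorem inner_ellSingle_right (i : ι) (a : H) (ξ : EllTwo ι H) :
    ⟪ξ, ellSingle i a⟫_ℂ = ⟪ξ i, a⟫_ℂ := by
  classical
  exact lp.inner_single_right (𝕜 := ℂ) (G := fun _ : ι => H) i a ξ

theorem clm_ext_ellSingle {F : Type*} [NormedAddCommGroup F] [NormedSpace ℂ F]
    {S T : EllTwo ι H →L[ℂ] F} (h : ∀ i a, S (ellSingle i a) = T (ellSingle i a)) : S = T := by
  classical
  exact lp.ext_continuousLinearMap (by norm_num) fun i => ContinuousLinearMap.ext fun a => h i a

/-- The matrix entries of an operator on `ℓ²(ι, H)`. -/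
noncomputable def entry (T : EllTwo ι H →L[ℂ] EllTwo ι H) (i j : ι) : H →L[ℂ] H :=
  ellEval i ∘L T ∘L ellSingle j

theorem entry_apply (T : EllTwo ι H →L[ℂ] EllTwo ι H) (i j : ι) (a : H) :
    entry T i j a = T (ellSingle j a) i := rfl

theorem entry_ext {S T : EllTwo ι H →L[ℂ] EllTwo ι H} (h : ∀ i j, entry S i j = entry T i j) :
    S = T :=
  clm_ext_ellSingle fun j a => lp.ext <| funext fun i =>
    congrArg (fun R : H →L[ℂ] H => R a) (h i j)

theorem diagOp_ellSingle (T : ι → H →L[ℂ] H) (C : ℝ) (hT : ∀ h, ‖T h‖ ≤ C) (i : ι) (a : H) :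
    diagOp T C hT (ellSingle i a) = ellSingle i (T i a) := by
  apply lp.ext
  funext j
  rw [diagOp_apply]
  by_cases hj : j = i
  · subst hj; simp
  · rw [ellSingle_apply_ne hj, ellSingle_apply_ne hj, map_zero]

/-- `1 ⊗ x` on `ℓ²(ι) ⊗ H`. -/
noncomputable def amp (ι : Type*) (x : H →L[ℂ] H) : EllTwo ι H →L[ℂ] EllTwo ι H :=
  diagOp (fun _ : ι => x) ‖x‖ fun _ => le_rfl

@[simp] theorem amp_apply (x : H →L[ℂ] H) (ξ : EllTwo ι H) (i : ι) : amp ι x ξ i = x (ξ i) := rfl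

theorem amp_ellSingle (x : H →L[ℂ] H) (i : ι) (a : H) :
    amp ι x (ellSingle i a) = ellSingle i (x a) := diagOp_ellSingle _ _ _ i a

theorem amp_mul (x y : H →L[ℂ] H) : amp ι (x * y) = amp ι x * amp ι y := rfl

theorem amp_sub (x y : H →L[ℂ] H) : amp ι (x - y) = amp ι x - amp ι y := rfl

theorem amp_eq_zero [Nonempty ι] {x : H →L[ℂ] H} (h : amp ι x = 0) : x = 0 := by
  ext a
  have i : ι := Classical.arbitrary ι
  simpa using congrArg (fun T : EllTwo ι H →L[ℂ] EllTwo ι H => T (ellSingle i a) i) h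

theorem norm_amp_apply_le (x : H →L[ℂ] H) {C : ℝ} (hx : ‖x‖ ≤ C) (ξ : EllTwo ι H) :
    ‖amp ι x ξ‖ ≤ C * ‖ξ‖ := by
  have hC : 0 ≤ C := (norm_nonneg _).trans hx
  have : ‖amp ι x ξ‖ ≤ ‖(C : ℂ) • ξ‖ := by
    refine lp.norm_mono (by norm_num) fun i => ?_
    rw [lp.coeFn_smul, Pi.smul_apply, norm_smul, Complex.norm_real, Real.norm_of_nonneg hC]
    exact x.le_of_opNorm_le hx _
  rwa [norm_smul, Complex.norm_real, Real.norm_of_nonneg hC] at this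

/-- If `R` maps the `f j`-th coordinate to the `j`-th one by `v`, then commuting with `R` is a
relation between matrix entries. -/
theorem entry_of_commute {T R : EllTwo ι H →L[ℂ] EllTwo ι H} {f : ι → ι}
    (hf : Function.Injective f) {v : H →L[ℂ] H} (hR : ∀ ξ i, R ξ i = v (ξ (f i)))
    (h : T * R = R * T) (i j : ι) : entry T i j * v = v * entry T (f i) (f j) := by
  ext a
  have hs : R (ellSingle (f j) a) = ellSingle j (v a) := by
    apply lp.ext
    funext k
    rw [hR]
    by_cases hk : k = j
    · subst hk; simp
    · rw [ellSingle_apply_ne hk, ellSingle_apply_ne (fun h => hk (hf h)), map_zero]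
  have := congrArg (fun S : EllTwo ι H →L[ℂ] EllTwo ι H => S (ellSingle (f j) a) i) h
  simp only [mul_apply_eq_comp, hs, hR] at this
  exact this

theorem amp_commute_iff {T : EllTwo ι H →L[ℂ] EllTwo ι H} {x : H →L[ℂ] H} :
    amp ι x * T = T * amp ι x ↔ ∀ i j, x * entry T i j = entry T i j * x := by
  constructor
  · intro h i j
    exact (entry_of_commute (f := id) Function.injective_id (fun _ _ => rfl) h.symm i j).symm
  · intro h
    refine entry_ext fun i j => ?_
    ext a
    have := congrArg (fun S : H →L[ℂ] H => S a) (h i j)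
    simp only [mul_apply_eq_comp, entry_apply, amp_apply, amp_ellSingle] at this ⊢
    exact this

variable [CompleteSpace H]

theorem entry_star (T : EllTwo ι H →L[ℂ] EllTwo ι H) (i j : ι) :
    entry (star T) i j = star (entry T j i) := by
  ext a
  refine ext_inner_left ℂ fun b => ?_
  rw [inner_star_apply_right, entry_apply, entry_apply, ← inner_ellSingle_left,
    inner_star_apply_right, inner_ellSingle_right]

theorem star_diagOp (T : ι → H →L[ℂ] H) (C : ℝ) (hT : ∀ h, ‖T h‖ ≤ C) :
    star (diagOp T C hT) = diagOp (fun h => star (T h)) C fun h => by rw [norm_star]; exact hT h := by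
  refine entry_ext fun i j => ?_
  rw [entry_star]
  ext a
  refine ext_inner_left ℂ fun b => ?_
  rw [inner_star_apply_right, entry_apply, entry_apply, diagOp_ellSingle, diagOp_ellSingle]
  by_cases h : i = j
  · subst h
    simp [inner_star_apply_right]
  · rw [ellSingle_apply_ne h, ellSingle_apply_ne (Ne.symm h)]
    simp

theorem amp_star (x : H →L[ℂ] H) : amp ι (star x) = star (amp ι x) := by
  rw [amp, amp, star_diagOp]
  rfl

/-- `1 ⊗ N`. -/
noncomputable def amplify (ι : Type*) (N : VonNeumannAlgebra H) : VonNeumannAlgebra (EllTwo ι H) :=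
  vnGenerated (amp ι '' (N : Set (H →L[ℂ] H)))

/-- Multiplication by `1 ⊗ s` acts on every matrix entry separately, so commutation can be tested
entrywise. -/
theorem amp_mem_commutantOf {S : Set (H →L[ℂ] H)} {T : EllTwo ι H →L[ℂ] EllTwo ι H} :
    T ∈ commutantOf (amp ι '' S) ↔ ∀ i j, entry T i j ∈ commutantOf S := by
  simp only [mem_commutantOf, Set.forall_mem_image, ← amp_star, amp_commute_iff]
  exact ⟨fun h i j s hs => ⟨(h hs).1 i j, (h hs).2 i j⟩,
    fun h s hs => ⟨fun i j => (h i j s hs).1, fun i j => (h i j s hs).2⟩⟩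

theorem amp_mem_vnGenerated {S : Set (H →L[ℂ] H)} {x : H →L[ℂ] H} (hx : x ∈ vnGenerated S) :
    amp ι x ∈ vnGenerated (amp ι '' S) := by
  rw [mem_vnGenerated] at hx ⊢
  intro T hT
  rw [amp_mem_commutantOf] at hT
  exact (amp_commute_iff.2 fun i j => (hx _ (hT i j)).symm).symm

theorem amp_mem_amplify {N : VonNeumannAlgebra H} {x : H →L[ℂ] H} (hx : x ∈ N) :
    amp ι x ∈ amplify ι N := subset_vnGenerated _ ⟨x, hx, rfl⟩

/-- Commuting with the matrix units `ellSingle j ∘L ellEval i₀` forces `T` to be diagonal with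
constant entry; commuting with `1 ⊗ y` for `y ∈ N'` puts that entry in `N'' = N`. -/
theorem exists_amp_eq [Nonempty ι] {N : VonNeumannAlgebra H} {T : EllTwo ι H →L[ℂ] EllTwo ι H}
    (hT : T ∈ amplify ι N) : ∃ x ∈ N, amp ι x = T := by
  have i₀ : ι := Classical.arbitrary ι
  have hx : ∀ j a, T (ellSingle j a) = ellSingle j (entry T i₀ i₀ a) := by
    intro j a
    have hE : (ellSingle j ∘L ellEval i₀ : EllTwo ι H →L[ℂ] EllTwo ι H) ∈
        commutantOf (amp ι '' (N : Set (H →L[ℂ] H))) := by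
      have h1 : ∀ x : H →L[ℂ] H, amp ι x * (ellSingle j ∘L ellEval i₀) =
          (ellSingle j ∘L ellEval i₀) * amp ι x := fun x => by
        ext1 ξ
        simp [amp_ellSingle]
      refine mem_commutantOf.2 ?_
      rintro _ ⟨x, -, rfl⟩
      rw [← amp_star]
      exact ⟨h1 _, h1 _⟩
    have := congrArg (fun S : EllTwo ι H →L[ℂ] EllTwo ι H => S (ellSingle i₀ a))
      (mem_vnGenerated.1 hT _ hE)
    simp only [mul_apply_eq_comp, ContinuousLinearMap.comp_apply, ellEval_apply,
      ellSingle_apply_self] at this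
    exact this.symm
  have hTx : amp ι (entry T i₀ i₀) = T := clm_ext_ellSingle fun j a => by
    rw [amp_ellSingle, hx]
  refine ⟨entry T i₀ i₀, ?_, hTx⟩
  rw [VonNeumannAlgebra.mem_iff_commute]
  intro y hy
  have h1 : amp ι y ∈ commutantOf (amp ι '' (N : Set (H →L[ℂ] H))) := by
    refine mem_commutantOf.2 ?_
    rintro _ ⟨x, hx, rfl⟩
    rw [← amp_star, ← amp_mul, ← amp_mul, ← amp_mul, ← amp_mul,
      VonNeumannAlgebra.mem_commutant_iff.1 hy x hx,
      VonNeumannAlgebra.mem_commutant_iff.1 hy _ (star_mem hx)]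
    exact ⟨rfl, rfl⟩
  have h2 := mem_vnGenerated.1 hT _ h1
  rw [← hTx, ← amp_mul, ← amp_mul, ← sub_eq_zero, ← amp_sub] at h2
  exact sub_eq_zero.1 (amp_eq_zero h2)

theorem amplify_mono {N M : VonNeumannAlgebra H} (h : N ≤ M) : amplify ι N ≤ amplify ι M :=
  vnGenerated_mono (Set.image_mono h)

theorem mem_of_amp_mem [Nonempty ι] {N : VonNeumannAlgebra H} {x : H →L[ℂ] H}
    (h : amp ι x ∈ amplify ι N) : x ∈ N := by
  obtain ⟨y, hy, hyx⟩ := exists_amp_eq h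
  rw [← sub_eq_zero, ← amp_sub] at hyx
  rwa [← sub_eq_zero.1 (amp_eq_zero hyx)]

end Matrix

/-! ### Normal tracial states as vector states -/

section TraceVectorExists

/-- The contraction `e a ↦ f a` extends to the closure of the range of `e`; composing with the
orthogonal projection makes it vanish on the complement. It supplies both the identifications with
`L²(P, τ)` and the operators implementing `σ`. -/
theorem exists_clm_of_norm_le {A E F : Type*} [AddCommGroup A] [Module ℂ A]
    [NormedAddCommGroup E] [InnerProductSpace ℂ E] [CompleteSpace E]
    [NormedAddCommGroup F] [NormedSpace ℂ F] [CompleteSpace F] (e : A →ₗ[ℂ] E) (f : A →ₗ[ℂ] F)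
    (h : ∀ a, ‖f a‖ ≤ ‖e a‖) :
    ∃ W : E →L[ℂ] F, (∀ a, W (e a) = f a) ∧ ∀ ξ, (∀ a, ⟪e a, ξ⟫_ℂ = 0) → W ξ = 0 := by
  let V : Submodule ℂ E := (LinearMap.range e).topologicalClosure
  have hV : IsClosed (V : Set E) := Submodule.isClosed_topologicalClosure _
  have : CompleteSpace V := hV.completeSpace_coe
  have hmem : ∀ a, e a ∈ V := fun a =>
    Submodule.le_topologicalClosure _ (LinearMap.mem_range_self e a)
  let e' : A →ₗ[ℂ] V := e.codRestrict V hmem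
  have hd : DenseRange e' := by
    rintro ⟨x, hx⟩
    rw [closure_subtype]
    refine closure_mono ?_ hx
    rintro _ ⟨a, rfl⟩
    exact ⟨e' a, ⟨a, rfl⟩, rfl⟩
  have hn : ∃ C, ∀ a, ‖f a‖ ≤ C * ‖e' a‖ := ⟨1, fun a => by rw [one_mul]; exact h a⟩
  refine ⟨f.extendOfNorm e' ∘L V.orthogonalProjectionOnto, fun a => ?_, fun ξ hξ => ?_⟩
  · rw [ContinuousLinearMap.comp_apply]
    have : V.orthogonalProjectionOnto (e a) = e' a :=
      Submodule.orthogonalProjectionOnto_mem_subspace_eq_self (K := V) ⟨e a, hmem a⟩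
    rw [this, LinearMap.extendOfNorm_eq hd hn]
  · rw [ContinuousLinearMap.comp_apply, Submodule.orthogonalProjectionOnto_eq_zero_iff.2, map_zero]
    rw [Submodule.orthogonal_closure, Submodule.mem_orthogonal]
    rintro _ ⟨a, rfl⟩
    exact hξ a

theorem clm_eq_of_range_of_orthogonal {A E F : Type*} [AddCommGroup A] [Module ℂ A]
    [NormedAddCommGroup E] [InnerProductSpace ℂ E] [CompleteSpace E]
    [NormedAddCommGroup F] [NormedSpace ℂ F] (e : A →ₗ[ℂ] E) {S T : E →L[ℂ] F}
    (h1 : ∀ a, S (e a) = T (e a)) (h2 : ∀ ξ, (∀ a, ⟪e a, ξ⟫_ℂ = 0) → S ξ = T ξ) : S = T := by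
  let V : Submodule ℂ E := (LinearMap.range e).topologicalClosure
  have hV : IsClosed (V : Set E) := Submodule.isClosed_topologicalClosure _
  have : CompleteSpace V := hV.completeSpace_coe
  ext ξ
  obtain ⟨y, hy, z, hz, rfl⟩ := V.exists_add_mem_mem_orthogonal ξ
  rw [map_add, map_add]
  congr 1
  · have hc : IsClosed {y | S y = T y} := isClosed_eq S.continuous T.continuous
    refine closure_minimal (s := (LinearMap.range e : Set E)) ?_ hc hy
    rintro _ ⟨a, rfl⟩
    exact h1 a
  · refine h2 z fun a => ?_
    rw [Submodule.orthogonal_closure] at hz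
    exact (Submodule.mem_orthogonal _ _).1 hz _ (LinearMap.mem_range_self e a)

variable {H : Type*} [NormedAddCommGroup H] [InnerProductSpace ℂ H] [CompleteSpace H]
variable {P : VonNeumannAlgebra H} (τ : TracialState P)

namespace TracialState

theorem inner_toL2 (a b : P) : ⟪τ.toL2 a, τ.toL2 b⟫_ℂ = τ.toPositive (star a * b) := by
  rw [toL2, toL2, UniformSpace.Completion.inner_coe]
  rfl

theorem lmul_toL2 (a b : P) : τ.lmul a (τ.toL2 b) = τ.toL2 (a * b) := by
  simp [lmul, toL2, PositiveLinearMap.leftMulMapPreGNS]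

theorem denseRange_toL2 : DenseRange τ.toL2 := by
  have h := UniformSpace.Completion.denseRange_coe (α := τ.toPositive.PreGNS)
  exact h

/-- `toL2` as a linear map. -/
noncomputable def toL2ₗ : P →ₗ[ℂ] τ.L2 where
  toFun := τ.toL2
  map_add' a b := by simp [toL2, UniformSpace.Completion.coe_add]
  map_smul' c a := by simp [toL2, UniformSpace.Completion.coe_smul]

@[simp] theorem toL2ₗ_apply (a : P) : τ.toL2ₗ a = τ.toL2 a := rfl

theorem star_lmul (a : P) : star (τ.lmul a) = τ.lmul (star a) :=
  (map_star τ.toPositive.gnsStarAlgHom a).symm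

end TracialState

/-- The map `a ↦ (1 ⊗ a) ζ`. -/
noncomputable def ampVec (P : VonNeumannAlgebra H) (ζ : EllTwo ℕ H) : P →ₗ[ℂ] EllTwo ℕ H where
  toFun a := amp ℕ (a : H →L[ℂ] H) ζ
  map_add' _ _ := rfl
  map_smul' _ _ := rfl

@[simp] theorem ampVec_apply (ζ : EllTwo ℕ H) (a : P) : ampVec P ζ a = amp ℕ (a : H →L[ℂ] H) ζ := rfl

theorem amp_ampVec (ζ : EllTwo ℕ H) (a b : P) :
    amp ℕ (a : H →L[ℂ] H) (ampVec P ζ b) = ampVec P ζ (a * b) := rfl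

theorem inner_ampVec_amp (ζ ξ : EllTwo ℕ H) (a b : P) :
    ⟪ampVec P ζ a, amp ℕ (b : H →L[ℂ] H) ξ⟫_ℂ = ⟪ampVec P ζ (star b * a), ξ⟫_ℂ := by
  rw [← amp_ampVec, ← inner_star_apply_left, ← amp_star]; rfl

theorem TracialState.exists_two_vectors :
    ∃ ξ η : EllTwo ℕ H, ∀ a : P, τ.toPositive a = ⟪ξ, amp ℕ (a : H →L[ℂ] H) η⟫_ℂ := by
  obtain ⟨ξ, η, hξ, hη, h⟩ := τ.normal
  refine ⟨⟨ξ, memℓp_gen (by simpa using hξ)⟩, ⟨η, memℓp_gen (by simpa using hη)⟩, fun a => ?_⟩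
  rw [h a, lp.inner_eq_tsum]
  rfl

theorem exists_positive_sqrt {K : Type*} [NormedAddCommGroup K] [InnerProductSpace ℂ K]
    [CompleteSpace K] {T : K →L[ℂ] K} (hT : 0 ≤ T) :
    ∃ R : K →L[ℂ] K, R * R = T ∧ star R = R ∧ ∀ a, Commute T a → Commute R a :=
  ⟨CFC.sqrt T, CFC.sqrt_mul_sqrt_self T hT, (CFC.sqrt_nonneg T).isSelfAdjoint.star_eq,
    fun _ ha => Commute.cfcₙ_nnreal ha _⟩

/-- After amplification, a normal tracial state is a vector state. -/
theorem TracialState.exists_vector :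
    ∃ Ω : EllTwo ℕ H, ∀ a : P, ⟪Ω, amp ℕ (a : H →L[ℂ] H) Ω⟫_ℂ = τ.toPositive a := by
  obtain ⟨ξ, η, h⟩ := τ.exists_two_vectors
  -- Polarisation: `τ(a⋆a) = Re ⟨a ξ, a η⟩ ≤ ‖a ζ‖²`, so `a ζ ↦ a` is a contraction `W` into `L²(P,
  -- τ)`.
  set ζ := ξ + η with hζ
  have hle : ∀ a : P, ‖τ.toL2ₗ a‖ ≤ ‖ampVec P ζ a‖ := fun a => by
    refine le_of_sq_le_sq ?_ (norm_nonneg _)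
    have e1 : ‖τ.toL2ₗ a‖ ^ 2 = (⟪ampVec P ξ a, ampVec P η a⟫_ℂ).re := by
      rw [← inner_self_eq_norm_sq (𝕜 := ℂ), toL2ₗ_apply, inner_toL2, h, ampVec_apply,
        ← inner_star_apply_right, ← amp_star]
      rfl
    have e2 : ampVec P ζ a = ampVec P ξ a + ampVec P η a := map_add (amp ℕ (a : H →L[ℂ] H)) ξ η
    have e3 := @norm_add_sq ℂ _ _ _ _ (ampVec P ξ a) (ampVec P η a)
    have e4 := @norm_sub_sq ℂ _ _ _ _ (ampVec P ξ a) (ampVec P η a)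
    rw [e1, e2, e3]
    simp only [RCLike.re_to_complex] at e4 ⊢
    nlinarith [sq_nonneg ‖ampVec P ξ a - ampVec P η a‖, sq_nonneg ‖ampVec P ξ a‖,
      sq_nonneg ‖ampVec P η a‖]
  obtain ⟨W, hW1, hW2⟩ := exists_clm_of_norm_le (ampVec P ζ) τ.toL2ₗ hle
  have hWa : ∀ a : P, W ∘L amp ℕ (a : H →L[ℂ] H) = τ.lmul a ∘L W := fun a => by
    refine clm_eq_of_range_of_orthogonal (ampVec P ζ) (fun b => ?_) fun x hx => ?_
    · rw [ContinuousLinearMap.comp_apply, ContinuousLinearMap.comp_apply, amp_ampVec, hW1, hW1,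
        toL2ₗ_apply, toL2ₗ_apply, lmul_toL2]
    · rw [ContinuousLinearMap.comp_apply, ContinuousLinearMap.comp_apply, hW2 x hx, map_zero]
      refine hW2 _ fun b => ?_
      rw [inner_ampVec_amp]
      exact hx _
  -- `W` intertwines the actions of `P`, so `W⋆W` and its square root `R` commute with `1 ⊗ P`. Then
  -- `⟨R ζ, a R ζ⟩ = ⟨W ζ, W (a ζ)⟩ = ⟨1, a⟩ = τ(a)`.
  set T : EllTwo ℕ H →L[ℂ] EllTwo ℕ H := ContinuousLinearMap.adjoint W ∘L W with hT
  have hT0 : 0 ≤ T :=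
    (ContinuousLinearMap.nonneg_iff_isPositive _).2 (ContinuousLinearMap.isPositive_adjoint_comp_self W)
  have hTa : ∀ a : P, Commute T (amp ℕ (a : H →L[ℂ] H)) := fun a => by
    ext1 x
    refine ext_inner_left ℂ fun y => ?_
    have e1 : ∀ (b : P) (z : EllTwo ℕ H), W (amp ℕ (b : H →L[ℂ] H) z) = τ.lmul b (W z) :=
      fun b z => congrArg (fun S : EllTwo ℕ H →L[ℂ] τ.L2 => S z) (hWa b)
    simp only [mul_apply_eq_comp, hT, ContinuousLinearMap.comp_apply]
    rw [ContinuousLinearMap.adjoint_inner_right, e1, ← inner_star_apply_left, star_lmul, ← e1,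
      ← inner_star_apply_left, ContinuousLinearMap.adjoint_inner_right, ← amp_star]
    rfl
  obtain ⟨R, hRR, hRs, hRc⟩ := exists_positive_sqrt hT0
  refine ⟨R ζ, fun a => ?_⟩
  have hRa : Commute R (amp ℕ (a : H →L[ℂ] H)) := hRc _ (hTa a)
  have e1 : amp ℕ (a : H →L[ℂ] H) (R ζ) = R (amp ℕ (a : H →L[ℂ] H) ζ) :=
    (congrArg (fun S : EllTwo ℕ H →L[ℂ] EllTwo ℕ H => S ζ) hRa.eq).symm
  have e2 : ∀ x, R (R x) = ContinuousLinearMap.adjoint W (W x) := fun x =>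
    congrArg (fun S : EllTwo ℕ H →L[ℂ] EllTwo ℕ H => S x) hRR
  have e3 : W ζ = τ.toL2 1 := hW1 1
  have e4 : W (amp ℕ (a : H →L[ℂ] H) ζ) = τ.toL2 a := hW1 a
  rw [e1, ← inner_star_apply_left, hRs, e2, ContinuousLinearMap.adjoint_inner_left, e3, e4,
    inner_toL2, star_one, one_mul]

end TraceVectorExists

/-! ### Coordinates in a double `ℓ²` sum -/

section Columns

theorem summable_uncurry_norm_sq {ι κ H : Type*} [NormedAddCommGroup H]
    (ξ : EllTwo ι (EllTwo κ H)) :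
    Summable fun p : ι × κ => ‖ξ p.1 p.2‖ ^ 2 := by
  rw [summable_prod_of_nonneg fun p => sq_nonneg _]
  refine ⟨fun i => ellTwo_summable (ξ i), ?_⟩
  simpa only [ellTwo_norm_sq] using ellTwo_summable ξ

variable {ι κ : Type*} {H : Type*} [NormedAddCommGroup H] [InnerProductSpace ℂ H]
variable {H' : Type*} [NormedAddCommGroup H'] [InnerProductSpace ℂ H']

/-- `1 ⊗ T : ℓ²(ι) ⊗ H → ℓ²(ι) ⊗ H'`. -/
noncomputable def mapOp (ι : Type*) (T : H →L[ℂ] H') : EllTwo ι H →L[ℂ] EllTwo ι H' :=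
  have key : ∀ (ξ : EllTwo ι H) (i : ι), ‖T (ξ i)‖ ≤ ‖((‖T‖ : ℂ) • ξ) i‖ := fun ξ i => by
    rw [lp.coeFn_smul, Pi.smul_apply, norm_smul, Complex.norm_real, norm_norm]
    exact T.le_opNorm _
  LinearMap.mkContinuous
    { toFun := fun ξ => ⟨fun i => T (ξ i), (lp.memℓp ((‖T‖ : ℂ) • ξ)).mono' (key ξ)⟩
      map_add' := fun ξ η => lp.ext (funext fun i => map_add T (ξ i) (η i))
      map_smul' := fun c ξ => lp.ext (funext fun i => map_smul T c (ξ i)) } ‖T‖ fun ξ => by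
    calc _ ≤ ‖(‖T‖ : ℂ) • ξ‖ := lp.norm_mono (by norm_num) (key ξ)
      _ = ‖T‖ * ‖ξ‖ := by rw [norm_smul, Complex.norm_real, norm_norm]

@[simp] theorem mapOp_apply (T : H →L[ℂ] H') (ξ : EllTwo ι H) (i : ι) : mapOp ι T ξ i = T (ξ i) := rfl

/-- `η ↦ δ_g ⊗ η`, from `ℓ²(ι) ⊗ H` to `ℓ²(ι) ⊗ ℓ²(κ) ⊗ H`. -/
noncomputable def colSingle (ι : Type*) (g : κ) : EllTwo ι H →L[ℂ] EllTwo ι (EllTwo κ H) :=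
  mapOp ι (ellSingle g)

/-- The `g`-th component of a vector of `ℓ²(ι) ⊗ ℓ²(κ) ⊗ H`. -/
noncomputable def colEval (ι : Type*) (g : κ) : EllTwo ι (EllTwo κ H) →L[ℂ] EllTwo ι H :=
  mapOp ι (ellEval g)

theorem colEval_amp_colSingle (x : EllTwo κ H →L[ℂ] EllTwo κ H) (g h : κ) (η : EllTwo ι H) :
    colEval ι g (amp ι x (colSingle ι h η)) = amp ι (entry x g h) η := rfl

theorem inner_colSingle_left (g : κ) (η : EllTwo ι H) (ξ : EllTwo ι (EllTwo κ H)) :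
    ⟪colSingle ι g η, ξ⟫_ℂ = ⟪η, colEval ι g ξ⟫_ℂ := by
  rw [lp.inner_eq_tsum, lp.inner_eq_tsum]
  exact tsum_congr fun i => inner_ellSingle_left g (η i) (ξ i)

theorem summable_uncurry_inner (ξ η : EllTwo ι (EllTwo κ H)) :
    Summable fun p : ι × κ => ⟪ξ p.1 p.2, η p.1 p.2⟫_ℂ := by
  refine .of_norm_bounded ((summable_uncurry_norm_sq ξ).add (summable_uncurry_norm_sq η))
    fun p => (norm_inner_le_norm _ _).trans ?_
  nlinarith [sq_nonneg (‖ξ p.1 p.2‖ - ‖η p.1 p.2‖), sq_nonneg ‖ξ p.1 p.2‖, sq_nonneg ‖η p.1 p.2‖]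

theorem inner_eq_tsum_colEval (ξ η : EllTwo ι (EllTwo κ H)) :
    ⟪ξ, η⟫_ℂ = ∑' g, ⟪colEval ι g ξ, colEval ι g η⟫_ℂ := by
  simp only [lp.inner_eq_tsum, colEval, mapOp_apply, ellEval_apply]
  exact (summable_uncurry_inner ξ η).tsum_comm.symm

theorem summable_norm_colEval_sq (ξ : EllTwo ι (EllTwo κ H)) :
    Summable fun g => ‖colEval ι g ξ‖ ^ 2 := by
  have h := (summable_prod_of_nonneg fun p => sq_nonneg _).1
    (summable_uncurry_norm_sq ξ).prod_symm
  have h2 : Summable fun g => ∑' i, ‖colEval ι g ξ i‖ ^ 2 := h.2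
  simpa only [← ellTwo_norm_sq] using h2

end Columns

/-! ### Fourier coefficients and the trace of the crossed product -/

section FourierCoefficients

variable {Γ : Type*} [Group Γ] {H : Type*} [NormedAddCommGroup H] [InnerProductSpace ℂ H]

/-- The operator of right translation: `(ρ_k ξ)(h) = ξ(h k)`. -/
noncomputable def rightTranslationOp (k : Γ) : EllTwo Γ H →L[ℂ] EllTwo Γ H :=
  have mem : ∀ ξ : EllTwo Γ H, Memℓp (fun h => ξ (h * k)) 2 := fun ξ => by
    have h2 : 0 < (2 : ℝ≥0∞).toReal := by norm_num
    exact memℓp_gen (((lp.memℓp ξ).summable h2).comp_injective (mul_left_injective k))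
  LinearMap.mkContinuous
    { toFun := fun ξ => ⟨fun h => ξ (h * k), mem ξ⟩
      map_add' := fun _ _ => rfl
      map_smul' := fun _ _ => rfl } 1 fun ξ => by
    have h2 : 0 < (2 : ℝ≥0∞).toReal := by norm_num
    rw [one_mul, lp.norm_eq_tsum_rpow h2, lp.norm_eq_tsum_rpow h2]
    exact le_of_eq (congrArg (fun t : ℝ => t ^ (1 / (2 : ℝ≥0∞).toReal))
      ((Equiv.mulRight k).tsum_eq fun h => ‖ξ h‖ ^ (2 : ℝ≥0∞).toReal))

theorem rightTranslationOp_apply (k : Γ) (ξ : EllTwo Γ H) (h : Γ) :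
    rightTranslationOp k ξ h = ξ (h * k) := rfl

theorem translationOp_ellSingle (g h : Γ) (a : H) :
    translationOp g (ellSingle h a) = ellSingle (g * h) a := by
  apply lp.ext
  funext k
  rw [translationOp_apply]
  by_cases hk : k = g * h
  · subst hk; simp
  · rw [ellSingle_apply_ne hk, ellSingle_apply_ne fun h' => hk (by rw [← h']; group)]

variable [CompleteSpace H]

theorem star_translationOp (g : Γ) : star (translationOp (H := H) g) = translationOp g⁻¹ := by
  ext1 ξ
  refine ext_inner_left ℂ fun η => ?_
  rw [inner_star_apply_right, lp.inner_eq_tsum, lp.inner_eq_tsum,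
    ← (Equiv.mulLeft g).tsum_eq]
  exact tsum_congr fun h => by simp

variable {P : VonNeumannAlgebra H} (σ : VNAction Γ P)

theorem VNAction.coeffOp_apply (a : P) (ξ : EllTwo Γ H) (h : Γ) :
    σ.coeffOp a ξ h = ((σ h⁻¹ a : P) : H →L[ℂ] H) (ξ h) := rfl

theorem VNAction.coeffOp_ellSingle (a : P) (h : Γ) (v : H) :
    σ.coeffOp a (ellSingle h v) = ellSingle h (((σ h⁻¹ a : P) : H →L[ℂ] H) v) :=
  diagOp_ellSingle _ _ _ _ _

theorem VNAction.map_mul_apply (g h : Γ) (a : P) : σ (g * h) a = σ g (σ h a) := by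
  rw [map_mul]; rfl

theorem VNAction.map_one_apply (a : P) : σ 1 a = a := by
  rw [map_one]; rfl

theorem VNAction.star_coeffOp (a : P) : star (σ.coeffOp a) = σ.coeffOp (star a) := by
  rw [coeffOp, star_diagOp]
  ext1 ξ
  apply lp.ext
  funext h
  rw [diagOp_apply, coeffOp_apply, map_star]
  rfl

theorem VNAction.coeffOp_mul (a b : P) : σ.coeffOp (a * b) = σ.coeffOp a * σ.coeffOp b := by
  ext1 ξ
  apply lp.ext
  funext h
  rw [mul_apply_eq_comp, coeffOp_apply, coeffOp_apply, coeffOp_apply, map_mul]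
  rfl

theorem VNAction.coeffOp_add (a b : P) : σ.coeffOp (a + b) = σ.coeffOp a + σ.coeffOp b := by
  ext1 ξ
  apply lp.ext
  funext h
  rw [coeffOp_apply, map_add]
  rfl

theorem VNAction.coeffOp_smul (c : ℂ) (a : P) : σ.coeffOp (c • a) = c • σ.coeffOp a := by
  ext1 ξ
  apply lp.ext
  funext h
  rw [coeffOp_apply, map_smul]
  rfl

theorem VNAction.coeffOp_one : σ.coeffOp (1 : P) = 1 := by
  ext1 ξ
  apply lp.ext
  funext h
  rw [coeffOp_apply, map_one]
  rfl

theorem VNAction.translationOp_coeffOp (g : Γ) (a : P) :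
    translationOp g * σ.coeffOp a * translationOp g⁻¹ = σ.coeffOp (σ g a) := by
  ext1 ξ
  apply lp.ext
  funext h
  rw [mul_apply_eq_comp, mul_apply_eq_comp, translationOp_apply, coeffOp_apply, coeffOp_apply,
    translationOp_apply, ← map_mul_apply]
  simp

theorem VNAction.coeffOp_mem_crossedProduct {Q : VonNeumannAlgebra H} {a : P}
    (ha : (a : H →L[ℂ] H) ∈ Q) : σ.coeffOp a ∈ σ.crossedProduct Q :=
  subset_vnGenerated _ (Or.inl ⟨a, ha, rfl⟩)

theorem VNAction.translationOp_mem_crossedProduct (Q : VonNeumannAlgebra H) (g : Γ) :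
    translationOp g ∈ σ.crossedProduct Q :=
  subset_vnGenerated _ (Or.inr ⟨g, rfl⟩)

theorem VNAction.crossedProduct_le {Q : VonNeumannAlgebra H} {N : VonNeumannAlgebra (EllTwo Γ H)}
    (h1 : ∀ a : P, (a : H →L[ℂ] H) ∈ Q → σ.coeffOp a ∈ N)
    (h2 : ∀ g : Γ, translationOp g ∈ N) : σ.crossedProduct Q ≤ N := by
  refine vnGenerated_le ?_
  rintro _ (⟨a, ha, rfl⟩ | ⟨g, rfl⟩)
  · exact h1 a ha
  · exact h2 g

/-- If `v` intertwines the identity and `σ_k`, then `1 ⊗ v` followed after right translation by `k`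
commutes with every `π(a)` and every `λ_g`, hence with the crossed product. For `k = 1` and `v ∈ P'`
this shows that matrix entries lie in `P`. -/
theorem VNAction.commute_of_intertwine {x : EllTwo Γ H →L[ℂ] EllTwo Γ H} {Q : VonNeumannAlgebra H}
    (hx : x ∈ σ.crossedProduct Q) {k : Γ} {v : H →L[ℂ] H}
    (hv : ∀ a : P, v * a = ((σ k a : P) : H →L[ℂ] H) * v) (g h : Γ) :
    entry x g h * v = v * entry x (g * k) (h * k) := by
  have hR : amp Γ v * rightTranslationOp k ∈
      commutantOf ({T | ∃ a : P, (a : H →L[ℂ] H) ∈ Q ∧ T = σ.coeffOp a} ∪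
        Set.range fun g : Γ => translationOp g) := by
    have h1 : ∀ a : P, σ.coeffOp a * (amp Γ v * rightTranslationOp k) =
        amp Γ v * rightTranslationOp k * σ.coeffOp a := fun a => by
      ext1 ξ
      apply lp.ext
      funext h
      simp only [mul_apply_eq_comp, coeffOp_apply, amp_apply, rightTranslationOp_apply]
      have := congrArg (fun T : H →L[ℂ] H => T (ξ (h * k))) (hv (σ (h * k)⁻¹ a))
      simp only [mul_apply_eq_comp, ← σ.map_mul_apply] at this
      rw [this]
      simp
    have h2 : ∀ g : Γ, translationOp g * (amp Γ v * rightTranslationOp k) =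
        amp Γ v * rightTranslationOp k * translationOp g := fun g => by
      ext1 ξ
      apply lp.ext
      funext h
      simp [rightTranslationOp_apply, mul_assoc]
    refine mem_commutantOf.2 ?_
    rintro _ (⟨a, -, rfl⟩ | ⟨g, rfl⟩)
    · rw [star_coeffOp]; exact ⟨h1 _, h1 _⟩
    · rw [star_translationOp]; exact ⟨h2 _, h2 _⟩
  exact entry_of_commute (f := fun h => h * k) (mul_left_injective k) (fun _ _ => rfl)
    (mem_vnGenerated.1 hx _ hR).symm g h

theorem VNAction.entry_mem {x : EllTwo Γ H →L[ℂ] EllTwo Γ H} {Q : VonNeumannAlgebra H}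
    (hx : x ∈ σ.crossedProduct Q) (g h : Γ) : entry x g h ∈ P := by
  rw [VonNeumannAlgebra.mem_iff_commute]
  intro y hy
  have := σ.commute_of_intertwine hx (k := 1) (v := y)
    (fun a => by rw [map_one_apply]; exact (VonNeumannAlgebra.mem_commutant_iff.1 hy a a.2).symm) g h
  simpa using this.symm

/-- `c` is the family of Fourier coefficients of `x`, that is `x = ∑ λ_g c_g'` in matrix form. -/
def VNAction.IsCoeff (x : EllTwo Γ H →L[ℂ] EllTwo Γ H) (c : Γ → P) : Prop :=
  ∀ g h, entry x g h = ((σ h⁻¹ (c (g * h⁻¹)) : P) : H →L[ℂ] H)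

variable {σ}

theorem VNAction.IsCoeff.entry_one {x : EllTwo Γ H →L[ℂ] EllTwo Γ H} {c : Γ → P}
    (hc : σ.IsCoeff x c) (g : Γ) : entry x g 1 = c g := by
  rw [hc, inv_one, mul_one, map_one_apply]

theorem VNAction.IsCoeff.star {x : EllTwo Γ H →L[ℂ] EllTwo Γ H} {c : Γ → P}
    (hc : σ.IsCoeff x c) : σ.IsCoeff (star x) fun g => star (σ g⁻¹ (c g⁻¹)) := by
  intro g h
  rw [entry_star, hc, map_star, ← map_mul_apply]
  simp

theorem VNAction.IsCoeff.conj {x : EllTwo Γ H →L[ℂ] EllTwo Γ H} {c : Γ → P}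
    (hc : σ.IsCoeff x c) (g : Γ) :
    σ.IsCoeff (translationOp g * x * translationOp g⁻¹) fun k => σ g (c (g⁻¹ * k * g)) := by
  intro k l
  have : entry (translationOp g * x * translationOp g⁻¹) k l = entry x (g⁻¹ * k) (g⁻¹ * l) := by
    ext a
    simp only [entry_apply, mul_apply_eq_comp, translationOp_apply, translationOp_ellSingle]
  rw [this, hc, ← map_mul_apply]
  simp [mul_assoc]

theorem VNAction.IsCoeff.eq_coeffOp {x : EllTwo Γ H →L[ℂ] EllTwo Γ H} {c : Γ → P}
    (hc : σ.IsCoeff x c) (h : ∀ g, g ≠ 1 → c g = 0) : x = σ.coeffOp (c 1) := by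
  refine entry_ext fun i j => ?_
  rw [hc]
  ext a
  rw [entry_apply, coeffOp_ellSingle]
  by_cases hij : i = j
  · subst hij; simp
  · rw [ellSingle_apply_ne hij, h _ fun h' => hij (mul_inv_eq_one.1 h')]
    simp

theorem VNAction.IsCoeff.eq_zero {x : EllTwo Γ H →L[ℂ] EllTwo Γ H} {c : Γ → P}
    (hc : σ.IsCoeff x c) (h : ∀ g, c g = 0) : x = 0 := by
  refine entry_ext fun i j => ?_
  rw [hc, h, map_zero]
  rfl

variable {τ : TracialState P} {Ω : EllTwo ℕ H}

/-- `Ω` implements the trace `τ`. -/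
def TracialState.IsVector (τ : TracialState P) (Ω : EllTwo ℕ H) : Prop :=
  ∀ a : P, ⟪Ω, amp ℕ (a : H →L[ℂ] H) Ω⟫_ℂ = τ.toPositive a

theorem TracialState.IsVector.inner (hΩ : τ.IsVector Ω) (a b : P) :
    ⟪ampVec P Ω a, ampVec P Ω b⟫_ℂ = τ.toPositive (star a * b) := by
  rw [← hΩ, ampVec_apply, ← inner_star_apply_right, ← amp_star]
  rfl

theorem TracialState.IsVector.norm_sq (hΩ : τ.IsVector Ω) (a : P) :
    ‖ampVec P Ω a‖ ^ 2 = (τ.toPositive (star a * a)).re := by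
  rw [← hΩ.inner]
  exact (inner_self_eq_norm_sq (𝕜 := ℂ) _).symm

theorem TracialState.IsVector.norm_toL2 (hΩ : τ.IsVector Ω) (a : P) :
    ‖ampVec P Ω a‖ = ‖τ.toL2 a‖ := by
  rw [← sq_eq_sq₀ (norm_nonneg _) (norm_nonneg _), hΩ.norm_sq, ← τ.inner_toL2]
  exact inner_self_eq_norm_sq (𝕜 := ℂ) _

theorem TracialState.IsVector.eq_zero (hΩ : τ.IsVector Ω) {a : P}
    (ha : amp ℕ (a : H →L[ℂ] H) Ω = 0) : a = 0 := by
  apply τ.faithful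
  rw [← hΩ.inner, ampVec_apply, ha, inner_zero_left]

theorem TracialState.IsVector.norm_action (hΩ : τ.IsVector Ω) (hσ : σ.TracePreserving τ) (g : Γ)
    (a : P) : ‖ampVec P Ω (σ g a)‖ = ‖ampVec P Ω a‖ := by
  rw [← sq_eq_sq₀ (norm_nonneg _) (norm_nonneg _), hΩ.norm_sq, hΩ.norm_sq, ← map_star, ← map_mul, hσ]

/-- Since `σ_k` preserves `τ`, the map `a Ω ↦ σ_k(a) Ω` is isometric; extended by zero on the
complement, it intertwines because the complement is stable under `1 ⊗ P`. It replaces a unitary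
implementing `σ_k`, which need not exist on `H`. -/
theorem TracialState.IsVector.exists_intertwiner (hΩ : τ.IsVector Ω) (hσ : σ.TracePreserving τ)
    (k : Γ) : ∃ V : EllTwo ℕ H →L[ℂ] EllTwo ℕ H, V Ω = Ω ∧
      ∀ a : P, V * amp ℕ (a : H →L[ℂ] H) = amp ℕ ((σ k a : P) : H →L[ℂ] H) * V := by
  let s : P →ₗ[ℂ] P :=
    { toFun := σ k, map_add' := map_add (σ k), map_smul' := fun c x => map_smul (σ k) c x }
  obtain ⟨V, hV1, hV2⟩ := exists_clm_of_norm_le (ampVec P Ω) (ampVec P Ω ∘ₗ s)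
    fun a => (hΩ.norm_action hσ k a).le
  have hV1' : ∀ a, V (ampVec P Ω a) = ampVec P Ω (σ k a) := hV1
  refine ⟨V, ?_, fun a => ?_⟩
  · have := hV1' 1
    rw [show σ k 1 = 1 from _root_.map_one _] at this
    exact this
  · refine clm_eq_of_range_of_orthogonal (ampVec P Ω) (fun b => ?_) fun x hx => ?_
    · rw [mul_apply_eq_comp, mul_apply_eq_comp, amp_ampVec, hV1', hV1', amp_ampVec, map_mul]
    · rw [mul_apply_eq_comp, mul_apply_eq_comp, hV2 x hx, map_zero]
      refine hV2 _ fun b => ?_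
      rw [inner_ampVec_amp]
      exact hx _

/-- Each matrix entry of the intertwiner `V` is an operator on `H` to which `commute_of_intertwine`
applies. Reassembling the entries and evaluating at `Ω = V Ω`, which separates `P`, gives the
covariance of the entries of `x`; all of them are then determined by the column of `1`. -/
theorem VNAction.exists_isCoeff (hΩ : τ.IsVector Ω) (hσ : σ.TracePreserving τ)
    {x : EllTwo Γ H →L[ℂ] EllTwo Γ H} (hx : x ∈ σ.crossedProduct P) :
    ∃ c : Γ → P, σ.IsCoeff x c := by
  let X : Γ → Γ → P := fun g h => ⟨entry x g h, σ.entry_mem hx g h⟩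
  have hX : ∀ g h k, X g h = σ k (X (g * k) (h * k)) := fun g h k => by
    obtain ⟨V, hVΩ, hV⟩ := hΩ.exists_intertwiner hσ k
    have e1 : ∀ n m (a : P), entry V n m * a = ((σ k a : P) : H →L[ℂ] H) * entry V n m := by
      intro n m a
      ext v
      have := congrArg (fun T : EllTwo ℕ H →L[ℂ] EllTwo ℕ H => T (ellSingle m v) n) (hV a)
      simp only [mul_apply_eq_comp, amp_ellSingle, amp_apply] at this
      exact this
    have e2 : amp ℕ (X g h : H →L[ℂ] H) * V =
        amp ℕ ((σ k (X (g * k) (h * k)) : P) : H →L[ℂ] H) * V := by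
      refine entry_ext fun n m => ?_
      exact (σ.commute_of_intertwine hx (e1 n m) g h).trans (e1 n m (X (g * k) (h * k)))
    have e3 := congrArg (fun T : EllTwo ℕ H →L[ℂ] EllTwo ℕ H => T Ω) e2
    simp only [mul_apply_eq_comp, hVΩ] at e3
    rw [← sub_eq_zero]
    refine hΩ.eq_zero ?_
    rw [← sub_eq_zero] at e3
    exact e3
  refine ⟨fun g => X g 1, fun g h => ?_⟩
  have := hX g h h⁻¹
  rw [mul_inv_cancel] at this
  exact congrArg Subtype.val this

theorem VNAction.IsCoeff.colEval {x : EllTwo Γ H →L[ℂ] EllTwo Γ H} {c : Γ → P}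
    (hc : σ.IsCoeff x c) (g : Γ) (Ω : EllTwo ℕ H) :
    colEval ℕ g (amp ℕ x (colSingle ℕ 1 Ω)) = ampVec P Ω (c g) := by
  rw [colEval_amp_colSingle, hc.entry_one]
  rfl

/-- The trace of the crossed product. -/
theorem VNAction.isTraceVector (hΩ : τ.IsVector Ω) (hσ : σ.TracePreserving τ) :
    IsTraceVector (amplify ℕ (σ.crossedProduct P)) (colSingle ℕ (1 : Γ) Ω) := by
  have key : ∀ (x y : EllTwo Γ H →L[ℂ] EllTwo Γ H) (c d : Γ → P), σ.IsCoeff x c → σ.IsCoeff y d →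
      ⟪colSingle ℕ (1 : Γ) Ω, amp ℕ x (amp ℕ y (colSingle ℕ (1 : Γ) Ω))⟫_ℂ =
        ∑' g, τ.toPositive (σ g⁻¹ (c g⁻¹) * d g) := by
    intro x y c d hc hd
    rw [← inner_star_apply_left, ← amp_star, inner_eq_tsum_colEval]
    refine tsum_congr fun g => ?_
    rw [hc.star.colEval, hd.colEval, hΩ.inner, star_star]
  constructor
  · intro a ha b hb
    obtain ⟨x, hx, rfl⟩ := exists_amp_eq ha
    obtain ⟨y, hy, rfl⟩ := exists_amp_eq hb
    obtain ⟨c, hc⟩ := VNAction.exists_isCoeff hΩ hσ hx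
    obtain ⟨d, hd⟩ := VNAction.exists_isCoeff hΩ hσ hy
    -- Under `g ↦ g⁻¹` the two series agree term by term, by traciality and invariance of `τ`.
    rw [key x y c d hc hd, key y x d c hd hc, ← (Equiv.inv Γ).tsum_eq]
    refine tsum_congr fun g => ?_
    rw [Equiv.inv_apply, inv_inv, τ.map_mul_comm, ← hσ g⁻¹, map_mul, ← map_mul_apply,
      inv_mul_cancel, map_one_apply]
  · intro a ha h
    obtain ⟨x, hx, rfl⟩ := exists_amp_eq ha
    obtain ⟨c, hc⟩ := VNAction.exists_isCoeff hΩ hσ hx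
    rw [hc.eq_zero fun g => ?_]
    · rfl
    · refine hΩ.eq_zero ?_
      have := hc.colEval g Ω
      rw [h, map_zero] at this
      exact this.symm

end FourierCoefficients

/-! ### Norms and decay of the coordinates -/

section Columns

variable {ι κ : Type*} {H : Type*} [NormedAddCommGroup H] [InnerProductSpace ℂ H]

theorem norm_colSingle (g : κ) (η : EllTwo ι H) : ‖colSingle ι g η‖ = ‖η‖ := by
  have h : colEval ι g (colSingle ι g η) = η := by
    apply lp.ext
    funext i
    exact ellSingle_apply_self g (η i)
  rw [← sq_eq_sq₀ (norm_nonneg _) (norm_nonneg _), ← inner_self_eq_norm_sq (𝕜 := ℂ),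
    inner_colSingle_left, h]
  exact inner_self_eq_norm_sq (𝕜 := ℂ) _

theorem norm_colEval_le (g : κ) (ξ : EllTwo ι (EllTwo κ H)) : ‖colEval ι g ξ‖ ≤ ‖ξ‖ := by
  refine le_of_sq_le_sq ?_ (norm_nonneg _)
  rw [ellTwo_norm_sq, ellTwo_norm_sq ξ]
  refine (ellTwo_summable _).tsum_le_tsum (fun i => ?_) (ellTwo_summable _)
  gcongr
  exact lp.norm_apply_le_norm (by norm_num) (ξ i) g

theorem tendsto_norm_colEval (ξ : EllTwo ι (EllTwo κ H)) :
    Tendsto (fun g => ‖colEval ι g ξ‖) cofinite (nhds 0) := by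
  have := (summable_norm_colEval_sq ξ).tendsto_cofinite_zero.sqrt
  simpa [Real.sqrt_sq] using this

end Columns

/-! ### Intermediate algebras of the crossed product -/

section Intermediate

variable {Γ : Type*} [Group Γ] {H : Type*} [NormedAddCommGroup H] [InnerProductSpace ℂ H]
  [CompleteSpace H] {P : VonNeumannAlgebra H} {σ : VNAction Γ P} {τ : TracialState P}
  {Ω : EllTwo ℕ H}

/-- Places the vectors `ξ_i` of the compactness condition in the Hilbert space on which the
expectation acts as a projection. -/
theorem TracialState.IsVector.exists_isometry (hΩ : τ.IsVector Ω) :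
    ∃ W : τ.L2 →L[ℂ] EllTwo ℕ H, (∀ a, W (τ.toL2 a) = ampVec P Ω a) ∧ (∀ ξ, ‖W ξ‖ = ‖ξ‖) ∧
      ∀ (a : P) ξ, W (τ.lmul a ξ) = amp ℕ (a : H →L[ℂ] H) (W ξ) := by
  obtain ⟨W, hW, -⟩ := exists_clm_of_norm_le τ.toL2ₗ (ampVec P Ω) fun a => (hΩ.norm_toL2 a).le
  have hW' : ∀ a, W (τ.toL2 a) = ampVec P Ω a := hW
  refine ⟨W, hW', fun ξ => ?_, fun a ξ => ?_⟩
  · refine τ.denseRange_toL2.induction_on ξ (isClosed_eq (by fun_prop) (by fun_prop)) fun b => ?_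
    rw [hW', hΩ.norm_toL2]
  · refine τ.denseRange_toL2.induction_on ξ (isClosed_eq (by fun_prop) (by fun_prop)) fun b => ?_
    rw [τ.lmul_toL2, hW', hW', amp_ampVec]

theorem VNAction.amp_coeffOp_colSingle (σ : VNAction Γ P) (a : P) (η : EllTwo ℕ H) :
    amp ℕ (σ.coeffOp a) (colSingle ℕ (1 : Γ) η) = colSingle ℕ 1 (amp ℕ (a : H →L[ℂ] H) η) := by
  apply lp.ext
  funext n
  have := σ.coeffOp_ellSingle a 1 (η n)
  rw [inv_one, map_one_apply] at this
  exact this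

/-- `π(a)` is diagonal over `Γ` with entries `σ_{g⁻¹}(a)` of norm at most `‖a‖`, so multiplying by
it cannot move mass between coordinates. -/
theorem VNAction.norm_colEval_amp_coeffOp_le (σ : VNAction Γ P) {a : P} {C : ℝ} (ha : ‖a‖ ≤ C)
    (g : Γ) (ξ : EllTwo ℕ (EllTwo Γ H)) :
    ‖colEval ℕ g (amp ℕ (σ.coeffOp a) ξ)‖ ≤ C * ‖colEval ℕ g ξ‖ :=
  norm_amp_apply_le ((σ g⁻¹ a : P) : H →L[ℂ] H) ((σ.norm_le _ _).trans ha) (colEval ℕ g ξ)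

/-- The conditional expectation onto an intermediate algebra maps almost periodic elements of `P`
into `P`. -/
theorem VNAction.coeff_eq_zero_of_almostPeriodic (hΓ : IsICC Γ) (hΩ : τ.IsVector Ω)
    (hσ : σ.TracePreserving τ) {P₀ : VonNeumannAlgebra H} {N : VonNeumannAlgebra (EllTwo Γ H)}
    (hN₀ : σ.crossedProduct P₀ ≤ N) (hN : N ≤ σ.crossedProduct P) {f : P}
    (hf : ∀ ε : ℝ, 0 < ε → ∃ (n : ℕ) (ξ : Fin n → τ.L2) (κ : Fin n → Γ → P),
      (∀ i g, (κ i g : H →L[ℂ] H) ∈ P₀) ∧ (∃ C : ℝ, ∀ i g, ‖κ i g‖ ≤ C) ∧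
      ∀ g, ‖τ.toL2 (σ g f) - ∑ i, τ.lmul (κ i g) (ξ i)‖ ≤ ε)
    {y : EllTwo Γ H →L[ℂ] EllTwo Γ H} (hy : y ∈ N)
    (hfy : orbitProj (amplify ℕ N) (colSingle ℕ (1 : Γ) Ω)
      (amp ℕ (σ.coeffOp f) (colSingle ℕ (1 : Γ) Ω)) = amp ℕ y (colSingle ℕ (1 : Γ) Ω))
    {c : Γ → P} (hc : σ.IsCoeff y c) {h : Γ} (hh : h ≠ 1) : c h = 0 := by
  have hT := VNAction.isTraceVector hΩ hσ
  obtain ⟨W, hW, hWn, hWl⟩ := hΩ.exists_isometry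
  set e := orbitProj (amplify ℕ N) (colSingle ℕ (1 : Γ) Ω) with he
  have key : ∀ ε : ℝ, 0 < ε → ‖ampVec P Ω (c h)‖ ≤ 2 * ε := by
    intro ε hε
    obtain ⟨n, ξ, κ, hκ, ⟨C, hC⟩, hfκ⟩ := hf ε hε
    -- The `η i` do not depend on `g`. Their coordinates tend to zero along the cofinite filter, so
    -- the infinite conjugacy class of `h` contains `g h g⁻¹` where the bound is below `ε`; this `g`
    -- is then used in the almost periodicity estimate.
    set η : Fin n → EllTwo ℕ (EllTwo Γ H) := fun i => e (colSingle ℕ 1 (W (ξ i))) with hη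
    have hlim : Tendsto (fun g => ∑ i, C * ‖colEval ℕ g (η i)‖) cofinite (nhds 0) := by
      have := tendsto_finsetSum (Finset.univ : Finset (Fin n)) fun i _ =>
        (tendsto_norm_colEval (η i)).const_mul C
      simpa using this
    have hev : {g | ∑ i, C * ‖colEval ℕ g (η i)‖ < ε}ᶜ.Finite :=
      (hlim.eventually (gt_mem_nhds hε))
    obtain ⟨k, hk, hkn⟩ := (hΓ h hh).exists_notMem_finite hev
    obtain ⟨g, rfl⟩ := isConj_iff.1 hk
    have hsum : ∑ i, C * ‖colEval ℕ (g * h * g⁻¹) (η i)‖ < ε := by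
      by_contra hcon
      exact hkn hcon
    have h1 : e (colSingle ℕ 1 (W (τ.toL2 (σ g f)))) =
        amp ℕ (translationOp g * y * translationOp g⁻¹) (colSingle ℕ (1 : Γ) Ω) := by
      have hlam : amp ℕ (translationOp g) ∈ amplify ℕ N :=
        amp_mem_amplify (hN₀ (σ.translationOp_mem_crossedProduct P₀ g))
      have := hT.orbitProj_conj (amplify_mono hN)
        (amp_mem_amplify (σ.coeffOp_mem_crossedProduct (Q := P) f.2)) (amp_mem_amplify hy) hlam hfy
      rw [← amp_star, star_translationOp, ← amp_mul, ← amp_mul, ← amp_mul, ← amp_mul,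
        translationOp_coeffOp, amp_coeffOp_colSingle] at this
      rw [hW]
      exact this
    have h2 : e (colSingle ℕ 1 (W (∑ i, τ.lmul (κ i g) (ξ i)))) =
        ∑ i, amp ℕ (σ.coeffOp (κ i g)) (η i) := by
      simp only [map_sum, hWl]
      refine Finset.sum_congr rfl fun i _ => ?_
      rw [← amp_coeffOp_colSingle, he, orbitProj_apply_comm]
      exact amp_mem_amplify (hN₀ (σ.coeffOp_mem_crossedProduct (hκ i g)))
    have h3 : ‖amp ℕ (translationOp g * y * translationOp g⁻¹) (colSingle ℕ (1 : Γ) Ω) -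
        ∑ i, amp ℕ (σ.coeffOp (κ i g)) (η i)‖ ≤ ε := by
      rw [← h1, ← h2, ← map_sub, ← map_sub, ← map_sub]
      refine (norm_orbitProj_apply_le _ _ _).trans ?_
      rw [norm_colSingle, hWn]
      exact hfκ g
    -- At the coordinate `g h g⁻¹` the first vector has entry `σ_g(c h) Ω`, whose norm is that of `c
    -- h Ω`.
    have h4 := (norm_colEval_le (g * h * g⁻¹) _).trans h3
    rw [map_sub, (hc.conj g).colEval] at h4
    have h5 : g⁻¹ * (g * h * g⁻¹) * g = h := by group
    rw [h5, map_sum] at h4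
    rw [← hΩ.norm_action hσ g]
    calc ‖ampVec P Ω (σ g (c h))‖
        ≤ ‖ampVec P Ω (σ g (c h)) -
            ∑ i, colEval ℕ (g * h * g⁻¹) (amp ℕ (σ.coeffOp (κ i g)) (η i))‖ +
          ‖∑ i, colEval ℕ (g * h * g⁻¹) (amp ℕ (σ.coeffOp (κ i g)) (η i))‖ := by
            rw [add_comm]; exact norm_le_norm_add_norm_sub' _ _
      _ ≤ ε + ∑ i, C * ‖colEval ℕ (g * h * g⁻¹) (η i)‖ := by
          gcongr
          exact norm_sum_le_of_le _ fun i _ => σ.norm_colEval_amp_coeffOp_le (hC i g) _ _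
      _ ≤ 2 * ε := by linarith
  refine hΩ.eq_zero (norm_eq_zero.1 (le_antisymm (le_of_forall_pos_le_add fun ε hε => ?_)
    (norm_nonneg _)))
  have := key (ε / 2) (by positivity)
  rw [zero_add]
  calc _ ≤ 2 * (ε / 2) := this
    _ = ε := by ring

/-- The elements of `P` that belong to `N`. -/
noncomputable def VNAction.coeffAlgebra (σ : VNAction Γ P) (N : VonNeumannAlgebra (EllTwo Γ H)) :
    VonNeumannAlgebra H :=
  vnGenerated {T | ∃ a : P, σ.coeffOp a ∈ N ∧ (a : H →L[ℂ] H) = T}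

theorem VNAction.coeffAlgebra_le (σ : VNAction Γ P) (N : VonNeumannAlgebra (EllTwo Γ H)) :
    σ.coeffAlgebra N ≤ P := by
  refine vnGenerated_le ?_
  rintro _ ⟨a, -, rfl⟩
  exact a.2

/-- The generated algebra acquires no new elements. The projection onto the closure of `{b Ω | π(b)
∈ N}` commutes with the generators `1 ⊗ b`, hence with `1 ⊗ a`, and fixes `Ω`. So `a Ω` is a limit
of such `b Ω`, and `mem_of_mem_closure` gives `π(a) ∈ N`. -/
theorem VNAction.mem_coeffAlgebra_iff (hΩ : τ.IsVector Ω) (hσ : σ.TracePreserving τ)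
    {N : VonNeumannAlgebra (EllTwo Γ H)} (hN : N ≤ σ.crossedProduct P) {a : P} :
    (a : H →L[ℂ] H) ∈ σ.coeffAlgebra N ↔ σ.coeffOp a ∈ N := by
  refine ⟨fun ha => ?_, fun ha => subset_vnGenerated _ ⟨a, ha, rfl⟩⟩
  have hT := VNAction.isTraceVector hΩ hσ
  refine mem_of_amp_mem (ι := ℕ) (hT.mem_of_mem_closure (amplify_mono hN)
    (amp_mem_amplify (σ.coeffOp_mem_crossedProduct a.2)) ?_)
  let V : Submodule ℂ (EllTwo ℕ H) :=
    { carrier := {v | ∃ b : P, σ.coeffOp b ∈ N ∧ ampVec P Ω b = v}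
      add_mem' := by
        rintro _ _ ⟨b, hb, rfl⟩ ⟨d, hd, rfl⟩
        exact ⟨b + d, by rw [coeffOp_add]; exact add_mem hb hd, map_add _ _ _⟩
      zero_mem' := ⟨(0 : ℂ) • 1, by
        rw [coeffOp_smul, zero_smul]; exact zero_mem N, by rw [zero_smul, map_zero]⟩
      smul_mem' := by
        rintro c _ ⟨b, hb, rfl⟩
        exact ⟨c • b, by rw [coeffOp_smul]; exact SMulMemClass.smul_mem c hb, map_smul _ _ _⟩ }
  have hΩV : Ω ∈ V.topologicalClosure := V.le_topologicalClosure
    ⟨1, by rw [coeffOp_one]; exact one_mem N, rfl⟩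
  let p := V.topologicalClosure.starProjection
  have hinv : ∀ b : P, σ.coeffOp b ∈ N → ∀ v ∈ V.topologicalClosure,
      amp ℕ (b : H →L[ℂ] H) v ∈ V.topologicalClosure := fun b hb v hv => by
    refine map_mem_closure (amp ℕ (b : H →L[ℂ] H)).continuous hv ?_
    rintro _ ⟨d, hd, rfl⟩
    exact ⟨b * d, by rw [coeffOp_mul]; exact mul_mem hb hd, rfl⟩
  have hcomm : ∀ b : P, σ.coeffOp b ∈ N →
      amp ℕ (b : H →L[ℂ] H) * p = p * amp ℕ (b : H →L[ℂ] H) := fun b hb => by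
    ext1 ξ
    refine (Submodule.eq_starProjection_of_mem_orthogonal (hinv b hb _
      (Submodule.starProjection_apply_mem _ _)) ?_).symm
    rw [Submodule.mem_orthogonal]
    intro v hv
    change ⟪v, amp ℕ (b : H →L[ℂ] H) ξ -
      amp ℕ (b : H →L[ℂ] H) (V.topologicalClosure.starProjection ξ)⟫_ℂ = 0
    rw [← map_sub, ← inner_star_apply_left, ← amp_star]
    have hb' : σ.coeffOp (star b) ∈ N := by rw [← star_coeffOp]; exact star_mem hb
    exact (Submodule.mem_orthogonal _ _).1 (Submodule.sub_starProjection_mem_orthogonal ξ) _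
      (hinv (star b) hb' v hv)
  have hp : p ∈ commutantOf (amp ℕ '' {T | ∃ a : P, σ.coeffOp a ∈ N ∧ (a : H →L[ℂ] H) = T}) := by
    refine mem_commutantOf.2 ?_
    rintro _ ⟨_, ⟨b, hb, rfl⟩, rfl⟩
    refine ⟨hcomm b hb, ?_⟩
    rw [← amp_star]
    exact hcomm (star b) (by rw [← star_coeffOp]; exact star_mem hb)
  have hpa := congrArg (fun T : EllTwo ℕ H →L[ℂ] EllTwo ℕ H => T Ω)
    (mem_vnGenerated.1 (amp_mem_vnGenerated (ι := ℕ) ha) p hp)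
  simp only [mul_apply_eq_comp] at hpa
  rw [show p Ω = Ω from Submodule.starProjection_eq_self_iff.2 hΩV] at hpa
  have haV : amp ℕ (a : H →L[ℂ] H) Ω ∈ V.topologicalClosure :=
    Submodule.starProjection_eq_self_iff.1 hpa
  rw [amp_coeffOp_colSingle]
  refine map_mem_closure (colSingle ℕ (1 : Γ)).continuous haV ?_
  rintro _ ⟨b, hb, rfl⟩
  refine ⟨amp ℕ (σ.coeffOp b), amp_mem_amplify hb, ?_⟩
  rw [amp_coeffOp_colSingle]
  rfl

/-- Intermediate algebras of a compact extension by an icc group are crossed products. -/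
theorem VNAction.exists_eq_crossedProduct (hΓ : IsICC Γ) {P₀ : VonNeumannAlgebra H} (hP₀ : P₀ ≤ P)
    (hσ : σ.TracePreserving τ) (hcpt : σ.IsCompactExtension τ P₀)
    {N : VonNeumannAlgebra (EllTwo Γ H)} (hN₀ : σ.crossedProduct P₀ ≤ N)
    (hN : N ≤ σ.crossedProduct P) :
    ∃ Q : VonNeumannAlgebra H, P₀ ≤ Q ∧ Q ≤ P ∧ σ.Invariant Q ∧ N = σ.crossedProduct Q := by
  obtain ⟨Ω, hΩ⟩ := τ.exists_vector
  have hΩ : τ.IsVector Ω := hΩ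
  have hT := VNAction.isTraceVector hΩ hσ
  have hQ := fun a : P => VNAction.mem_coeffAlgebra_iff (a := a) hΩ hσ hN
  have hlam : ∀ g : Γ, translationOp g ∈ N :=
    fun g => hN₀ (σ.translationOp_mem_crossedProduct P₀ g)
  set Ωh := colSingle ℕ (1 : Γ) Ω with hΩh
  set e := orbitProj (amplify ℕ N) Ωh with he
  have hcond : ∀ x ∈ σ.crossedProduct P, ∃ y ∈ N, e (amp ℕ x Ωh) = amp ℕ y Ωh := fun x hx => by
    obtain ⟨z, hz, hxz⟩ := hT.exists_condExp (amplify_mono hN) (amp_mem_amplify hx)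
    obtain ⟨y, hy, rfl⟩ := exists_amp_eq hz
    exact ⟨y, hy, hxz⟩
  -- The expectation onto `N` maps all of `P` into `P`. The coordinates at `g ≠ 1` are continuous
  -- linear functions on `L²(P, τ)` that vanish on the almost periodic elements, whose span is
  -- dense.
  have hE : ∀ a : P, ∃ b : P, σ.coeffOp b ∈ N ∧
      e (amp ℕ (σ.coeffOp a) Ωh) = amp ℕ (σ.coeffOp b) Ωh := by
    intro a
    have hzero : ∀ (ξ : τ.L2) (W : τ.L2 →L[ℂ] EllTwo ℕ H),
        (∀ a, W (τ.toL2 a) = ampVec P Ω a) → ∀ g : Γ, g ≠ 1 →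
        colEval ℕ g (e (colSingle ℕ 1 (W ξ))) = 0 := by
      intro ξ W hW g hg
      obtain ⟨F, hF, hap⟩ := hcpt
      have hξ : ξ ∈ closure (Submodule.span ℂ (τ.toL2 '' F) : Set τ.L2) := by rw [hF]; trivial
      let L : τ.L2 →L[ℂ] EllTwo ℕ H := colEval ℕ g ∘L e ∘L colSingle ℕ 1 ∘L W
      have hL : (Submodule.span ℂ (τ.toL2 '' F)) ≤ L.ker := by
        rw [Submodule.span_le]
        rintro _ ⟨f, hf, rfl⟩
        obtain ⟨y, hy, hfy⟩ := hcond _ (σ.coeffOp_mem_crossedProduct (Q := P) f.2)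
        obtain ⟨c, hc⟩ := VNAction.exists_isCoeff hΩ hσ (hN hy)
        have hcg := VNAction.coeff_eq_zero_of_almostPeriodic hΓ hΩ hσ hN₀ hN (hap f hf) hy hfy hc hg
        have e1 : L (τ.toL2 f) = colEval ℕ g (e (amp ℕ (σ.coeffOp f) Ωh)) := by
          rw [hΩh, amp_coeffOp_colSingle]
          exact congrArg (fun v => colEval ℕ g (e (colSingle ℕ 1 v))) (hW f)
        show L (τ.toL2 f) = 0
        rw [e1, hfy, hΩh, hc.colEval, hcg, map_zero]
      exact closure_minimal hL (isClosed_eq L.continuous continuous_const) hξ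
    obtain ⟨W, hW, -, -⟩ := hΩ.exists_isometry
    obtain ⟨y, hy, hay⟩ := hcond _ (σ.coeffOp_mem_crossedProduct (Q := P) a.2)
    obtain ⟨c, hc⟩ := VNAction.exists_isCoeff hΩ hσ (hN hy)
    have hyc := hc.eq_coeffOp fun g hg => by
      refine hΩ.eq_zero ?_
      have := hzero (τ.toL2 a) W hW g hg
      rw [hW, ampVec_apply, ← amp_coeffOp_colSingle, ← hΩh, hay, hΩh, hc.colEval] at this
      exact this
    exact ⟨c 1, hyc ▸ hy, by rw [hay, hyc]⟩
  refine ⟨σ.coeffAlgebra N, fun x hx => ?_, σ.coeffAlgebra_le N, fun g a ha => ?_, ?_⟩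
  · exact (hQ ⟨x, hP₀ hx⟩).2 (hN₀ (σ.coeffOp_mem_crossedProduct hx))
  · rw [hQ] at ha ⊢
    rw [← translationOp_coeffOp]
    exact mul_mem (mul_mem (hlam g) ha) (hlam g⁻¹)
  · have hRN : σ.crossedProduct (σ.coeffAlgebra N) ≤ N :=
      σ.crossedProduct_le (fun a ha => (hQ a).1 ha) hlam
    refine le_antisymm (fun x hx => ?_) hRN
    set R := σ.crossedProduct (σ.coeffAlgebra N) with hR
    obtain ⟨z, hz, hxz⟩ := hT.exists_condExp (amplify_mono (hRN.trans hN)) (amp_mem_amplify (hN hx))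
    obtain ⟨y, hy, rfl⟩ := exists_amp_eq hz
    have hdN : x - y ∈ N := sub_mem hx (hRN hy)
    obtain ⟨c, hc⟩ := VNAction.exists_isCoeff hΩ hσ (hN hdN)
    have horth : ∀ w ∈ R, ⟪amp ℕ w Ωh, amp ℕ (x - y) Ωh⟫_ℂ = 0 := fun w hw => by
      have := inner_sub_orbitProj (amp_mem_amplify (ι := ℕ) hw) Ωh (amp ℕ x Ωh)
      rw [hxz] at this
      exact this
    -- `x - y` is orthogonal to `Q ⋊ Γ`. The coefficient of `λ_g⁻¹ (x - y)` at `1` is `c g`, so `‖c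
    -- g Ω‖²` is an inner product against an element of `N`. Inserting the projection replaces `c g`
    -- by its expectation `b ∈ Q`, and moving `λ_g` to the left gives an inner product with `λ_g
    -- π(b) ∈ Q ⋊ Γ`.
    have hd0 : x - y = 0 := hc.eq_zero fun g => by
      refine hΩ.eq_zero ?_
      obtain ⟨b, hb, hcb⟩ := hE (c g)
      have h1 : ⟪ampVec P Ω (c g), ampVec P Ω (c g)⟫_ℂ =
          ⟪amp ℕ (σ.coeffOp (c g)) Ωh, amp ℕ (translationOp g⁻¹ * (x - y)) Ωh⟫_ℂ := by
        rw [amp_coeffOp_colSingle, inner_colSingle_left, colEval_amp_colSingle, ampVec_apply]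
        congr 2
        rw [← hc.entry_one]
        ext v
        simp [entry_apply]
      have h2 : e (amp ℕ (translationOp g⁻¹ * (x - y)) Ωh) =
          amp ℕ (translationOp g⁻¹ * (x - y)) Ωh :=
        Submodule.starProjection_eq_self_iff.2 (Submodule.le_topologicalClosure _
          (apply_mem_orbitSpace (amp_mem_amplify (mul_mem (hlam g⁻¹) hdN)) Ωh))
      rw [← h2, he, orbitProj, ← Submodule.inner_starProjection_left_eq_right] at h1
      change _ = ⟪e (amp ℕ (σ.coeffOp (c g)) Ωh), _⟫_ℂ at h1
      rw [hcb, amp_mul, mul_apply_eq_comp, ← star_translationOp, amp_star, inner_star_apply_right,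
        ← mul_apply_eq_comp, ← amp_mul, horth] at h1
      · exact inner_self_eq_zero.1 h1
      · exact mul_mem (σ.translationOp_mem_crossedProduct _ g)
          (σ.coeffOp_mem_crossedProduct ((hQ b).2 hb))
    rwa [sub_eq_zero.1 hd0]

end Intermediate

/-! ### `L^∞` acting on `L²` -/

section LInfty

variable {X : Type*} [MeasurableSpace X] {μ : Measure X}

theorem l2_norm_sq (ξ : Lp ℂ 2 μ) : ‖ξ‖ ^ 2 = ∫ x, ‖ξ x‖ ^ 2 ∂μ := by
  have h : ((‖ξ‖ ^ 2 : ℝ) : ℂ) = ∫ x, ((‖ξ x‖ ^ 2 : ℝ) : ℂ) ∂μ := by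
    have := inner_self_eq_norm_sq_to_K (𝕜 := ℂ) ξ
    rw [L2.inner_def] at this
    push_cast
    rw [← RCLike.ofReal_eq_complex_ofReal, ← this]
    refine integral_congr_ae (Eventually.of_forall fun x => ?_)
    exact inner_self_eq_norm_sq_to_K (𝕜 := ℂ) (ξ x)
  rw [integral_complex_ofReal] at h
  exact_mod_cast h

theorem l2_integrable_norm_sq (ξ : Lp ℂ 2 μ) : Integrable (fun x => ‖ξ x‖ ^ 2) μ :=
  (memLp_two_iff_integrable_sq_norm (Lp.aestronglyMeasurable ξ)).1 (Lp.memLp ξ)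

theorem mulOp_mem_linfty (f : Lp ℂ ∞ μ) : mulOp μ f ∈ linfty μ := subset_vnGenerated _ ⟨f, rfl⟩

variable [IsProbabilityMeasure μ]

theorem mulOp_oneL2_ae (f : Lp ℂ ∞ μ) : mulOp μ f (oneL2 μ) =ᵐ[μ] f := by
  filter_upwards [mulOp_apply_ae f (oneL2 μ), oneL2_ae μ] with x h1 h2
  rw [h1, h2, mul_one]

theorem linfty_isTraceVector : IsTraceVector (linfty μ) (oneL2 μ) where
  trace a ha b hb := by
    rw [← mul_apply_eq_comp, linfty_mul_comm ha hb]; rfl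
  separating _ ha h := eq_zero_of_apply_one ha h

theorem linfty_ext {S T : Lp ℂ 2 μ →L[ℂ] Lp ℂ 2 μ} (hS : S ∈ linfty μ) (hT : T ∈ linfty μ)
    (h : S (oneL2 μ) = T (oneL2 μ)) : S = T := by
  refine sub_eq_zero.1 (eq_zero_of_apply_one (sub_mem hS hT) ?_)
  rw [_root_.sub_apply, h, sub_self]

theorem linfty_apply_ae {T : Lp ℂ 2 μ →L[ℂ] Lp ℂ 2 μ} (hT : T ∈ linfty μ) (f : Lp ℂ ∞ μ) :
    T (mulOp μ f (oneL2 μ)) =ᵐ[μ] fun x => f x * T (oneL2 μ) x := by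
  have h := congrArg (fun S : Lp ℂ 2 μ →L[ℂ] Lp ℂ 2 μ => S (oneL2 μ))
    (linfty_mul_comm hT (mulOp_mem_linfty f))
  simp only [mul_apply_eq_comp] at h
  rw [h]
  exact mulOp_apply_ae f _

/-- Testing on indicators suffices: `∫_s |T 1|² = ‖T 1_s‖² ≤ ‖T‖² μ(s)` for every measurable `s`. -/
theorem linfty_ae_bound {T : Lp ℂ 2 μ →L[ℂ] Lp ℂ 2 μ} (hT : T ∈ linfty μ) :
    ∀ᵐ x ∂μ, ‖T (oneL2 μ) x‖ ≤ ‖T‖ := by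
  have h : (fun x => ‖T (oneL2 μ) x‖ ^ 2) ≤ᵐ[μ] fun _ => ‖T‖ ^ 2 := by
    refine ae_le_of_forall_setIntegral_le (l2_integrable_norm_sq _) (integrable_const _)
      fun s hs _ => ?_
    set f : Lp ℂ ∞ μ := indicatorConstLp ∞ hs (measure_ne_top μ s) 1 with hf
    have hfx : f =ᵐ[μ] s.indicator fun _ => 1 := indicatorConstLp_coeFn
    have e1 : ∫ x in s, ‖T (oneL2 μ) x‖ ^ 2 ∂μ = ‖T (mulOp μ f (oneL2 μ))‖ ^ 2 := by
      rw [l2_norm_sq, ← integral_indicator hs]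
      refine integral_congr_ae ?_
      filter_upwards [linfty_apply_ae hT f, hfx] with x h1 h2
      rw [h1, h2]
      by_cases hx : x ∈ s <;> simp [hx]
    have e2 : ∫ x in s, ‖T‖ ^ 2 ∂μ = ‖T‖ ^ 2 * ‖mulOp μ f (oneL2 μ)‖ ^ 2 := by
      rw [l2_norm_sq, ← integral_const_mul, ← integral_indicator hs]
      refine integral_congr_ae ?_
      filter_upwards [mulOp_oneL2_ae f, hfx] with x h1 h2
      rw [h1, h2]
      by_cases hx : x ∈ s <;> simp [hx]
    rw [e1, e2, ← mul_pow]
    gcongr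
    exact T.le_opNorm _
  filter_upwards [h] with x hx
  exact le_of_sq_le_sq hx (norm_nonneg _)

/-- `L^∞(X)` is its own double commutant. -/
theorem exists_mulOp_eq {T : Lp ℂ 2 μ →L[ℂ] Lp ℂ 2 μ} (hT : T ∈ linfty μ) :
    ∃ f : Lp ℂ ∞ μ, mulOp μ f = T ∧ f =ᵐ[μ] T (oneL2 μ) := by
  have hm : MemLp (T (oneL2 μ)) ∞ μ :=
    memLp_top_of_bound (Lp.aestronglyMeasurable _) ‖T‖ (linfty_ae_bound hT)
  refine ⟨hm.toLp _, ?_, hm.coeFn_toLp⟩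
  refine linfty_ext (mulOp_mem_linfty _) hT (Lp.ext ?_)
  exact (mulOp_oneL2_ae _).trans hm.coeFn_toLp

theorem dense_linfty_orbit : Dense (orbitSpace (linfty μ) (oneL2 μ) : Set (Lp ℂ 2 μ)) := by
  intro ξ
  change ξ ∈ (orbitSpace (linfty μ) (oneL2 μ)).topologicalClosure
  induction ξ using Lp.induction (by norm_num : (2 : ℝ≥0∞) ≠ ∞) with
  | indicatorConst c hs hμs =>
    refine Submodule.le_topologicalClosure _
      ⟨_, mulOp_mem_linfty (indicatorConstLp ∞ hs hμs.ne c), ?_⟩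
    apply Lp.ext
    refine (mulOp_oneL2_ae _).trans (indicatorConstLp_coeFn.trans ?_)
    exact (indicatorConstLp_coeFn (p := 2) (hs := hs) (hμs := hμs.ne)).symm
  | add hf hg _ h1 h2 => exact add_mem h1 h2
  | isClosed => exact isClosed_closure

end LInfty

/-! ### Cyclic vectors and `L²(P, τ)` -/

section Cyclic

variable {H : Type*} [NormedAddCommGroup H] [InnerProductSpace ℂ H] [CompleteSpace H]

/-- If `τ` is the vector state of a cyclic vector in `H`, then `H` is `L²(P, τ)`. -/
theorem TracialState.exists_isometry_of_cyclic {P : VonNeumannAlgebra H} (τ : TracialState P)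
    {Ω : H} (h : ∀ a : P, ⟪Ω, (a : H →L[ℂ] H) Ω⟫_ℂ = τ.toPositive a)
    (hd : Dense (orbitSpace P Ω : Set H)) :
    ∃ U : H →L[ℂ] τ.L2, (∀ a : P, U ((a : H →L[ℂ] H) Ω) = τ.toL2 a) ∧ (∀ ξ, ‖U ξ‖ = ‖ξ‖) ∧
      ∀ (a : P) ξ, U ((a : H →L[ℂ] H) ξ) = τ.lmul a (U ξ) := by
  let e : P →ₗ[ℂ] H :=
    { toFun := fun a => (a : H →L[ℂ] H) Ω
      map_add' := fun _ _ => rfl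
      map_smul' := fun _ _ => rfl }
  have hn : ∀ a : P, ‖τ.toL2ₗ a‖ = ‖e a‖ := fun a => by
    rw [← sq_eq_sq₀ (norm_nonneg _) (norm_nonneg _), ← inner_self_eq_norm_sq (𝕜 := ℂ),
      toL2ₗ_apply, inner_toL2, ← h, ← inner_self_eq_norm_sq (𝕜 := ℂ)]
    exact congrArg Complex.re (inner_star_apply_right (a : H →L[ℂ] H) Ω _)
  obtain ⟨U, hU, -⟩ := exists_clm_of_norm_le e τ.toL2ₗ fun a => (hn a).le
  have hU' : ∀ a : P, U ((a : H →L[ℂ] H) Ω) = τ.toL2 a := hU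
  refine ⟨U, hU', fun ξ => ?_, fun a ξ => ?_⟩
  · have hc : IsClosed {ξ | ‖U ξ‖ = ‖ξ‖} := isClosed_eq U.continuous.norm continuous_norm
    refine hc.closure_subset_iff.2 ?_ (hd ξ)
    rintro _ ⟨b, hb, rfl⟩
    exact (congrArg norm (hU' ⟨b, hb⟩)).trans (hn ⟨b, hb⟩)
  · have hc : IsClosed {ξ | U ((a : H →L[ℂ] H) ξ) = τ.lmul a (U ξ)} :=
      isClosed_eq (U.continuous.comp (a : H →L[ℂ] H).continuous)
        ((τ.lmul a).continuous.comp U.continuous)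
    refine hc.closure_subset_iff.2 ?_ (hd ξ)
    rintro _ ⟨b, hb, rfl⟩
    have h1 := hU' ⟨b, hb⟩
    have h2 := hU' (a * ⟨b, hb⟩)
    rw [← TracialState.lmul_toL2, ← h1] at h2
    exact h2

end Cyclic

/-! ### Truncation of complex numbers -/

section Clamp

/-- Truncation of the real and the imaginary part at `±R`. -/
noncomputable def clampC (R : ℝ) (z : ℂ) : ℂ := ⟨max (-R) (min R z.re), max (-R) (min R z.im)⟩

theorem abs_clamp_sub_le (R a b : ℝ) : |max (-R) (min R a) - max (-R) (min R b)| ≤ |a - b| := by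
  have h1 := abs_max_sub_max_le_max (-R) (min R a) (-R) (min R b)
  have h2 := abs_min_sub_min_le_max R a R b
  rw [sub_self, abs_zero] at h1 h2
  exact (h1.trans (max_le (abs_nonneg _) le_rfl)).trans (h2.trans (max_le (abs_nonneg _) le_rfl))

theorem lipschitzWith_clampC (R : ℝ) : LipschitzWith 1 (clampC R) := by
  refine LipschitzWith.of_dist_le_mul fun z w => ?_
  rw [NNReal.coe_one, one_mul, Complex.dist_eq_re_im, Complex.dist_eq_re_im]
  refine Real.sqrt_le_sqrt ?_
  have h1 := sq_le_sq.2 (abs_clamp_sub_le R z.re w.re)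
  have h2 := sq_le_sq.2 (abs_clamp_sub_le R z.im w.im)
  exact add_le_add h1 h2

theorem clampC_zero {R : ℝ} (hR : 0 ≤ R) : clampC R 0 = 0 := by
  apply Complex.ext <;> simp [clampC, hR]

theorem norm_clampC_le {R : ℝ} (hR : 0 ≤ R) (z : ℂ) : ‖clampC R z‖ ≤ 2 * R := by
  have h : ∀ a : ℝ, |max (-R) (min R a)| ≤ R := fun a =>
    abs_le.2 ⟨le_max_left _ _, max_le (by linarith) (min_le_left _ _)⟩
  refine (Complex.norm_le_abs_re_add_abs_im _).trans ?_
  have h1 := h z.re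
  have h2 := h z.im
  have : |(clampC R z).re| + |(clampC R z).im| ≤ R + R := add_le_add h1 h2
  linarith

theorem clampC_of_norm_le {R : ℝ} {z : ℂ} (hz : ‖z‖ ≤ R) : clampC R z = z := by
  have h1 := abs_le.1 ((Complex.abs_re_le_norm z).trans hz)
  have h2 := abs_le.1 ((Complex.abs_im_le_norm z).trans hz)
  apply Complex.ext
  · show max (-R) (min R z.re) = z.re
    rw [min_eq_right h1.2, max_eq_right h1.1]
  · show max (-R) (min R z.im) = z.im
    rw [min_eq_right h2.2, max_eq_right h2.1]

end Clamp

/-! ### Bounded relatively almost periodic functions -/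

section AlmostPeriodic

variable {Γ : Type*} [Group Γ] {X : Type*} [MeasurableSpace X] [MulAction Γ X]
  [MeasurableConstSMul Γ X] {μ : Measure X} [SMulInvariantMeasure Γ X μ]
  {Z : Type*} [MeasurableSpace Z]

/-- A `1`-Lipschitz map does not increase `|f ∘ g⁻¹ - ξ_j|` pointwise, and conditional expectation
is monotone; the functions `φ ∘ ξ_j` serve for the same `ε`. -/
theorem IsRelAlmostPeriodic.compLp {p : X → Z} {f : Lp ℂ 2 μ} (hf : IsRelAlmostPeriodic Γ μ p f)
    {φ : ℂ → ℂ} (hφ : LipschitzWith 1 φ) (h0 : φ 0 = 0) :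
    IsRelAlmostPeriodic Γ μ p (hφ.compLp h0 f) := by
  intro ε hε
  obtain ⟨n, ξ, h⟩ := hf ε hε
  refine ⟨n, fun j => hφ.compLp h0 (ξ j), fun g => ?_⟩
  have hle : ∀ j, μ[fun y => ‖(koopman Γ μ g : Lp ℂ 2 μ →L[ℂ] Lp ℂ 2 μ) (hφ.compLp h0 f) y -
        (hφ.compLp h0 (ξ j)) y‖ ^ 2 | MeasurableSpace.comap p inferInstance] ≤ᵐ[μ]
      μ[fun y => ‖(koopman Γ μ g : Lp ℂ 2 μ →L[ℂ] Lp ℂ 2 μ) f y - ξ j y‖ ^ 2 |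
        MeasurableSpace.comap p inferInstance] := fun j => by
    have hint : ∀ a b : Lp ℂ 2 μ, Integrable (fun y => ‖a y - b y‖ ^ 2) μ := fun a b =>
      (l2_integrable_norm_sq (a - b)).congr (by
        filter_upwards [Lp.coeFn_sub a b] with y hy
        rw [hy]; rfl)
    refine condExp_mono (hint _ _) (hint _ _) ?_
    filter_upwards [koopman_apply_ae Γ μ g (hφ.compLp h0 f), koopman_apply_ae Γ μ g f,
      hφ.coeFn_compLp h0 (ξ j), (measurePreserving_smul g⁻¹ μ).quasiMeasurePreserving.ae_eq_comp
        (hφ.coeFn_compLp h0 f)] with y h1 h2 h3 h4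
    have h5 : (hφ.compLp h0 f) (g⁻¹ • y) = φ (f (g⁻¹ • y)) := h4
    rw [h1, h2, h3, h5]
    gcongr
    simpa [dist_eq_norm] using hφ.dist_le_mul (f (g⁻¹ • y)) (ξ j y)
  filter_upwards [h g, ae_all_iff.2 hle] with x hx hx'
  obtain ⟨j, hj⟩ := hx
  exact ⟨j, (hx' j).trans_lt hj⟩

theorem star_koopman (g : Γ) : star (koopman Γ μ g : Lp ℂ 2 μ →L[ℂ] Lp ℂ 2 μ) =
    (koopman Γ μ g⁻¹ : Lp ℂ 2 μ →L[ℂ] Lp ℂ 2 μ) := by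
  rw [map_inv]; rfl

variable [IsProbabilityMeasure μ]

theorem koopman_oneL2 (g : Γ) : (koopman Γ μ g : Lp ℂ 2 μ →L[ℂ] Lp ℂ 2 μ) (oneL2 μ) = oneL2 μ := by
  apply Lp.ext
  filter_upwards [koopman_apply_ae Γ μ g (oneL2 μ), oneL2_ae μ,
    (measurePreserving_smul g⁻¹ μ).quasiMeasurePreserving.ae_eq_comp (oneL2_ae μ)] with x h1 h2 h3
  rw [h1, h2]
  exact h3

theorem linftyAction_apply_oneL2 (g : Γ) (T : linfty μ) :
    ((linftyAction Γ μ g T : linfty μ) : Lp ℂ 2 μ →L[ℂ] Lp ℂ 2 μ) (oneL2 μ) =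
      (koopman Γ μ g : Lp ℂ 2 μ →L[ℂ] Lp ℂ 2 μ)
        ((T : Lp ℂ 2 μ →L[ℂ] Lp ℂ 2 μ) (oneL2 μ)) := by
  rw [linftyAction, coe_adAction_apply, star_koopman, mul_apply_eq_comp, mul_apply_eq_comp,
    koopman_oneL2]

theorem linftyAction_tracePreserving : (linftyAction Γ μ).TracePreserving (integralState μ) := by
  intro g T
  change ⟪oneL2 μ, ((linftyAction Γ μ g T : linfty μ) : Lp ℂ 2 μ →L[ℂ] Lp ℂ 2 μ) (oneL2 μ)⟫_ℂ =
    ⟪oneL2 μ, (T : Lp ℂ 2 μ →L[ℂ] Lp ℂ 2 μ) (oneL2 μ)⟫_ℂ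
  rw [linftyAction_apply_oneL2, ← inner_star_apply_left, star_koopman, koopman_oneL2]

/-- The bounded relatively almost periodic functions are dense as soon as the relatively almost
periodic ones are. -/
theorem dense_bounded_almostPeriodic {p : X → Z} (h : IsCompactFactorMap Γ μ p) :
    Dense {ξ : Lp ℂ 2 μ | ∃ T ∈ linfty μ, T (oneL2 μ) = ξ ∧ IsRelAlmostPeriodic Γ μ p ξ} := by
  intro ξ
  rw [Metric.mem_closure_iff]
  intro ε hε
  obtain ⟨_, ⟨S, hS, rfl⟩, hSξ⟩ := dense_linfty_orbit.exists_dist_lt ξ (half_pos hε)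
  obtain ⟨f, hf, hfS⟩ := h.exists_dist_lt (S (oneL2 μ)) (half_pos hε)
  -- Truncation at level `‖S‖` fixes `S 1`, so truncating `f` does not increase its distance to `S
  -- 1`.
  have h0 := clampC_zero (norm_nonneg S)
  have hφ := lipschitzWith_clampC ‖S‖
  have hSc : hφ.compLp h0 (S (oneL2 μ)) = S (oneL2 μ) := by
    apply Lp.ext
    filter_upwards [hφ.coeFn_compLp h0 (S (oneL2 μ)), linfty_ae_bound hS] with x h1 h2
    rw [h1]
    exact clampC_of_norm_le h2
  have hm : MemLp (hφ.compLp h0 f) ∞ μ := by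
    refine memLp_top_of_bound (Lp.aestronglyMeasurable _) (2 * ‖S‖) ?_
    filter_upwards [hφ.coeFn_compLp h0 f] with x h1
    rw [h1]
    exact norm_clampC_le (norm_nonneg S) _
  refine ⟨hφ.compLp h0 f, ⟨mulOp μ (hm.toLp _), mulOp_mem_linfty _, ?_, hf.compLp hφ h0⟩, ?_⟩
  · exact Lp.ext ((mulOp_oneL2_ae _).trans hm.coeFn_toLp)
  · have hd := (LipschitzWith.lipschitzWith_compLp hφ h0).dist_le_mul (S (oneL2 μ)) f
    rw [hSc, NNReal.coe_one, one_mul] at hd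
    calc _ ≤ dist ξ (S (oneL2 μ)) + dist (S (oneL2 μ)) (hφ.compLp h0 f) := dist_triangle _ _ _
      _ < ε / 2 + ε / 2 := by linarith
      _ = ε := by ring

end AlmostPeriodic

/-! ### Approximation piecewise over the base -/

section CompactFactor

variable {X : Type*} {m m₀ : MeasurableSpace X} {μ : Measure X}

theorem measurableSet_condExp_lt (f : X → ℝ) (c : ℝ) : MeasurableSet[m] {x | (μ[f | m]) x < c} := by
  have h : Measurable[m] (μ[f | m]) := stronglyMeasurable_condExp.measurable
  exact h measurableSet_Iio

variable [IsProbabilityMeasure μ]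

/-- Multiplication by the indicator function of `s`. -/
noncomputable def indOp (μ : Measure X) [IsFiniteMeasure μ] {s : Set X} (hs : MeasurableSet s) :
    Lp ℂ 2 μ →L[ℂ] Lp ℂ 2 μ :=
  mulOp μ (indicatorConstLp ∞ hs (measure_ne_top μ s) 1)

theorem indOp_apply_ae {s : Set X} (hs : MeasurableSet s) (ξ : Lp ℂ 2 μ) :
    indOp μ hs ξ =ᵐ[μ] s.indicator ξ := by
  filter_upwards [mulOp_apply_ae (indicatorConstLp ∞ hs (measure_ne_top μ s) 1) ξ,
    indicatorConstLp_coeFn (p := ∞) (hs := hs) (hμs := measure_ne_top μ s) (c := (1 : ℂ))]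
    with x h1 h2
  rw [indOp, h1, h2]
  by_cases hx : x ∈ s <;> simp [hx]

theorem norm_indOp_le {s : Set X} (hs : MeasurableSet s) : ‖indOp μ hs‖ ≤ ‖mulOp μ‖ := by
  refine ((mulOp μ).le_opNorm _).trans (mul_le_of_le_one_right (norm_nonneg _) ?_)
  refine norm_indicatorConstLp_le.trans ?_
  simp

theorem norm_sub_sum_le_of_isometry {E F : Type*} [NormedAddCommGroup E] [NormedSpace ℂ E]
    [NormedAddCommGroup F] [NormedSpace ℂ F] {U : E →L[ℂ] F} (hU : ∀ ξ, ‖U ξ‖ = ‖ξ‖) {n : ℕ} {v : F}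
    {w : Fin n → F} {a : E} {b : Fin n → E} (hv : v = U a) (hw : ∀ j, w j = U (b j)) {ε : ℝ}
    (h : ‖a - ∑ j, b j‖ ≤ ε) : ‖v - ∑ j, w j‖ ≤ ε := by
  rw [hv, Finset.sum_congr rfl fun j _ => hw j, ← map_sum, ← map_sub, hU]
  exact h

/-- On `A j` the sum equals `ξ j`. Because `A j` is `m`-measurable, `∫_{A j} |F - ξ j|²` is the
integral of the conditional expectation, hence at most `ε² μ(A j)`; disjointness bounds the total by
`ε²`. -/
theorem norm_sub_sum_indOp_le (hm : m ≤ m₀) {n : ℕ} {A : Fin n → Set X}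
    (hA : ∀ j, MeasurableSet[m] (A j)) (hd : Pairwise (Function.onFun Disjoint A))
    (hcover : ∀ᵐ x ∂μ, ∃ j, x ∈ A j) (F : Lp ℂ 2 μ) (ξ : Fin n → Lp ℂ 2 μ) {ε : ℝ} (hε : 0 ≤ ε)
    (hξ : ∀ j, ∀ x ∈ A j, (μ[fun y => ‖F y - ξ j y‖ ^ 2 | m]) x ≤ ε ^ 2) :
    ‖F - ∑ j, indOp μ (hm _ (hA j)) (ξ j)‖ ≤ ε := by
  refine le_of_sq_le_sq ?_ hε
  have hint : ∀ j, Integrable (fun y => ‖F y - ξ j y‖ ^ 2) μ := fun j =>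
    (l2_integrable_norm_sq (F - ξ j)).congr (by
      filter_upwards [Lp.coeFn_sub F (ξ j)] with y hy
      rw [hy]; rfl)
  have h1 : ∀ᵐ x ∂μ, ‖(F - ∑ j, indOp μ (hm _ (hA j)) (ξ j) : Lp ℂ 2 μ) x‖ ^ 2 =
      ∑ j, (A j).indicator (fun y => ‖F y - ξ j y‖ ^ 2) x := by
    filter_upwards [Lp.coeFn_sub F (∑ j, indOp μ (hm _ (hA j)) (ξ j)),
      Lp.coeFn_finsetSum Finset.univ fun j => indOp μ (hm _ (hA j)) (ξ j),
      ae_all_iff.2 fun j => indOp_apply_ae (hm _ (hA j)) (ξ j), hcover] with x e1 e2 e3 ⟨j, hj⟩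
    have hne : ∀ i, i ≠ j → x ∉ A i := fun i hi hx => Set.disjoint_left.1 (hd hi) hx hj
    rw [e1, Pi.sub_apply, e2, Finset.sum_apply, Finset.sum_eq_single j, Finset.sum_eq_single j,
      e3 j, Set.indicator_of_mem hj, Set.indicator_of_mem hj]
    · exact fun i _ hi => Set.indicator_of_notMem (hne i hi) _
    · simp
    · exact fun i _ hi => by rw [e3 i, Set.indicator_of_notMem (hne i hi)]
    · simp
  rw [l2_norm_sq, integral_congr_ae h1, integral_finsetSum _ fun j _ =>
    (hint j).indicator (hm _ (hA j))]
  calc ∑ j, ∫ x, (A j).indicator (fun y => ‖F y - ξ j y‖ ^ 2) x ∂μ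
      = ∑ j, ∫ x in A j, (μ[fun y => ‖F y - ξ j y‖ ^ 2 | m]) x ∂μ := by
        refine Finset.sum_congr rfl fun j _ => ?_
        rw [integral_indicator (hm _ (hA j)), setIntegral_condExp hm (hint j) (hA j)]
    _ ≤ ∑ j, ε ^ 2 * μ.real (A j) := by
        refine Finset.sum_le_sum fun j _ => ?_
        calc _ ≤ ∫ x in A j, ε ^ 2 ∂μ := setIntegral_mono_on integrable_condExp.integrableOn
              (integrable_const _) (hm _ (hA j)) (hξ j)
          _ = _ := by rw [setIntegral_const, smul_eq_mul, mul_comm]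
    _ ≤ ε ^ 2 := by
        rw [← Finset.mul_sum]
        refine mul_le_of_le_one_right (sq_nonneg _) ?_
        refine (sum_measureReal_le_measureReal_univ (fun j _ => hm _ (hA j))
          fun i _ j _ hij => hd hij).trans ?_
        simp

end CompactFactor

/-! ### From compact factor maps to compact extensions of algebras -/

section CompactExtension

variable {Γ : Type*} [Group Γ] {X : Type*} [MeasurableSpace X] [MulAction Γ X]
  [MeasurableConstSMul Γ X] {μ : Measure X} [SMulInvariantMeasure Γ X μ] [IsProbabilityMeasure μ]
  {Z : Type*} [MeasurableSpace Z] {ν : Measure Z} [IsProbabilityMeasure ν]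

theorem indOp_mem_linftyOfFactor {p : X → Z} (hp : MeasurePreserving p μ ν) {s : Set X}
    (hs : MeasurableSet[MeasurableSpace.comap p inferInstance] s) :
    indOp μ (hp.measurable.comap_le _ hs) ∈ linftyOfFactor p hp := by
  obtain ⟨t, ht, rfl⟩ := hs
  exact subset_vnGenerated _ ⟨indicatorConstLp ∞ ht (measure_ne_top ν t) 1, rfl⟩

/-- A compact extension of measure preserving actions is a compact extension of algebras. -/
theorem IsCompactFactorMap.isCompactExtension {p : X → Z} (hp : MeasurePreserving p μ ν)
    (h : IsCompactFactorMap Γ μ p) :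
    (linftyAction Γ μ).IsCompactExtension (integralState μ) (linftyOfFactor p hp) := by
  obtain ⟨U, hU, hUn, hUl⟩ := (integralState μ).exists_isometry_of_cyclic (Ω := oneL2 μ)
    (fun _ => rfl) dense_linfty_orbit
  refine ⟨{T | IsRelAlmostPeriodic Γ μ p ((T : Lp ℂ 2 μ →L[ℂ] Lp ℂ 2 μ) (oneL2 μ))}, ?_, ?_⟩
  · have hUd : DenseRange U := by
      refine (integralState μ).denseRange_toL2.mono ?_
      rintro _ ⟨T, rfl⟩
      exact ⟨_, hU T⟩
    have hd := hUd.dense_image U.continuous (dense_bounded_almostPeriodic h)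
    refine (hd.mono ?_).closure_eq
    rintro _ ⟨_, ⟨T, hT, rfl, hap⟩, rfl⟩
    exact Submodule.subset_span ⟨⟨T, hT⟩, hap, (hU ⟨T, hT⟩).symm⟩
  · intro T hT ε hε
    obtain ⟨n, ξ, hξ⟩ := hT ε hε
    have hm := hp.measurable.comap_le
    let F : Γ → Lp ℂ 2 μ := fun g => (koopman Γ μ g : Lp ℂ 2 μ →L[ℂ] Lp ℂ 2 μ)
      ((T : Lp ℂ 2 μ →L[ℂ] Lp ℂ 2 μ) (oneL2 μ))
    -- `D g j` is the part of the base over which `ξ j` is close to the translate by `g`. After the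
    -- sets are made disjoint, their indicators are the coefficients `κ_j(g)`; they belong to `L^∞`
    -- of the base since conditional expectations are measurable over it.
    let D : Γ → Fin n → Set X := fun g j =>
      {x | (μ[fun y => ‖F g y - ξ j y‖ ^ 2 | MeasurableSpace.comap p inferInstance]) x < ε ^ 2}
    have hD : ∀ g j, MeasurableSet[MeasurableSpace.comap p inferInstance] (D g j) := fun g j =>
      measurableSet_condExp_lt _ _
    have hA : ∀ g j, MeasurableSet[MeasurableSpace.comap p inferInstance] (disjointed (D g) j) :=
      fun g j => disjointedRec (fun _ _ ht => MeasurableSet.diff ht (hD g _)) (hD g j)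
    have hK : ∀ g j, indOp μ (hm _ (hA g j)) ∈ linftyOfFactor p hp := fun g j =>
      indOp_mem_linftyOfFactor hp (hA g j)
    refine ⟨n, fun j => U (ξ j),
      fun j g => ⟨indOp μ (hm _ (hA g j)), linftyOfFactor_le p hp (hK g j)⟩,
      fun j g => hK g j, ⟨‖mulOp μ‖, fun j g => norm_indOp_le _⟩, fun g => ?_⟩
    have h1 := norm_sub_sum_indOp_le hm (hA g) (disjoint_disjointed (D g)) (by
      filter_upwards [hξ g] with x ⟨j, hj⟩
      have : x ∈ ⋃ i, disjointed (D g) i := by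
        rw [iUnion_disjointed]
        exact Set.mem_iUnion.2 ⟨j, hj⟩
      exact Set.mem_iUnion.1 this) (F g) ξ hε.le fun j x hx => (disjointed_subset (D g) j hx).le
    have e0 : (integralState μ).toL2 (linftyAction Γ μ g T) = U (F g) := by
      rw [← hU, linftyAction_apply_oneL2]
    have e1 : ∀ j, (integralState μ).lmul
        ⟨indOp μ (hm _ (hA g j)), linftyOfFactor_le p hp (hK g j)⟩ (U (ξ j)) =
          U (indOp μ (hm _ (hA g j)) (ξ j)) := fun j => (hUl ⟨_, _⟩ (ξ j)).symm
    exact norm_sub_sum_le_of_isometry hUn e0 e1 h1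

end CompactExtension

/-! ### The `σ`-algebra of an intermediate algebra -/

section FactorAlgebra

variable {X : Type*} [MeasurableSpace X] {μ : Measure X} [IsProbabilityMeasure μ]
  {Q : VonNeumannAlgebra (Lp ℂ 2 μ)}

/-- Multiplication by the function `f` belongs to `Q`. -/
def VonNeumannAlgebra.MemFun (Q : VonNeumannAlgebra (Lp ℂ 2 μ)) (f : X → ℂ) : Prop :=
  ∃ T ∈ Q, T (oneL2 μ) =ᵐ[μ] f

namespace VonNeumannAlgebra

theorem MemFun.congr {f g : X → ℂ} (hf : Q.MemFun f) (h : f =ᵐ[μ] g) : Q.MemFun g := by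
  obtain ⟨T, hT, hTf⟩ := hf
  exact ⟨T, hT, hTf.trans h⟩

theorem memFun_const (c : ℂ) : Q.MemFun fun _ => c := by
  refine ⟨c • 1, SMulMemClass.smul_mem c (one_mem Q), ?_⟩
  rw [_root_.smul_apply, one_apply_eq_self]
  filter_upwards [Lp.coeFn_smul c (oneL2 μ), oneL2_ae μ] with x h1 h2
  rw [h1, Pi.smul_apply, h2, smul_eq_mul, mul_one]

theorem MemFun.add {f g : X → ℂ} (hf : Q.MemFun f) (hg : Q.MemFun g) :
    Q.MemFun fun x => f x + g x := by
  obtain ⟨S, hS, hSf⟩ := hf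
  obtain ⟨T, hT, hTg⟩ := hg
  refine ⟨S + T, add_mem hS hT, ?_⟩
  rw [_root_.add_apply]
  filter_upwards [Lp.coeFn_add (S (oneL2 μ)) (T (oneL2 μ)), hSf, hTg] with x h1 h2 h3
  rw [h1, Pi.add_apply, h2, h3]

theorem MemFun.mul (hQ : Q ≤ linfty μ) {f g : X → ℂ} (hf : Q.MemFun f) (hg : Q.MemFun g) :
    Q.MemFun fun x => f x * g x := by
  obtain ⟨S, hS, hSf⟩ := hf
  obtain ⟨T, hT, hTg⟩ := hg
  refine ⟨T * S, mul_mem hT hS, ?_⟩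
  obtain ⟨a, ha, ha'⟩ := exists_mulOp_eq (hQ hS)
  have h := linfty_apply_ae (hQ hT) a
  rw [ha] at h
  rw [mul_apply_eq_comp]
  filter_upwards [h, ha', hSf, hTg] with x h1 h2 h3 h4
  rw [h1, h2, h3, h4]

theorem MemFun.const_mul (hQ : Q ≤ linfty μ) {f : X → ℂ} (c : ℂ) (hf : Q.MemFun f) :
    Q.MemFun fun x => c * f x :=
  (memFun_const c).mul hQ hf

theorem MemFun.sub (hQ : Q ≤ linfty μ) {f g : X → ℂ} (hf : Q.MemFun f) (hg : Q.MemFun g) :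
    Q.MemFun fun x => f x - g x := by
  simpa [sub_eq_add_neg] using hf.add (hg.const_mul hQ (-1))

theorem MemFun.conj (hQ : Q ≤ linfty μ) {f : X → ℂ} (hf : Q.MemFun f) :
    Q.MemFun fun x => star (f x) := by
  obtain ⟨T, hT, hTf⟩ := hf
  obtain ⟨a, ha, ha'⟩ := exists_mulOp_eq (hQ hT)
  refine ⟨_, star_mem hT, ?_⟩
  rw [← ha, star_mulOp]
  filter_upwards [mulOp_oneL2_ae (star a), Lp.coeFn_star a, ha', hTf] with x h1 h2 h3 h4
  rw [h1, h2, Pi.star_apply, h3, h4]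

theorem MemFun.exists_bound (hQ : Q ≤ linfty μ) {f : X → ℂ} (hf : Q.MemFun f) :
    ∃ C, ∀ᵐ x ∂μ, ‖f x‖ ≤ C := by
  obtain ⟨T, hT, hTf⟩ := hf
  refine ⟨‖T‖, ?_⟩
  filter_upwards [linfty_ae_bound (hQ hT), hTf] with x h1 h2
  rwa [← h2]

theorem MemFun.exists_eq {T : Lp ℂ 2 μ →L[ℂ] Lp ℂ 2 μ} (hQ : Q ≤ linfty μ) (hT : T ∈ linfty μ)
    (h : Q.MemFun (T (oneL2 μ))) : T ∈ Q := by
  obtain ⟨S, hS, hST⟩ := h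
  rwa [← linfty_ext (hQ hS) hT (Lp.ext hST)]

/-- Dominated convergence turns bounded pointwise convergence into convergence in `L²`, and a
multiplication operator whose value at `1` lies in the closure of `Q 1` lies in `Q`. -/
theorem memFun_of_tendsto (hQ : Q ≤ linfty μ) {F : ℕ → X → ℂ} {f : X → ℂ} {C : ℝ}
    (hF : ∀ n, Q.MemFun (F n)) (hC : ∀ n, ∀ᵐ x ∂μ, ‖F n x‖ ≤ C)
    (h : ∀ᵐ x ∂μ, Tendsto (fun n => F n x) atTop (nhds (f x))) : Q.MemFun f := by
  choose T hT hTF using hF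
  have hfm : AEStronglyMeasurable f μ :=
    aestronglyMeasurable_of_tendsto_ae atTop
      (fun n => (Lp.aestronglyMeasurable _).congr (hTF n)) h
  have hfC : ∀ᵐ x ∂μ, ‖f x‖ ≤ C := by
    filter_upwards [h, ae_all_iff.2 hC] with x hx hx'
    exact le_of_tendsto hx.norm (Eventually.of_forall hx')
  have hm : MemLp f ∞ μ := memLp_top_of_bound hfm C hfC
  have hS : mulOp μ (hm.toLp f) (oneL2 μ) =ᵐ[μ] f := (mulOp_oneL2_ae _).trans hm.coeFn_toLp
  refine ⟨_, linfty_isTraceVector.mem_of_mem_closure hQ (mulOp_mem_linfty (hm.toLp f)) ?_, hS⟩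
  refine mem_closure_of_tendsto (f := fun n => T n (oneL2 μ)) (b := atTop) ?_
    (Eventually.of_forall fun n => apply_mem_orbitSpace (hT n) _)
  rw [tendsto_iff_norm_sub_tendsto_zero]
  have hsq : Tendsto (fun n => ‖T n (oneL2 μ) - mulOp μ (hm.toLp f) (oneL2 μ)‖ ^ 2) atTop
      (nhds 0) := by
    have hae : ∀ n, (fun x => ‖(T n (oneL2 μ) - mulOp μ (hm.toLp f) (oneL2 μ) : Lp ℂ 2 μ) x‖ ^ 2)
        =ᵐ[μ] fun x => ‖F n x - f x‖ ^ 2 := fun n => by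
      filter_upwards [Lp.coeFn_sub (T n (oneL2 μ)) (mulOp μ (hm.toLp f) (oneL2 μ)), hTF n, hS]
        with x h1 h2 h3
      rw [h1, Pi.sub_apply, h2, h3]
    simp_rw [l2_norm_sq, fun n => integral_congr_ae (hae n)]
    have := tendsto_integral_of_dominated_convergence (F := fun n x => ‖F n x - f x‖ ^ 2)
      (f := fun _ : X => (0 : ℝ)) (μ := μ) (fun _ => (C + C) ^ 2)
      (fun n => ((l2_integrable_norm_sq _).congr (hae n)).aestronglyMeasurable)
      (integrable_const _) (fun n => ?_) ?_
    · simpa using this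
    · filter_upwards [hC n, hfC] with x h1 h2
      rw [Real.norm_of_nonneg (by positivity)]
      gcongr
      exact (norm_sub_le _ _).trans (add_le_add h1 h2)
    · filter_upwards [h] with x hx
      have := ((hx.sub_const (f x)).norm).pow 2
      simpa using this
  have := hsq.sqrt
  simpa using this

theorem MemFun.aeval (hQ : Q ≤ linfty μ) {g : X → ℝ} (hg : Q.MemFun fun x => (g x : ℂ))
    (q : Polynomial ℝ) : Q.MemFun fun x => ((q.eval (g x) : ℝ) : ℂ) := by
  induction q using Polynomial.induction_on' with
  | add a b ha hb => simpa using ha.add hb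
  | monomial n c =>
    simp only [Polynomial.eval_monomial]
    induction n with
    | zero => simpa using memFun_const (Q := Q) (c : ℂ)
    | succ n ih => simpa [pow_succ, mul_assoc] using ih.mul hQ hg

/-- Weierstrass approximation of `φ` on an interval containing the essential range of `g`. -/
theorem MemFun.comp_continuous (hQ : Q ≤ linfty μ) {g : X → ℝ}
    (hg : Q.MemFun fun x => (g x : ℂ)) {φ : ℝ → ℝ} (hφ : Continuous φ) :
    Q.MemFun fun x => (φ (g x) : ℂ) := by
  obtain ⟨C, hC⟩ := hg.exists_bound hQ
  have hq : ∀ n : ℕ, ∃ q : Polynomial ℝ, ∀ t ∈ Set.Icc (-C) C,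
      |q.eval t - φ t| < 1 / ((n : ℝ) + 1) :=
    fun n => exists_polynomial_near_of_continuousOn (-C) C φ hφ.continuousOn _
      Nat.one_div_pos_of_nat
  choose q hq using hq
  obtain ⟨D, hD⟩ := isCompact_Icc.exists_bound_of_continuousOn
    (hφ.continuousOn (s := Set.Icc (-C) C))
  have hIcc : ∀ᵐ x ∂μ, g x ∈ Set.Icc (-C) C := by
    filter_upwards [hC] with x hx
    rw [Complex.norm_real] at hx
    exact abs_le.1 hx
  refine memFun_of_tendsto hQ (C := D + 1) (fun n => hg.aeval hQ (q n)) (fun n => ?_) ?_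
  · filter_upwards [hIcc] with x hx
    rw [Complex.norm_real]
    have h1 := (hq n _ hx).le.trans (Nat.one_div_le_one_div (α := ℝ) (Nat.zero_le n))
    have h2 := hD _ hx
    have h3 := norm_sub_norm_le ((q n).eval (g x)) (φ (g x))
    rw [Real.norm_eq_abs (_ - _)] at h3
    simp at h1
    linarith
  · filter_upwards [hIcc] with x hx
    refine (Complex.continuous_ofReal.tendsto _).comp ?_
    rw [tendsto_iff_norm_sub_tendsto_zero]
    exact squeeze_zero (fun _ => norm_nonneg _) (fun n => (hq n _ hx).le)
      tendsto_one_div_add_atTop_nhds_zero_nat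

/-- Membership of an indicator function. -/
theorem MemFun.indicator_lt (hQ : Q ≤ linfty μ) {g : X → ℝ} (hg : Q.MemFun fun x => (g x : ℂ))
    (c : ℝ) : Q.MemFun ({x | g x < c}.indicator fun _ => 1) := by
  -- The indicator of `t < c` is the increasing limit of the continuous functions `min 1 (n (c -
  -- t)⁺)`.
  have hlim : ∀ t : ℝ, Tendsto (fun n : ℕ => ((min 1 (n * max 0 (c - t)) : ℝ) : ℂ)) atTop
      (nhds ((Set.Iio c).indicator (fun _ => 1) t)) := fun t => by
    by_cases ht : t < c
    · rw [Set.indicator_of_mem (show t ∈ Set.Iio c from ht)]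
      refine tendsto_const_nhds.congr' ?_
      obtain ⟨N, hN⟩ := exists_nat_gt (1 / (c - t))
      filter_upwards [eventually_ge_atTop N] with n hn
      have h0 : 0 < c - t := sub_pos.2 ht
      have h1 : 1 ≤ n * max 0 (c - t) := by
        rw [max_eq_right h0.le]
        rw [div_lt_iff₀ h0] at hN
        have : (N : ℝ) ≤ n := Nat.cast_le.2 hn
        nlinarith
      rw [min_eq_left h1, Complex.ofReal_one]
    · rw [Set.indicator_of_notMem (show t ∉ Set.Iio c from ht)]
      have : max 0 (c - t) = 0 := max_eq_left (by linarith)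
      simp [this]
  refine memFun_of_tendsto hQ (C := 1) (F := fun n x => ((min 1 (n * max 0 (c - g x)) : ℝ) : ℂ))
    (fun n => hg.comp_continuous hQ (φ := fun t => min 1 (n * max 0 (c - t))) (by fun_prop))
    (fun n => Eventually.of_forall fun x => ?_) (Eventually.of_forall fun x => hlim (g x))
  rw [Complex.norm_real, Real.norm_of_nonneg (by positivity)]
  exact min_le_left _ _

/-- The measurable sets whose indicator function belongs to `Q`. -/
@[reducible]
def factorAlgebra (hQ : Q ≤ linfty μ) : MeasurableSpace X where
  MeasurableSet' s := MeasurableSet s ∧ Q.MemFun (s.indicator fun _ => 1)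
  measurableSet_empty := ⟨.empty, by simpa using memFun_const (Q := Q) 0⟩
  measurableSet_compl s hs := by
    refine ⟨hs.1.compl, ((memFun_const 1).sub hQ hs.2).congr (Eventually.of_forall fun x => ?_)⟩
    by_cases hx : x ∈ s <;> simp [hx]
  measurableSet_iUnion s hs := by
    refine ⟨.iUnion fun n => (hs n).1, ?_⟩
    -- Finite unions come from `1_{A ∪ B} = 1_A + 1_B - 1_A 1_B`; the countable union is their
    -- bounded pointwise limit.
    have hacc : ∀ n, Q.MemFun ((Set.accumulate s n).indicator fun _ => 1) := fun n => by
      induction n with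
      | zero => simpa using (hs 0).2
      | succ n ih =>
        refine ((ih.add (hs (n + 1)).2).sub hQ (ih.mul hQ (hs (n + 1)).2)).congr
          (Eventually.of_forall fun x => ?_)
        rw [Set.accumulate_succ]
        by_cases h1 : x ∈ Set.accumulate s n <;> by_cases h2 : x ∈ s (n + 1) <;> simp [h1, h2]
    refine memFun_of_tendsto hQ (C := 1) hacc (fun n => Eventually.of_forall fun x => ?_)
      (Eventually.of_forall fun x => ?_)
    · by_cases hx : x ∈ Set.accumulate s n <;> simp [hx]
    · rw [← Set.iUnion_accumulate]
      exact (Set.monotone_accumulate.tendsto_indicator _ _ x).mono_right (pure_le_nhds _)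

theorem factorAlgebra_le (hQ : Q ≤ linfty μ) : factorAlgebra hQ ≤ ‹MeasurableSpace X› :=
  fun _ hs => hs.1

theorem measurableSet_factorAlgebra_of_null (hQ : Q ≤ linfty μ) {s : Set X} (hs : MeasurableSet s)
    (h : μ s = 0) : MeasurableSet[factorAlgebra hQ] s := by
  refine ⟨hs, (memFun_const 0).congr ?_⟩
  filter_upwards [measure_eq_zero_iff_ae_notMem.1 h] with x hx
  simp [hx]

/-- Real and imaginary parts are in `Q` by stability under conjugation, and the sets `{g < c}` are
in the `σ`-algebra by `MemFun.indicator_lt`. -/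
theorem MemFun.measurable (hQ : Q ≤ linfty μ) {f : X → ℂ} (hf : Q.MemFun f) (hm : Measurable f) :
    Measurable[factorAlgebra hQ] f := by
  have key : ∀ g : X → ℝ, Measurable g → Q.MemFun (fun x => (g x : ℂ)) →
      Measurable[factorAlgebra hQ] g := fun g hg hgQ => by
    have h : ∀ c, MeasurableSet[factorAlgebra hQ] (g ⁻¹' Set.Iio c) := fun c =>
      ⟨hg measurableSet_Iio, hgQ.indicator_lt hQ c⟩
    exact measurable_of_Iio (mδ := factorAlgebra hQ) h
  have hre := key (fun x => (f x).re) (Complex.measurable_re.comp hm)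
    (((hf.add (hf.conj hQ)).const_mul hQ (1 / 2)).congr (Eventually.of_forall fun x => by
      apply Complex.ext <;> simp; ring))
  have him := key (fun x => (f x).im) (Complex.measurable_im.comp hm)
    (((hf.sub hQ (hf.conj hQ)).const_mul hQ (-Complex.I / 2)).congr (Eventually.of_forall fun x => by
      apply Complex.ext <;> simp; ring))
  exact Complex.measurableEquivRealProd.symm.measurable.comp (hre.prodMk him)

variable {Z : Type*} [mZ : MeasurableSpace Z] {ν : Measure Z} {p : X → Z}

/-- Bounded functions measurable with respect to `factorAlgebra` belong to `Q`. -/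
theorem memFun_of_measurable (hQ : Q ≤ linfty μ) (hp : ∀ s, MeasurableSet s → Q.MemFun
    ((p ⁻¹' s).indicator fun _ => 1)) {f : Z → ℂ} (hf : StronglyMeasurable f) {C : ℝ} (hC0 : 0 ≤ C)
    (hC : ∀ᵐ x ∂μ, ‖f (p x)‖ ≤ C) : Q.MemFun fun x => f (p x) := by
  have hs : ∀ φ : SimpleFunc Z ℂ, Q.MemFun fun x => φ (p x) := fun φ => by
    induction φ using SimpleFunc.induction with
    | const c hs =>
      rename_i s
      refine ((hp s hs).const_mul hQ c).congr (Eventually.of_forall fun x => ?_)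
      by_cases hx : p x ∈ s <;> simp [hx]
    | add _ h1 h2 => exact h1.add h2
  refine memFun_of_tendsto hQ (C := C) (fun n => hs (hf.approxBounded C n))
    (fun n => Eventually.of_forall fun x => hf.norm_approxBounded_le hC0 n _) ?_
  filter_upwards [hC] with x hx
  exact hf.tendsto_approxBounded_of_norm_le hx

theorem linftyOfFactor_le_of_memFun (hQ : Q ≤ linfty μ) (hp : MeasurePreserving p μ ν)
    (h : ∀ s, MeasurableSet s → Q.MemFun ((p ⁻¹' s).indicator fun _ => 1)) :
    linftyOfFactor p hp ≤ Q := by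
  refine vnGenerated_le ?_
  rintro _ ⟨f, rfl⟩
  refine MemFun.exists_eq hQ (mulOp_mem_linfty _) ?_
  have hf := (mulOp_oneL2_ae _).trans (Lp.coeFn_compMeasurePreserving f hp)
  refine (memFun_of_measurable hQ h (Lp.stronglyMeasurable f)
    (norm_nonneg (mulOp μ (Lp.compMeasurePreserving p hp f))) ?_).congr hf.symm
  filter_upwards [linfty_ae_bound (mulOp_mem_linfty (Lp.compMeasurePreserving p hp f)), hf]
    with x h1 h2
  rw [h2] at h1
  exact h1

theorem mem_linftyOfFactor (hp : MeasurePreserving p μ ν) {T : Lp ℂ 2 μ →L[ℂ] Lp ℂ 2 μ}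
    (hT : T ∈ linfty μ) {f : Z → ℂ} (hf : Measurable f) (h : T (oneL2 μ) =ᵐ[μ] f ∘ p) :
    T ∈ linftyOfFactor p hp := by
  have hb : ∀ᵐ z ∂ν, ‖f z‖ ≤ ‖T‖ := by
    rw [← hp.map_eq, ae_map_iff hp.aemeasurable (measurableSet_le hf.norm measurable_const)]
    filter_upwards [linfty_ae_bound hT, h] with x h1 h2
    rw [h2] at h1
    exact h1
  have hm : MemLp f ∞ ν := memLp_top_of_bound hf.aestronglyMeasurable _ hb
  have hT' : T = mulOp μ (Lp.compMeasurePreserving p hp (hm.toLp f)) := by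
    refine linfty_ext hT (mulOp_mem_linfty _) (Lp.ext (h.trans ?_))
    exact ((mulOp_oneL2_ae _).trans ((Lp.coeFn_compMeasurePreserving _ hp).trans
      (hp.quasiMeasurePreserving.ae_eq_comp hm.coeFn_toLp))).symm
  rw [hT']
  exact subset_vnGenerated _ ⟨_, rfl⟩

theorem memFun_indicator_preimage (hp : MeasurePreserving p μ ν) [IsProbabilityMeasure ν]
    (hQ : linftyOfFactor p hp ≤ Q) {s : Set Z} (hs : MeasurableSet s) :
    Q.MemFun ((p ⁻¹' s).indicator fun _ => 1) := by
  refine ⟨mulOp μ (Lp.compMeasurePreserving p hp (indicatorConstLp ∞ hs (measure_ne_top ν s) 1)),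
    hQ (subset_vnGenerated _ ⟨_, rfl⟩), ?_⟩
  refine (mulOp_oneL2_ae _).trans ((Lp.coeFn_compMeasurePreserving _ hp).trans ?_)
  refine (hp.quasiMeasurePreserving.ae_eq_comp indicatorConstLp_coeFn).trans ?_
  exact Eventually.of_forall fun x => rfl

theorem MemFun.smul {Γ : Type*} [Group Γ] [MulAction Γ X] [MeasurableConstSMul Γ X]
    [SMulInvariantMeasure Γ X μ] (hQ : Q ≤ linfty μ) (hinv : (linftyAction Γ μ).Invariant Q)
    {f : X → ℂ} (hf : Q.MemFun f) (g : Γ) : Q.MemFun fun x => f (g⁻¹ • x) := by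
  obtain ⟨T, hT, hTf⟩ := hf
  refine ⟨_, hinv g ⟨T, hQ hT⟩ hT, ?_⟩
  rw [linftyAction_apply_oneL2]
  exact (koopman_apply_ae Γ μ g _).trans
    ((measurePreserving_smul g⁻¹ μ).quasiMeasurePreserving.ae_eq_comp hTf)

end VonNeumannAlgebra

end FactorAlgebra

/-! ### Spaces realising an intermediate algebra -/

section Models

theorem smulInvariantMeasure_map {Γ X Z : Type*} [Group Γ] [MeasurableSpace X] [MulAction Γ X]
    {μ : Measure X} [SMulInvariantMeasure Γ X μ] [MeasurableSpace Z] [MulAction Γ Z]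
    [MeasurableConstSMul Γ Z] {p₁ : X → Z} (h₁ : Measurable p₁)
    (heq : ∀ g : Γ, ∀ᵐ x ∂μ, p₁ (g • x) = g • p₁ x) : SMulInvariantMeasure Γ Z (μ.map p₁) := by
  refine ⟨fun g s hs => ?_⟩
  rw [Measure.map_apply h₁ (hs.preimage (measurable_const_smul g)), Measure.map_apply h₁ hs,
    ← measure_preimage_smul μ g (p₁ ⁻¹' s)]
  refine measure_congr ?_
  filter_upwards [heq g] with x hx
  exact congrArg (· ∈ s) hx.symm

variable {Γ : Type w} [Group Γ] {X : Type u} [MeasurableSpace X] [MulAction Γ X]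
  {μ : Measure X} [IsProbabilityMeasure μ] [SMulInvariantMeasure Γ X μ]
  {X₀ : Type v} [MeasurableSpace X₀] [MulAction Γ X₀]
  {μ₀ : Measure X₀} {p : X → X₀} {Q : VonNeumannAlgebra (Lp ℂ 2 μ)}

/-- A measurable space with a `Γ`-action and a map from `X` to it over `X₀` gives an intermediate
extension, with the image measure. -/
theorem exists_factor_of_map (hp : IsFactorMap Γ p μ μ₀) {Z : Type*} [MeasurableSpace Z]
    [MulAction Γ Z] [MeasurableConstSMul Γ Z] {p₁ : X → Z} {p₂ : Z → X₀} (hm : Measurable p₁)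
    (heq : ∀ g : Γ, ∀ᵐ x ∂μ, p₁ (g • x) = g • p₁ x) (hm₂ : Measurable p₂) (hcomp : p₂ ∘ p₁ = p)
    (heq₂ : ∀ g : Γ, ∀ᵐ z ∂(μ.map p₁), p₂ (g • z) = g • p₂ z)
    (hQ : Q = linftyOfFactor p₁ (hm.measurePreserving μ)) :
    ∃ (ν : Measure Z) (_ : IsProbabilityMeasure ν) (_ : SMulInvariantMeasure Γ Z ν)
      (p₁ : X → Z) (p₂ : Z → X₀) (h₁ : IsFactorMap Γ p₁ μ ν),
      IsFactorMap Γ p₂ ν μ₀ ∧ p₂ ∘ p₁ = p ∧ Q = linftyOfFactor p₁ h₁.measurePreserving := by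
  refine ⟨μ.map p₁, Measure.isProbabilityMeasure_map hm.aemeasurable,
    smulInvariantMeasure_map hm heq, p₁, p₂, ⟨hm.measurePreserving μ, heq⟩, ⟨⟨hm₂, ?_⟩, heq₂⟩,
    hcomp, hQ⟩
  rw [Measure.map_map hm₂ hm, hcomp, hp.measurePreserving.map_eq]

/-- The set `X` with a given `σ`-algebra. -/
def CoarseSpace (X : Type*) (_ : MeasurableSpace X) : Type _ := X

instance (m : MeasurableSpace X) : MeasurableSpace (CoarseSpace X m) := m

instance (m : MeasurableSpace X) : MulAction Γ (CoarseSpace X m) := inferInstanceAs (MulAction Γ X)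

variable [MeasurableConstSMul Γ X]

/-- An intermediate algebra is `L^∞` of the `σ`-algebra of the sets whose indicator functions it
contains. -/
theorem exists_coarse_factor [IsProbabilityMeasure μ₀] (hp : IsFactorMap Γ p μ μ₀)
    (hQ₀ : linftyOfFactor p hp.measurePreserving ≤ Q) (hQ : Q ≤ linfty μ)
    (hinv : (linftyAction Γ μ).Invariant Q) :
    ∃ (Z : Type u) (_ : MeasurableSpace Z) (_ : MulAction Γ Z) (_ : MeasurableConstSMul Γ Z)
      (ν : Measure Z) (_ : IsProbabilityMeasure ν) (_ : SMulInvariantMeasure Γ Z ν)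
      (p₁ : X → Z) (p₂ : Z → X₀) (h₁ : IsFactorMap Γ p₁ μ ν),
      IsFactorMap Γ p₂ ν μ₀ ∧ p₂ ∘ p₁ = p ∧ Q = linftyOfFactor p₁ h₁.measurePreserving := by
  let p₁ : X → CoarseSpace X (VonNeumannAlgebra.factorAlgebra hQ) := id
  have hm : Measurable p₁ := fun s hs => hs.1
  have hm₂ : Measurable (fun z : CoarseSpace X (VonNeumannAlgebra.factorAlgebra hQ) => p z) := fun s hs =>
    ⟨hp.measurePreserving.measurable hs,
      VonNeumannAlgebra.memFun_indicator_preimage hp.measurePreserving hQ₀ hs⟩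
  have hs : MeasurableConstSMul Γ (CoarseSpace X (VonNeumannAlgebra.factorAlgebra hQ)) := ⟨fun g s hs => by
    have h := hs.2.smul hQ hinv g⁻¹
    rw [inv_inv] at h
    exact ⟨(measurable_const_smul g (M := Γ) (α := X)) hs.1, h⟩⟩
  refine ⟨CoarseSpace X (VonNeumannAlgebra.factorAlgebra hQ), inferInstance, inferInstance, hs,
    exists_factor_of_map hp hm (fun g => Eventually.of_forall fun x => rfl) hm₂ rfl
      (fun g => ?_) ?_⟩
  -- Equivariance must hold almost everywhere for the measure on the coarser `σ`-algebra. The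
  -- exceptional set need not be measurable, but its measurable hull is null, and the coarse
  -- `σ`-algebra contains all measurable null sets.
  · have h0 : μ (toMeasurable μ {x | p (g • x) ≠ g • p x}) = 0 := by
      rw [measure_toMeasurable]
      exact hp.equivariant g
    refine measure_mono_null (subset_toMeasurable μ {x | p (g • x) ≠ g • p x}) ?_
    rwa [Measure.map_apply hm (VonNeumannAlgebra.measurableSet_factorAlgebra_of_null hQ
      (measurableSet_toMeasurable _ _) h0)]
  · refine le_antisymm (fun T hT => ?_) ?_
    · exact VonNeumannAlgebra.mem_linftyOfFactor _ (hQ hT)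
        (VonNeumannAlgebra.MemFun.measurable hQ ⟨T, hT, ae_eq_refl _⟩
          (Lp.stronglyMeasurable _).measurable) (ae_eq_refl _)
    · exact VonNeumannAlgebra.linftyOfFactor_le_of_memFun hQ _ fun s hs => hs.2

/-- Every standard Borel space is isomorphic to one in any given universe. -/
theorem exists_measurableEquiv_standardBorel (Z : Type v) [MeasurableSpace Z]
    [StandardBorelSpace Z] : ∃ (Y : Type u) (_ : MeasurableSpace Y) (_ : StandardBorelSpace Y),
      Nonempty (Y ≃ᵐ Z) := by
  obtain ⟨φ, hφ⟩ := exists_measurableEmbedding_real Z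
  have : PolishSpace (ULift.{u} ℝ) := Homeomorph.ulift.isClosedEmbedding.polishSpace
  have hψ : MeasurableEmbedding fun z => ULift.up.{u} (φ z) :=
    MeasurableEquiv.ulift.symm.measurableEmbedding.comp hφ
  exact ⟨Set.range fun z => ULift.up.{u} (φ z), inferInstance, hψ.measurableSet_range.standardBorel,
    ⟨hψ.equivRange.symm⟩⟩

/-- The model is `X₀ × (Γ → ℕ → ℂ)`, with the given action times the shift: `x` goes to `p x`
together with all values `f_n(h⁻¹ x)`, where the `f_n` are dense in `Q 1`. It is standard because
`Γ` is countable, and the projection to `X₀` is equivariant everywhere. -/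
theorem exists_standard_factor [IsProbabilityMeasure μ₀] [MeasurableConstSMul Γ X₀] [Countable Γ]
    [StandardBorelSpace X] [StandardBorelSpace X₀] (hp : IsFactorMap Γ p μ μ₀)
    (hQ₀ : linftyOfFactor p hp.measurePreserving ≤ Q) (hQ : Q ≤ linfty μ)
    (hinv : (linftyAction Γ μ).Invariant Q) :
    ∃ (Z : Type u) (_ : MeasurableSpace Z) (_ : StandardBorelSpace Z) (_ : MulAction Γ Z)
      (_ : MeasurableConstSMul Γ Z)
      (ν : Measure Z) (_ : IsProbabilityMeasure ν) (_ : SMulInvariantMeasure Γ Z ν)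
      (p₁ : X → Z) (p₂ : Z → X₀) (h₁ : IsFactorMap Γ p₁ μ ν),
      IsFactorMap Γ p₂ ν μ₀ ∧ p₂ ∘ p₁ = p ∧ Q = linftyOfFactor p₁ h₁.measurePreserving := by
  have : Fact ((2 : ℝ≥0∞) ≠ ∞) := ⟨by norm_num⟩
  obtain ⟨ξ, hξ⟩ := TopologicalSpace.exists_dense_seq (orbitSpace Q (oneL2 μ))
  choose T hT hTξ using fun n => (ξ n).2
  let f : ℕ → X → ℂ := fun n => T n (oneL2 μ)
  have hf : ∀ n, Q.MemFun (f n) := fun n => ⟨T n, hT n, ae_eq_refl _⟩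
  have hfm : ∀ n, Measurable (f n) := fun n => (Lp.stronglyMeasurable _).measurable
  -- `Z` is a copy of the product in the universe of `X`; structure is transported along `e`.
  obtain ⟨Z, _, _, ⟨e⟩⟩ := exists_measurableEquiv_standardBorel.{u} (X₀ × (Γ → ℕ → ℂ))
  let _ : MulAction Γ (Γ → ℕ → ℂ) := arrowAction
  let _ : MulAction Γ Z := e.toEquiv.mulAction Γ
  have hsmul : ∀ (g : Γ) (z : Z), g • z = e.symm (g • (e z).1, fun h => (e z).2 (g⁻¹ * h)) :=
    fun _ _ => rfl
  have hcs : MeasurableConstSMul Γ Z := ⟨fun g => by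
    refine e.symm.measurable.comp (Measurable.prodMk ?_ ?_)
    · exact (measurable_const_smul g).comp (measurable_fst.comp e.measurable)
    · exact measurable_pi_lambda _ fun h =>
        (measurable_pi_apply (g⁻¹ * h)).comp (measurable_snd.comp e.measurable)⟩
  let p₁ : X → Z := fun x => e.symm (p x, fun h n => f n (h⁻¹ • x))
  -- The first coordinate is measurable for the `σ`-algebra of `Q` because `L^∞(X₀) ⊆ Q`, the others
  -- because `Q` is invariant. This gives `L^∞(Z) ⊆ Q`.
  have hm' : Measurable[VonNeumannAlgebra.factorAlgebra hQ] p₁ := by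
    refine e.symm.measurable.comp (Measurable.prodMk (fun s hs => ⟨hp.measurePreserving.measurable hs,
      VonNeumannAlgebra.memFun_indicator_preimage hp.measurePreserving hQ₀ hs⟩) ?_)
    exact @measurable_pi_lambda _ _ _ (VonNeumannAlgebra.factorAlgebra hQ) _ _ fun h => 
      @measurable_pi_lambda _ _ _ (VonNeumannAlgebra.factorAlgebra hQ) _ _ fun n => 
        ((hf n).smul hQ hinv h).measurable hQ ((hfm n).comp (measurable_const_smul h⁻¹))
  have hm : Measurable p₁ := hm'.mono (VonNeumannAlgebra.factorAlgebra_le hQ) le_rfl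
  refine ⟨Z, inferInstance, inferInstance, inferInstance, hcs,
    exists_factor_of_map (p₂ := fun z => (e z).1) hp hm (fun g => ?_)
      (measurable_fst.comp e.measurable) ?_ (fun g => Eventually.of_forall fun z => ?_) ?_⟩
  · filter_upwards [hp.equivariant g] with x hx
    rw [hsmul]
    simp only [p₁, MeasurableEquiv.apply_symm_apply, hx, smul_smul, mul_inv_rev, inv_inv]
  · ext x
    simp [p₁]
  · rw [hsmul, MeasurableEquiv.apply_symm_apply]
  · refine le_antisymm (fun S hS => ?_) ?_
    -- For the converse, each `f_n` is the coordinate `(1, n)` of `p₁`, so `L^∞(Z) 1` is dense in `Q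
    -- 1` for the `2`-norm.
    · refine linfty_isTraceVector.mem_of_mem_closure (linftyOfFactor_le _ _) (hQ hS) ?_
      have hc : Continuous fun v : orbitSpace Q (oneL2 μ) => (v : Lp ℂ 2 μ) :=
        continuous_subtype_val
      suffices h : Set.MapsTo (fun v : orbitSpace Q (oneL2 μ) => (v : Lp ℂ 2 μ)) (Set.range ξ)
          (orbitSpace (linftyOfFactor p₁ (hm.measurePreserving μ)) (oneL2 μ)) by
        have key := map_mem_closure hc (hξ ⟨S (oneL2 μ), apply_mem_orbitSpace hS _⟩) h
        exact key
      rintro _ ⟨n, rfl⟩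
      beta_reduce
      rw [← hTξ n]
      refine apply_mem_orbitSpace (VonNeumannAlgebra.mem_linftyOfFactor _ (hQ (hT n))
        (f := fun z => (e z).2 1 n) ?_ (Eventually.of_forall fun x => ?_)) _
      · exact (measurable_pi_apply n).comp
          ((measurable_pi_apply 1).comp (measurable_snd.comp e.measurable))
      · simp [p₁, f]
    · exact VonNeumannAlgebra.linftyOfFactor_le_of_memFun hQ _ fun s hs => (hm' hs).2

end Models

/-! ### The theorem -/

theorem mainTheorem2 {Γ : Type w} [Group Γ] (hΓ : IsICC Γ) :
    -- tracial von Neumann algebras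
    (∀ (H : Type u) [NormedAddCommGroup H] [InnerProductSpace ℂ H] [CompleteSpace H]
      (P P₀ : VonNeumannAlgebra H) (τ : TracialState P) (σ : VNAction Γ P),
      P₀ ≤ P → σ.TracePreserving τ → σ.Invariant P₀ → σ.IsCompactExtension τ P₀ →
      ∀ N : VonNeumannAlgebra (EllTwo Γ H),
        σ.crossedProduct P₀ ≤ N → N ≤ σ.crossedProduct P →
        ∃ Q : VonNeumannAlgebra H, P₀ ≤ Q ∧ Q ≤ P ∧ σ.Invariant Q ∧ N = σ.crossedProduct Q) ∧
    -- probability measure preserving actions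
    (∀ (X : Type u) [MeasurableSpace X] [MulAction Γ X] [MeasurableConstSMul Γ X]
      (μ : Measure X) [IsProbabilityMeasure μ] [SMulInvariantMeasure Γ X μ]
      (X₀ : Type v) [MeasurableSpace X₀] [MulAction Γ X₀] [MeasurableConstSMul Γ X₀]
      (μ₀ : Measure X₀) [IsProbabilityMeasure μ₀] [SMulInvariantMeasure Γ X₀ μ₀]
      (p : X → X₀) (hp : IsFactorMap Γ p μ μ₀),
      -- ergodic compact extensions of actions give compact extensions of algebras
      (ErgodicSMul Γ X μ → IsCompactFactorMap Γ μ p →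
        (linftyAction Γ μ).IsCompactExtension (integralState μ)
          (linftyOfFactor p hp.measurePreserving)) ∧
      -- intermediate algebras come from intermediate extensions
      ((linftyAction Γ μ).IsCompactExtension (integralState μ)
          (linftyOfFactor p hp.measurePreserving) →
        ∀ N : VonNeumannAlgebra (EllTwo Γ (Lp ℂ 2 μ)),
          (linftyAction Γ μ).crossedProduct (linftyOfFactor p hp.measurePreserving) ≤ N →
          N ≤ (linftyAction Γ μ).crossedProduct (linfty μ) →
          ∃ (Z : Type u) (_ : MeasurableSpace Z) (_ : MulAction Γ Z)
            (_ : MeasurableConstSMul Γ Z) (ν : Measure Z) (_ : IsProbabilityMeasure ν)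
            (_ : SMulInvariantMeasure Γ Z ν) (p₁ : X → Z) (p₂ : Z → X₀)
            (h₁ : IsFactorMap Γ p₁ μ ν),
            IsFactorMap Γ p₂ ν μ₀ ∧ p₂ ∘ p₁ = p ∧
            (StandardBorelSpace X → StandardBorelSpace X₀ → Countable Γ →
              StandardBorelSpace Z) ∧
            N = (linftyAction Γ μ).crossedProduct
              (linftyOfFactor p₁ h₁.measurePreserving))) := by
  refine ⟨fun H _ _ _ P P₀ τ σ hP₀ hσ _ hcpt N hN₀ hN =>
    VNAction.exists_eq_crossedProduct hΓ hP₀ hσ hcpt hN₀ hN,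
    fun X _ _ _ μ _ _ X₀ _ _ _ μ₀ _ _ p hp =>
      ⟨fun _ h => h.isCompactExtension hp.measurePreserving, fun hcpt N hN₀ hN => ?_⟩⟩
  obtain ⟨Q, hQ₀, hQ, hinv, rfl⟩ := VNAction.exists_eq_crossedProduct hΓ
    (linftyOfFactor_le p hp.measurePreserving) linftyAction_tracePreserving hcpt hN₀ hN
  -- One `Z` has to satisfy the conditional standardness claim, so the model is chosen by cases; for
  -- the coarse model the claim is vacuous.
  by_cases hst : StandardBorelSpace X ∧ StandardBorelSpace X₀ ∧ Countable Γ
  · obtain ⟨_, _, _⟩ := hst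
    obtain ⟨Z, i₁, i₂, i₃, i₄, ν, i₅, i₆, p₁, p₂, h₁, h₂, hc, hQZ⟩ :=
      exists_standard_factor hp hQ₀ hQ hinv
    exact ⟨Z, i₁, i₃, i₄, ν, i₅, i₆, p₁, p₂, h₁, h₂, hc, fun _ _ _ => i₂, by rw [hQZ]⟩
  · obtain ⟨Z, i₁, i₃, i₄, ν, i₅, i₆, p₁, p₂, h₁, h₂, hc, hQZ⟩ :=
      exists_coarse_factor hp hQ₀ hQ hinv
    exact ⟨Z, i₁, i₃, i₄, ν, i₅, i₆, p₁, p₂, h₁, h₂, hc, fun a b c => (hst ⟨a, b, c⟩).elim,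
      by rw [hQZ]⟩
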